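/- Call the following multisets of orders, and the following groups of rotations of the unit sphere, by common names: (1) the $k$-gon ($k\ge 2$): orders $(k,k)$, the group of rotations of the pyramid over a regular $k$-gon (cyclic of order $k$); (2) the dihedron $D_k$ ($k\ge 2$): orders $(2,2,k)$, the group of rotations of the double pyramid over a regular $k$-gon (dihedral of order $2k$); (3) the tetrahedron: orders $(2,3,3)$, its group of rotations; (4) the cube/octahedron: orders $(2,3,4)$, its group of rotations; (5) the dodecahedron/icosahedron: orders $(2,3,5)$, its group of rotations. Here the polyhedra are centered at the origin of $\mathbb R^3$ (in (1) and (2) the heights are such that there are no symmetries besides those of the pyramid or double pyramid over a regular $k$-gon), and the group of rotations of a polyhedron consists of the orientation preserving elements of the group generated by the reflections in its symmetry planes. The rotations act on $\mathbb C\cup\{\infty\}$ through stereographic projection of the unit sphere. Let $G$ be a nontrivial finite group of automorphisms (biholomorphic self-maps) of the Riemann sphere $\mathbb C\cup\{\infty\}$. Then the quotient of the sphere by $G$ is again the Riemann sphere and has a signature: there are a surjective holomorphic map $\pi:\mathbb C\cup\{\infty\}\to\mathbb C\cup\{\infty\}$ whose fibres are exactly the orbits of $G$, a finite set $A$, and integers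 $r_a>1$ ($a\in A$) such that $\pi$ has multiplicity $r_a$ at every point over $a\in A$ and multiplicity $1$ at every point not over $A$. For every such $\pi$, with signature $(A,R)$, $R=(r_a)_{a\in A}$, the multiset $R$ is one of the multisets (1)–(5), and $G$ is conjugate, by an automorphism of the Riemann sphere, to the group of rotations of the sphere with the same name as $R$. -/

import Mathlib

noncomputable section

namespace RiemannSphere

open scoped Manifold OnePoint Topology
open Filter Set

/-! ### The Riemann sphere `ℂ ∪ {∞}` as a complex manifold -/

/-- The function `z ↦ 1 / z` on the sphere `ℂ ∪ {∞}`, which exchanges `0` and `∞`. -/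
def invFun : OnePoint ℂ → OnePoint ℂ
  | ∞ => ((0 : ℂ) : OnePoint ℂ)
  | (z : ℂ) => if z = 0 then ∞ else ((z⁻¹ : ℂ) : OnePoint ℂ)

theorem invFun_infty : invFun ∞ = ((0 : ℂ) : OnePoint ℂ) := rfl

theorem invFun_coe (z : ℂ) :
    invFun (z : OnePoint ℂ) = if z = 0 then ∞ else ((z⁻¹ : ℂ) : OnePoint ℂ) := rfl

theorem invFun_zero : invFun ((0 : ℂ) : OnePoint ℂ) = ∞ := by simp [invFun_coe]

theorem invFun_coe_of_ne {z : ℂ} (hz : z ≠ 0) :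
    invFun (z : OnePoint ℂ) = ((z⁻¹ : ℂ) : OnePoint ℂ) := by simp [invFun_coe, hz]

theorem invFun_invFun (p : OnePoint ℂ) : invFun (invFun p) = p := by
  induction p using OnePoint.rec with
  | infty => rw [invFun_infty, invFun_zero]
  | coe z =>
    by_cases hz : z = 0
    · subst hz; rw [invFun_zero, invFun_infty]
    · rw [invFun_coe_of_ne hz, invFun_coe_of_ne (inv_ne_zero hz), inv_inv]

theorem continuous_invFun : Continuous invFun := by
  rw [continuous_iff_continuousAt]
  intro p
  induction p using OnePoint.rec with
  | infty =>
    rw [OnePoint.continuousAt_infty', invFun_infty, coclosedCompact_eq_cocompact,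
      ← Metric.cobounded_eq_cocompact]
    have h : Tendsto (fun z : ℂ => ((z⁻¹ : ℂ) : OnePoint ℂ)) (Bornology.cobounded ℂ)
        (𝓝 ((0 : ℂ) : OnePoint ℂ)) :=
      (OnePoint.continuous_coe.tendsto (0 : ℂ)).comp tendsto_inv₀_cobounded
    refine h.congr' ?_
    filter_upwards [Bornology.eventually_ne_cobounded (0 : ℂ)] with z hz
    exact (invFun_coe_of_ne hz).symm
  | coe z =>
    rw [OnePoint.continuousAt_coe]
    by_cases hz : z = 0
    · subst hz
      rw [continuousAt_iff_punctured_nhds]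
      have h : Tendsto (fun z : ℂ => ((z⁻¹ : ℂ) : OnePoint ℂ)) (𝓝[≠] 0) (𝓝 ∞) := by
        refine OnePoint.tendsto_coe_infty.comp ?_
        rw [coclosedCompact_eq_cocompact, ← Metric.cobounded_eq_cocompact]
        exact tendsto_inv₀_nhdsNE_zero
      simp only [Function.comp_apply, invFun_zero]
      refine h.congr' ?_
      filter_upwards [self_mem_nhdsWithin] with w hw
      exact (invFun_coe_of_ne hw).symm
    · have h : ContinuousAt (fun z : ℂ => ((z⁻¹ : ℂ) : OnePoint ℂ)) z :=
        OnePoint.continuous_coe.continuousAt.comp (continuousAt_inv₀ hz)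
      refine h.congr ?_
      filter_upwards [isOpen_ne.mem_nhds hz] with w hw
      exact (invFun_coe_of_ne hw).symm

/-- The homeomorphism `z ↦ 1 / z` of the sphere. -/
def inversion : OnePoint ℂ ≃ₜ OnePoint ℂ where
  toFun := invFun
  invFun := invFun
  left_inv := invFun_invFun
  right_inv := invFun_invFun
  continuous_toFun := continuous_invFun
  continuous_invFun := continuous_invFun

/-- The affine coordinate `z` on `ℂ`. -/
def chartFinite : OpenPartialHomeomorph (OnePoint ℂ) ℂ :=
  ((OnePoint.isOpenEmbedding_coe (X := ℂ)).toOpenPartialHomeomorph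
    ((↑) : ℂ → OnePoint ℂ)).symm

/-- The coordinate `1 / z` near `∞`. -/
def chartInfinity : OpenPartialHomeomorph (OnePoint ℂ) ℂ :=
  inversion.toOpenPartialHomeomorph.trans chartFinite

theorem chartFinite_source : chartFinite.source = {∞}ᶜ := by
  simp [chartFinite, ← OnePoint.compl_infty]

theorem chartFinite_target : chartFinite.target = univ := by
  simp [chartFinite]

theorem chartFinite_coe (z : ℂ) : chartFinite (z : OnePoint ℂ) = z := by
  have h := (OnePoint.isOpenEmbedding_coe (X := ℂ)).toOpenPartialHomeomorph_left_inv
    ((↑) : ℂ → OnePoint ℂ) (x := z)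
  simpa [chartFinite] using h

theorem chartFinite_symm_apply (z : ℂ) : chartFinite.symm z = (z : OnePoint ℂ) := by
  simp [chartFinite]

theorem chartInfinity_source :
    chartInfinity.source = {((0 : ℂ) : OnePoint ℂ)}ᶜ := by
  ext p
  simp only [chartInfinity, OpenPartialHomeomorph.trans_source, chartFinite_source]
  induction p using OnePoint.rec with
  | infty => simp [inversion, invFun_infty]
  | coe z => by_cases hz : z = 0 <;> simp [inversion, invFun_coe, hz]

theorem chartInfinity_target : chartInfinity.target = univ := by
  simp [chartInfinity, chartFinite_target]

theorem chartInfinity_apply (p : OnePoint ℂ) : chartInfinity p = chartFinite (invFun p) := rfl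

theorem chartInfinity_symm_apply (z : ℂ) :
    chartInfinity.symm z = invFun (z : OnePoint ℂ) := by
  change invFun (chartFinite.symm z) = _
  rw [chartFinite_symm_apply]

open Classical in
/-- The complex atlas of the Riemann sphere: the coordinates `z` and `1 / z`. -/
instance : ChartedSpace ℂ (OnePoint ℂ) where
  atlas := {chartFinite, chartInfinity}
  chartAt p := if p = ∞ then chartInfinity else chartFinite
  mem_chart_source p := by
    by_cases hp : p = ∞
    · simp [hp, chartInfinity_source]
    · simp [hp, chartFinite_source]
  chart_mem_atlas p := by
    by_cases hp : p = ∞ <;> simp [hp]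

/-- The atlas is holomorphic (the order of smoothness `⊤` means analytic). -/
instance : IsManifold 𝓘(ℂ) ⊤ (OnePoint ℂ) := by
  refine isManifold_of_contDiffOn _ _ _ ?_
  have key : ∀ (f : ℂ → ℂ) (s : Set ℂ), (∀ z ∈ s, z ≠ 0) → (∀ z ∈ s, f z = z⁻¹) →
      ContDiffOn ℂ ⊤ f s := fun f s h0 hf =>
    (contDiffOn_inv ℂ (𝕜' := ℂ)).congr_mono (f₁ := f) (fun z hz => hf z hz) (fun z hz => h0 z hz)
  intro e e' he he'
  rcases he with rfl | rfl <;> rcases he' with rfl | rfl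
  · refine contDiffOn_id.congr fun z _ => ?_
    simp [chartFinite_symm_apply, chartFinite_coe]
  · refine key _ _ (fun z hz => ?_) (fun z hz => ?_)
    all_goals
      have h0 : z ≠ 0 := by
        simpa [chartFinite_symm_apply, chartInfinity_source, chartFinite_target] using hz
    · exact h0
    · simp [chartFinite_symm_apply, chartInfinity_apply, invFun_coe_of_ne h0, chartFinite_coe]
  · refine key _ _ (fun z hz => ?_) (fun z hz => ?_)
    all_goals
      have h0 : z ≠ 0 := by
        rintro rfl
        simp [chartInfinity_symm_apply, chartFinite_source, invFun_zero] at hz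
    · exact h0
    · simp [chartInfinity_symm_apply, invFun_coe_of_ne h0, chartFinite_coe]
  · refine contDiffOn_id.congr fun z _ => ?_
    simp [chartInfinity_symm_apply, chartInfinity_apply, invFun_invFun, chartFinite_coe]

/-- The group of automorphisms of the Riemann sphere: its biholomorphic self-maps. -/
def automorphismGroup : Subgroup (Equiv.Perm (OnePoint ℂ)) where
  carrier := {f | MDifferentiable 𝓘(ℂ) 𝓘(ℂ) (f : OnePoint ℂ → OnePoint ℂ) ∧
    MDifferentiable 𝓘(ℂ) 𝓘(ℂ) (f.symm : OnePoint ℂ → OnePoint ℂ)}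
  mul_mem' := fun hf hg => ⟨hf.1.comp hg.1, hg.2.comp hf.2⟩
  one_mem' := ⟨mdifferentiable_id, mdifferentiable_id⟩
  inv_mem' := fun hf => ⟨hf.2, hf.1⟩

/-! ### Quotient coverings and signatures -/

/-- The multiplicity of a holomorphic map `π` at the point `p`: the order of vanishing at `p` of
`π - π p`, computed in the charts at `p` and at `π p`. -/
def localMultiplicity (π : OnePoint ℂ → OnePoint ℂ) (p : OnePoint ℂ) : ℕ∞ :=
  analyticOrderAt
    (fun w => chartAt ℂ (π p) (π ((chartAt ℂ p).symm w)) - chartAt ℂ (π p) (π p))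
    (chartAt ℂ p p)

/-- `π` realizes the quotient of the Riemann sphere by the group `G`, the quotient being
identified with the Riemann sphere: `π` is holomorphic and onto, and its fibres are exactly the
orbits of `G`. -/
structure IsQuotientMap (G : Subgroup (Equiv.Perm (OnePoint ℂ)))
    (π : OnePoint ℂ → OnePoint ℂ) : Prop where
  holomorphic : MDifferentiable 𝓘(ℂ) 𝓘(ℂ) π
  surjective : Function.Surjective π
  fibres : ∀ p q, π p = π q ↔ ∃ g ∈ G, g p = q

/-- The branched covering `π` of the Riemann sphere by the (simply connected) Riemann sphere is a
universal covering with signature `(A, R)`, where `A` is the branching locus and `R` consists of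
the orders `r a > 1`, `a ∈ A`: the multiplicity of `π` equals `r a` at *every* point over `a ∈ A`
(so the local monodromy at `a` is a product of `r a`-cycles, of order `r a`), and `π` is
unramified over the complement of `A`. -/
structure HasSignature (π : OnePoint ℂ → OnePoint ℂ) (A : Finset (OnePoint ℂ))
    (r : OnePoint ℂ → ℕ) : Prop where
  one_lt : ∀ a ∈ A, 1 < r a
  branched : ∀ p, π p ∈ A → localMultiplicity π p = r (π p)
  unbranched : ∀ p, π p ∉ A → localMultiplicity π p = 1

/-! ### Rotations of the sphere -/

/-- Euclidean three-space. -/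
abbrev E3 : Type := EuclideanSpace ℝ (Fin 3)

/-- The unit sphere in three-space. -/
abbrev S2 : Type := Metric.sphere (0 : E3) 1

theorem mem_S2_iff (x : E3) :
    x ∈ Metric.sphere (0 : E3) 1 ↔ x 0 ^ 2 + x 1 ^ 2 + x 2 ^ 2 = 1 := by
  rw [mem_sphere_zero_iff_norm, EuclideanSpace.norm_eq, Real.sqrt_eq_one]
  simp [Fin.sum_univ_three]

/-- The north pole `(0, 0, 1)`. -/
def northPole : S2 := ⟨!₂[0, 0, 1], by rw [mem_S2_iff]; simp⟩

open Classical in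
/-- Stereographic projection from the north pole, `(x, y, t) ↦ (x + i y) / (1 - t)`. -/
def stereoFun (x : S2) : OnePoint ℂ :=
  if x = northPole then ∞ else
    (((⟨x.1 0 / (1 - x.1 2), x.1 1 / (1 - x.1 2)⟩ : ℂ)) : OnePoint ℂ)

theorem stereoInv_aux (z : ℂ) :
    (!₂[2 * z.re / (Complex.normSq z + 1), 2 * z.im / (Complex.normSq z + 1),
      (Complex.normSq z - 1) / (Complex.normSq z + 1)] : E3) ∈ Metric.sphere (0 : E3) 1 := by
  rw [mem_S2_iff]
  have h : Complex.normSq z + 1 ≠ 0 := by positivity [Complex.normSq_nonneg z]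
  simp only [Matrix.cons_val]
  field_simp
  rw [Complex.normSq_apply]
  ring

/-- The inverse of stereographic projection. -/
def stereoInv : OnePoint ℂ → S2
  | ∞ => northPole
  | (z : ℂ) => ⟨_, stereoInv_aux z⟩

theorem eq_northPole {x : S2} (h : x.1 2 = 1) : x = northPole := by
  have hx := (mem_S2_iff x.1).1 x.2
  rw [h] at hx
  have h0 : x.1 0 = 0 := by nlinarith [sq_nonneg (x.1 0), sq_nonneg (x.1 1)]
  have h1 : x.1 1 = 0 := by nlinarith [sq_nonneg (x.1 0), sq_nonneg (x.1 1)]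
  apply Subtype.ext
  ext i
  fin_cases i <;> simp [northPole, h0, h1, h]

/-- Stereographic projection as the identification of the unit sphere with `ℂ ∪ {∞}`. -/
def stereo : S2 ≃ OnePoint ℂ where
  toFun := stereoFun
  invFun := stereoInv
  left_inv x := by
    by_cases hx : x = northPole
    · simp [stereoFun, hx, stereoInv]
    · have h2 : 1 - x.1 2 ≠ 0 := fun h => hx (eq_northPole (by linarith))
      have hs := (mem_S2_iff x.1).1 x.2
      have hn : Complex.normSq ⟨x.1 0 / (1 - x.1 2), x.1 1 / (1 - x.1 2)⟩
          = (1 + x.1 2) / (1 - x.1 2) := by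
        rw [Complex.normSq_mk]
        field_simp
        linarith
      have hn1 : (1 + x.1 2) / (1 - x.1 2) + 1 = 2 / (1 - x.1 2) := by field_simp; ring
      have hn2 : (1 + x.1 2) / (1 - x.1 2) - 1 = 2 * x.1 2 / (1 - x.1 2) := by field_simp; ring
      rw [stereoFun, if_neg hx]
      apply Subtype.ext
      simp only [stereoInv, hn, hn1, hn2]
      ext i
      fin_cases i <;> simp <;> field_simp
  right_inv p := by
    induction p using OnePoint.rec with
    | infty => simp [stereoInv, stereoFun]
    | coe z =>
      have h : Complex.normSq z + 1 ≠ 0 := by positivity [Complex.normSq_nonneg z]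
      have ht : 1 - (Complex.normSq z - 1) / (Complex.normSq z + 1)
          = 2 / (Complex.normSq z + 1) := by field_simp; ring
      have hne : stereoInv (z : OnePoint ℂ) ≠ northPole := by
        intro he
        have h2 := congrArg (fun x : S2 => x.1 2) he
        simp [stereoInv, northPole] at h2
        rw [div_eq_one_iff_eq h] at h2
        linarith
      rw [stereoFun, if_neg hne]
      congr 1
      apply Complex.ext <;> simp [stereoInv, ht] <;> field_simp

/-- The permutation of the unit sphere induced by a linear isometry of three-space. -/
def isometryOnSphere (ρ : E3 ≃ₗᵢ[ℝ] E3) : Equiv.Perm S2 :=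
  ρ.toEquiv.subtypeEquiv fun x => by simp

/-- The action of the linear isometries of three-space on `ℂ ∪ {∞}`, the latter being identified
with the unit sphere by stereographic projection. -/
def isometryAction : (E3 ≃ₗᵢ[ℝ] E3) →* Equiv.Perm (OnePoint ℂ) where
  toFun ρ := stereo.permCongr (isometryOnSphere ρ)
  map_one' := by
    ext p
    simp [isometryOnSphere]
  map_mul' ρ σ := by
    ext p
    simp [isometryOnSphere]

/-- The orientation preserving linear isometries of three-space, i.e. the rotations. -/
def rotations : Subgroup (E3 ≃ₗᵢ[ℝ] E3) where
  carrier := {ρ | LinearMap.det (ρ.toLinearEquiv : E3 →ₗ[ℝ] E3) = 1}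
  mul_mem' := fun {a b} ha hb => by
    have h : ((a * b).toLinearEquiv : E3 →ₗ[ℝ] E3)
        = (a.toLinearEquiv : E3 →ₗ[ℝ] E3) * (b.toLinearEquiv : E3 →ₗ[ℝ] E3) := rfl
    simp only [mem_ofPred_eq] at *
    rw [h, map_mul, ha, hb, one_mul]
  one_mem' := LinearMap.det_id
  inv_mem' := fun {a} ha => by
    have h : (a⁻¹.toLinearEquiv : E3 →ₗ[ℝ] E3) * (a.toLinearEquiv : E3 →ₗ[ℝ] E3) = 1 := by
      ext1 x
      exact a.symm_apply_apply x
    simp only [mem_ofPred_eq] at *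
    have h' := congrArg LinearMap.det h
    rw [map_mul, ha, mul_one] at h'
    rw [h']
    exact LinearMap.det_id

/-! ### The polyhedra, their rotation groups and their sets of orders -/

/-- The reflections in the symmetry planes (through the origin) of the polyhedron with vertex set
`V`; a plane is given by a normal vector `v`. -/
def symmetryReflections (V : Set E3) : Set (E3 ≃ₗᵢ[ℝ] E3) :=
  {s | ∃ v : E3, v ≠ 0 ∧ s = (Submodule.span ℝ {v})ᗮ.reflection ∧ s '' V = V}

/-- The group of rotations defined by the polyhedron with vertex set `V`: the orientation
preserving elements of the group generated by the reflections in its symmetry planes. -/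
def polyhedronRotationGroup (V : Set E3) : Subgroup (E3 ≃ₗᵢ[ℝ] E3) :=
  Subgroup.closure (symmetryReflections V) ⊓ rotations

/-- The pyramid over the regular `k`-gon, with center of mass at the origin. -/
def pyramid (k : ℕ) : Set E3 :=
  {v | ∃ j : ℕ, v = !₂[Real.cos (2 * Real.pi * j / k), Real.sin (2 * Real.pi * j / k), -1]} ∪
    {!₂[0, 0, 3]}

/-- The dihedron: two pyramids joined along their common base, a regular `k`-gon. The apexes are
at height `2` so that for `k = 4` one does not obtain a regular octahedron. -/
def dihedron (k : ℕ) : Set E3 :=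
  {v | ∃ j : ℕ, v = !₂[Real.cos (2 * Real.pi * j / k), Real.sin (2 * Real.pi * j / k), 0]} ∪
    {!₂[0, 0, 2], !₂[0, 0, -2]}

/-- The regular tetrahedron. -/
def tetrahedron : Set E3 :=
  {!₂[1, 1, 1], !₂[1, -1, -1], !₂[-1, 1, -1], !₂[-1, -1, 1]}

/-- The regular octahedron. -/
def octahedron : Set E3 :=
  {!₂[1, 0, 0], !₂[-1, 0, 0], !₂[0, 1, 0], !₂[0, -1, 0], !₂[0, 0, 1], !₂[0, 0, -1]}

/-- The regular icosahedron. -/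
def icosahedron : Set E3 :=
  {v | ∃ a b : ℝ, (a = 1 ∨ a = -1) ∧ (b = Real.goldenRatio ∨ b = -Real.goldenRatio) ∧
    (v = !₂[0, a, b] ∨ v = !₂[a, b, 0] ∨ v = !₂[b, 0, a])}

/-- The common names of the elliptic sets of orders and of the groups of rotations. -/
inductive Name : Type
  | kGon (k : ℕ)
  | dihedron (k : ℕ)
  | tetrahedron
  | octahedron
  | icosahedron

/-- The set of orders (with repetitions) with the given name. -/
def Name.orders : Name → Multiset ℕ
  | .kGon k => {k, k}
  | .dihedron k => {2, 2, k}
  | .tetrahedron => {2, 3, 3}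
  | .octahedron => {2, 3, 4}
  | .icosahedron => {2, 3, 5}

/-- The polyhedron with the given name. -/
def Name.polyhedron : Name → Set E3
  | .kGon k => RiemannSphere.pyramid k
  | .dihedron k => RiemannSphere.dihedron k
  | .tetrahedron => RiemannSphere.tetrahedron
  | .octahedron => RiemannSphere.octahedron
  | .icosahedron => RiemannSphere.icosahedron

/-- The group of rotations with the given name. -/
def Name.rotationGroup (N : Name) : Subgroup (E3 ≃ₗᵢ[ℝ] E3) :=
  polyhedronRotationGroup N.polyhedron

end RiemannSphere

end

/-!
Every automorphism of the sphere is a Möbius transformation, so it is determined by its values at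
three points, and a nontrivial element of `G` has only finitely many fixed points.

*The quotient.* For a point `a` with trivial stabilizer, outside the orbit of `∞`, the function
`∏ g, (g p - a)` is invariant and of degree `|G|`, hence separates the orbits
(`isQuotientMap_orbitMap`). In a local coordinate in which a quotient map `π` is an `m`-th power,
the nearby points of a fibre differ by `m`-th roots of unity on one hand and by elements of the
stabilizer on the other, so the multiplicity is the order of the stabilizer
(`IsQuotientMap.localMultiplicity_eq`). In particular it is constant on fibres, and the signature
exists.

*The orders.* Each nontrivial element of `G` has exactly two fixed points. Counting the pairs of a
nontrivial element and a fixed point gives the Riemann–Hurwitz formula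
`∑ (1 - 1 / r a) = 2 - 2 / |G|` (`sum_one_sub_inv`), whose solutions are the five types
(`signature_cases`).

*Conjugacy.* In the first two types there is a point with an orbit of size one or two. When that
orbit is moved into `{0, ∞}`, the group consists of the maps `z ↦ c z`, and possibly `z ↦ c / z`,
with `c ^ k = 1`. In the last three types let `s = 3, 4, 5` be the largest order. The
formula shows that a finite group containing `G` with a stabilizer at least as large and the same
orbit cannot be larger than `G`, so `G` is the full group of automorphisms preserving the orbit
with stabilizers of order `s` (`eq_setStabilizer_orbit`). With one point of the orbit at `0` and the
second fixed point of its stabilizer at `∞`, the stabilizer acts by `s`-th roots of unity, and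
this determines the orbit up to an automorphism: the icosahedral orbit consists of `0`, `∞` and two
pentagons, whose ratio is found from the rotation around a third vertex
(`orbit_eq_doublePentagon`). Hence two groups with the same `s` and the same orbit size are
conjugate (`exists_conjugate_eq_of_vertexData`).

*The polyhedra.* A reflection of three-space acts on the sphere as a Möbius transformation composed
with complex conjugation, so the rotation groups of the polyhedra act by automorphisms
(`isometryAction_mem`). For the pyramid and the dihedron these automorphisms are computed. For the
other solids it is enough to exhibit mirrors: the product of two of them is a rotation of order `s`
around a vertex that has at least three images, and the possible signatures leave only one orbit
size.
-/
namespace RiemannSphere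

open scoped Manifold OnePoint Topology
open Filter Set

/-! ### Holomorphic maps of the sphere -/

instance : IsManifold 𝓘(ℂ) 1 (OnePoint ℂ) :=
  IsManifold.of_le (n := ⊤) le_top

/-- The finite coordinate of a point of the sphere, with the value `0` at `∞`. -/
def finitePart (p : OnePoint ℂ) : ℂ := p.elim 0 id

@[simp] theorem finitePart_coe (z : ℂ) : finitePart (z : OnePoint ℂ) = z := rfl

theorem coe_finitePart {p : OnePoint ℂ} (hp : p ≠ ∞) : (finitePart p : OnePoint ℂ) = p := by
  induction p using OnePoint.rec with
  | infty => exact absurd rfl hp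
  | coe z => rfl

theorem chartFinite_mem_atlas : chartFinite ∈ atlas ℂ (OnePoint ℂ) := Or.inl rfl

theorem chartInfinity_mem_atlas : chartInfinity ∈ atlas ℂ (OnePoint ℂ) := Or.inr rfl

theorem mdifferentiable_coe :
    MDifferentiable 𝓘(ℂ) 𝓘(ℂ) ((↑) : ℂ → OnePoint ℂ) := by
  intro z
  have h := mdifferentiableAt_atlas_symm (I := 𝓘(ℂ)) chartFinite_mem_atlas (x := z)
    (by simp [chartFinite_target])
  exact h.congr_of_eventuallyEq (Eventually.of_forall fun w => (chartFinite_symm_apply w).symm)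

theorem finitePart_eventuallyEq {p : OnePoint ℂ} (hp : p ≠ ∞) :
    finitePart =ᶠ[𝓝 p] chartFinite := by
  filter_upwards [isOpen_ne.mem_nhds hp] with q hq
  conv_rhs => rw [← coe_finitePart hq, chartFinite_coe]

theorem mdifferentiableAt_finitePart {p : OnePoint ℂ} (hp : p ≠ ∞) :
    MDifferentiableAt 𝓘(ℂ) 𝓘(ℂ) finitePart p := by
  have h := mdifferentiableAt_atlas (I := 𝓘(ℂ)) chartFinite_mem_atlas (x := p)
    (by simpa [chartFinite_source] using hp)
  exact h.congr_of_eventuallyEq (finitePart_eventuallyEq hp)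

theorem mdifferentiableAt_coe_iff {f : OnePoint ℂ → OnePoint ℂ} {z : ℂ} :
    MDifferentiableAt 𝓘(ℂ) 𝓘(ℂ) f (z : OnePoint ℂ) ↔
      MDifferentiableAt 𝓘(ℂ) 𝓘(ℂ) (fun w : ℂ => f w) z := by
  refine ⟨fun h => h.comp z (mdifferentiable_coe z), fun h => ?_⟩
  have h1 : MDifferentiableAt 𝓘(ℂ) 𝓘(ℂ) ((fun w : ℂ => f w) ∘ finitePart) (z : OnePoint ℂ) :=
    MDifferentiableAt.comp (z : OnePoint ℂ) (by simpa using h)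
      (mdifferentiableAt_finitePart (OnePoint.coe_ne_infty z))
  refine h1.congr_of_eventuallyEq ?_
  filter_upwards [isOpen_ne.mem_nhds (OnePoint.coe_ne_infty z)] with q hq
  simp [coe_finitePart hq]

/-- A map with values in the finite plane is holomorphic as a map to the sphere iff it is
holomorphic as a function. -/
theorem mdifferentiableAt_coe_comp {h : ℂ → ℂ} {z : ℂ} :
    MDifferentiableAt 𝓘(ℂ) 𝓘(ℂ) (fun w => (h w : OnePoint ℂ)) z ↔ DifferentiableAt ℂ h z := by
  refine ⟨fun H => ?_, fun H => ?_⟩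
  · have := (mdifferentiableAt_finitePart (OnePoint.coe_ne_infty (h z))).comp z H
    exact mdifferentiableAt_iff_differentiableAt.1 this
  · exact (mdifferentiable_coe (h z)).comp z H.mdifferentiableAt

theorem mdifferentiableAt_invFun_of_ne_zero {p : OnePoint ℂ} (hp : p ≠ (0 : ℂ)) :
    MDifferentiableAt 𝓘(ℂ) 𝓘(ℂ) invFun p := by
  have h := mdifferentiableAt_atlas (I := 𝓘(ℂ)) chartInfinity_mem_atlas (x := p)
    (by simpa [chartInfinity_source] using hp)
  have h2 := (mdifferentiable_coe (chartInfinity p)).comp p h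
  refine h2.congr_of_eventuallyEq ?_
  filter_upwards [isOpen_ne.mem_nhds hp] with q hq
  have hq' : invFun q ≠ ∞ := fun h => hq (by rw [← invFun_invFun q, h, invFun_infty])
  simp only [Function.comp, chartInfinity_apply]
  conv_rhs => rw [← coe_finitePart hq', chartFinite_coe]
  rw [coe_finitePart hq']

theorem mdifferentiable_invFun : MDifferentiable 𝓘(ℂ) 𝓘(ℂ) invFun := by
  intro p
  by_cases hp : p = ((0 : ℂ) : OnePoint ℂ)
  · subst hp
    rw [mdifferentiableAt_coe_iff]
    have h := mdifferentiableAt_atlas_symm (I := 𝓘(ℂ)) chartInfinity_mem_atlas (x := 0)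
      (by simp [chartInfinity_target])
    exact h.congr_of_eventuallyEq
      (Eventually.of_forall fun w => (chartInfinity_symm_apply w).symm)
  · exact mdifferentiableAt_invFun_of_ne_zero hp

theorem mdifferentiableAt_infty_iff {f : OnePoint ℂ → OnePoint ℂ} :
    MDifferentiableAt 𝓘(ℂ) 𝓘(ℂ) f ∞ ↔
      MDifferentiableAt 𝓘(ℂ) 𝓘(ℂ) (fun w : ℂ => f (invFun w)) 0 := by
  rw [← mdifferentiableAt_coe_iff (f := fun p => f (invFun p))]
  constructor
  · intro h
    refine MDifferentiableAt.comp ((0 : ℂ) : OnePoint ℂ) ?_ (mdifferentiable_invFun _)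
    rwa [invFun_zero]
  · intro h
    have := MDifferentiableAt.comp (I' := 𝓘(ℂ)) (∞ : OnePoint ℂ) (g := fun p => f (invFun p))
      (f := invFun) (by rwa [invFun_infty]) (mdifferentiable_invFun _)
    refine this.congr_of_eventuallyEq (Eventually.of_forall fun q => ?_)
    simp [invFun_invFun]

theorem inversion_mem : inversion.toEquiv ∈ automorphismGroup :=
  ⟨mdifferentiable_invFun, mdifferentiable_invFun⟩

/-- The point `[n : d]` of the sphere, that is `n / d` with the value `∞` for `d = 0`. -/
noncomputable def ratio (n d : ℂ) : OnePoint ℂ := if d = 0 then ∞ else ((n / d : ℂ) : OnePoint ℂ)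

theorem ratio_of_ne {n d : ℂ} (h : d ≠ 0) : ratio n d = ((n / d : ℂ) : OnePoint ℂ) := if_neg h

theorem ratio_zero (n : ℂ) : ratio n 0 = ∞ := if_pos rfl

theorem ratio_one (n : ℂ) : ratio n 1 = n := by simp [ratio]

theorem ratio_eq_infty {n d : ℂ} : ratio n d = ∞ ↔ d = 0 := by
  unfold ratio; split_ifs with h <;> simp [h]

theorem invFun_ratio {n d : ℂ} (h : n ≠ 0 ∨ d ≠ 0) : invFun (ratio n d) = ratio d n := by
  by_cases hd : d = 0
  · have hn : n ≠ 0 := by simpa [hd] using h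
    simp [hd, ratio_zero, invFun_infty, ratio_of_ne hn]
  · by_cases hn : n = 0
    · rw [hn, ratio_zero, ratio_of_ne hd, zero_div, invFun_zero]
    · rw [ratio_of_ne hd, ratio_of_ne hn, invFun_coe_of_ne (div_ne_zero hn hd), inv_div]

theorem invFun_coe_eq_ratio (z : ℂ) : invFun z = ratio 1 z := by
  rw [← invFun_ratio (n := z) (d := 1) (Or.inr one_ne_zero), ratio_one]

theorem ratio_mul_left {k : ℂ} (hk : k ≠ 0) (n d : ℂ) : ratio (k * n) (k * d) = ratio n d := by
  by_cases hd : d = 0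
  · simp [hd, ratio_zero]
  · rw [ratio_of_ne hd, ratio_of_ne (mul_ne_zero hk hd), mul_div_mul_left _ _ hk]

theorem mdifferentiableAt_ratio {n d : ℂ → ℂ} {z : ℂ} (hn : DifferentiableAt ℂ n z)
    (hd : DifferentiableAt ℂ d z) (h : n z ≠ 0 ∨ d z ≠ 0) :
    MDifferentiableAt 𝓘(ℂ) 𝓘(ℂ) (fun w => ratio (n w) (d w)) z := by
  have key : ∀ {n d : ℂ → ℂ}, DifferentiableAt ℂ n z → DifferentiableAt ℂ d z → d z ≠ 0 →
      MDifferentiableAt 𝓘(ℂ) 𝓘(ℂ) (fun w => ratio (n w) (d w)) z := by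
    intro n d hn hd h
    refine (mdifferentiableAt_coe_comp.2 (hn.div hd h)).congr_of_eventuallyEq ?_
    filter_upwards [hd.continuousAt.eventually_ne h] with w hw
    simp [ratio_of_ne hw]
  rcases h with h | h
  · refine ((mdifferentiable_invFun _).comp z (key hd hn h)).congr_of_eventuallyEq ?_
    filter_upwards [hn.continuousAt.eventually_ne h] with w hw
    exact (invFun_ratio (Or.inr hw)).symm
  · exact key hn hd h

theorem smul_coe_eq_ratio (g : GL (Fin 2) ℂ) (z : ℂ) :
    g • (z : OnePoint ℂ) = ratio (g 0 0 * z + g 0 1) (g 1 0 * z + g 1 1) := by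
  rw [OnePoint.smul_some_eq_ite]; rfl

theorem smul_infty_eq_ratio (g : GL (Fin 2) ℂ) :
    g • (∞ : OnePoint ℂ) = ratio (g 0 0) (g 1 0) := by
  rw [OnePoint.smul_infty_eq_ite]; rfl

theorem det_entries_ne_zero (g : GL (Fin 2) ℂ) : g 0 0 * g 1 1 - g 0 1 * g 1 0 ≠ 0 := by
  have := g.det_ne_zero
  rwa [Matrix.det_fin_two] at this

theorem mdifferentiable_smul (g : GL (Fin 2) ℂ) :
    MDifferentiable 𝓘(ℂ) 𝓘(ℂ) (fun p : OnePoint ℂ => g • p) := by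
  have hdet := det_entries_ne_zero g
  intro p
  induction p using OnePoint.rec with
  | infty =>
    rw [mdifferentiableAt_infty_iff]
    have h : MDifferentiableAt 𝓘(ℂ) 𝓘(ℂ)
        (fun w => ratio (g 0 0 + g 0 1 * w) (g 1 0 + g 1 1 * w)) 0 := by
      refine mdifferentiableAt_ratio (by fun_prop) (by fun_prop) ?_
      by_contra! H
      simp only [mul_zero, add_zero] at H
      exact hdet (by rw [H.1, H.2]; ring)
    refine h.congr_of_eventuallyEq (Eventually.of_forall fun w => ?_)
    by_cases hw : w = 0
    · simp [hw, invFun_zero, smul_infty_eq_ratio]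
    · simp only [invFun_coe_of_ne hw]
      rw [smul_coe_eq_ratio, ← ratio_mul_left hw]
      congr 1 <;> field_simp
  | coe z =>
    rw [mdifferentiableAt_coe_iff]
    simp only [smul_coe_eq_ratio]
    refine mdifferentiableAt_ratio (by fun_prop) (by fun_prop) ?_
    by_contra! H
    exact hdet (by linear_combination (-g 1 0) * H.1 + g 0 0 * H.2)

/-- The Möbius transformation defined by an invertible matrix. -/
noncomputable def mobius : GL (Fin 2) ℂ →* Equiv.Perm (OnePoint ℂ) := MulAction.toPermHom _ _

theorem mobius_apply (g : GL (Fin 2) ℂ) (p : OnePoint ℂ) : mobius g p = g • p := rfl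

theorem mobius_mem (g : GL (Fin 2) ℂ) : mobius g ∈ automorphismGroup := by
  refine ⟨mdifferentiable_smul g, ?_⟩
  have h : ((mobius g).symm : OnePoint ℂ → OnePoint ℂ) = fun p => g⁻¹ • p := by
    ext1 p; rfl
  rw [h]
  exact mdifferentiable_smul g⁻¹

theorem exists_mobius {a b c d : ℂ} (h : a * d - b * c ≠ 0) :
    ∃ f ∈ automorphismGroup, f ∞ = ratio a c ∧ ∀ z : ℂ, f z = ratio (a * z + b) (c * z + d) := by
  refine ⟨mobius (Matrix.GeneralLinearGroup.mkOfDetNeZero !![a, b; c, d]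
    (by simpa [Matrix.det_fin_two] using h)), mobius_mem _, ?_, fun z => ?_⟩
  · rw [mobius_apply, smul_infty_eq_ratio]; rfl
  · rw [mobius_apply, smul_coe_eq_ratio]; rfl

/-! ### Automorphisms of the sphere are Möbius transformations -/

theorem perm_inv_apply {α : Type*} (f : Equiv.Perm α) (x : α) : f⁻¹ (f x) = x :=
  f.symm_apply_apply x

theorem perm_apply_inv {α : Type*} (f : Equiv.Perm α) (x : α) : f (f⁻¹ x) = x :=
  f.apply_symm_apply x

theorem apply_coe_ne_infty {f : Equiv.Perm (OnePoint ℂ)} (h : f ∞ = ∞) (z : ℂ) :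
    f (z : OnePoint ℂ) ≠ ∞ := fun hz =>
  OnePoint.coe_ne_infty z (f.injective (hz.trans h.symm))

theorem differentiable_finitePart {f : Equiv.Perm (OnePoint ℂ)} (hf : f ∈ automorphismGroup)
    (h : f ∞ = ∞) : Differentiable ℂ (fun z : ℂ => finitePart (f z)) := by
  intro z
  refine mdifferentiableAt_coe_comp.1 ?_
  simp only [coe_finitePart (apply_coe_ne_infty h _)]
  exact mdifferentiableAt_coe_iff.1 (hf.1 z)

/-- An automorphism fixing `0` and `∞` is a scaling: if it is `z ↦ h z`, then `h` vanishes
only at `0`, to first order, so that `h z / z` is an entire function without zeros, and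
`z / h z` has a limit at infinity because `1 / h (1 / w)` is differentiable at `0`. Hence
`z / h z` is constant. -/
theorem exists_scaling {f : Equiv.Perm (OnePoint ℂ)} (hf : f ∈ automorphismGroup)
    (hinf : f ∞ = ∞) (h0 : f (0 : ℂ) = (0 : ℂ)) :
    ∃ c : ℂ, c ≠ 0 ∧ ∀ z : ℂ, f z = (c * z : ℂ) := by
  set h : ℂ → ℂ := fun z => finitePart (f z) with hh
  have hcoe : ∀ z : ℂ, f z = (h z : OnePoint ℂ) := fun z =>
    (coe_finitePart (apply_coe_ne_infty hinf z)).symm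
  have hd : Differentiable ℂ h := differentiable_finitePart hf hinf
  have hh0 : h 0 = 0 := by simp [hh, h0]
  have hinf' : f.symm ∞ = ∞ := by rw [Equiv.symm_apply_eq, hinf]
  have hd' : Differentiable ℂ (fun z : ℂ => finitePart (f.symm z)) :=
    differentiable_finitePart (f := f.symm) (automorphismGroup.inv_mem hf) hinf'
  have hne : ∀ z, z ≠ 0 → h z ≠ 0 := by
    intro z hz hz0
    have : f z = f (0 : ℂ) := by rw [h0, hcoe, hz0]
    exact hz (by simpa using f.injective this)
  have hder : deriv h 0 ≠ 0 := by
    intro hz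
    have hid : (fun z : ℂ => finitePart (f.symm (h z : OnePoint ℂ))) = id := by
      funext z
      rw [← hcoe, Equiv.symm_apply_apply]; rfl
    have := deriv_comp (h₂ := fun z : ℂ => finitePart (f.symm z)) (h := h) (0 : ℂ)
      (hd' _) (hd _)
    rw [hz, mul_zero] at this
    have h2 : deriv (fun z : ℂ => finitePart (f.symm (h z : OnePoint ℂ))) 0 = 0 := this
    rw [hid] at h2
    simp at h2
  set q : ℂ → ℂ := dslope h 0 with hq
  have hqd : Differentiable ℂ q := by
    rw [hq, ← differentiableOn_univ, Complex.differentiableOn_dslope (by simp)]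
    exact hd.differentiableOn
  have hq0 : ∀ z, z ≠ 0 → q z = h z / z := by
    intro z hz
    rw [hq, dslope_of_ne _ hz, slope_def_field, hh0]; simp
  have hqne : ∀ z, q z ≠ 0 := by
    intro z
    by_cases hz : z = 0
    · rw [hz, hq, dslope_same]; exact hder
    · rw [hq0 z hz]; exact div_ne_zero (hne z hz) hz
  set F : ℂ → ℂ := fun w => finitePart (invFun (f (invFun w))) with hF
  have hF0 : F 0 = 0 := by simp [hF, invFun_zero, hinf, invFun_infty]
  have hFd : DifferentiableAt ℂ F 0 := by
    have h1 := mdifferentiableAt_infty_iff.1 (hf.1 ∞)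
    have h2 := (mdifferentiable_invFun _).comp (0 : ℂ) h1
    have h3 := (mdifferentiableAt_finitePart (p := invFun (f (invFun (0 : ℂ)))) (by
      rw [invFun_zero, hinf, invFun_infty]; exact OnePoint.coe_ne_infty _)).comp (0 : ℂ) h2
    exact mdifferentiableAt_iff_differentiableAt.1 h3
  have hFz : ∀ w : ℂ, w ≠ 0 → F w = (h w⁻¹)⁻¹ := by
    intro w hw
    simp only [hF]
    rw [invFun_coe_of_ne hw, hcoe, invFun_coe_of_ne (hne _ (inv_ne_zero hw)), finitePart_coe]
  have hlim : Tendsto (fun z => (q z)⁻¹) (cocompact ℂ) (𝓝 (deriv F 0)) := by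
    have h1 := hasDerivAt_iff_tendsto_slope.1 hFd.hasDerivAt
    rw [← Metric.cobounded_eq_cocompact]
    have h2 : Tendsto (fun z : ℂ => z⁻¹) (Bornology.cobounded ℂ) (𝓝[≠] 0) := by
      refine tendsto_nhdsWithin_iff.2 ⟨tendsto_inv₀_cobounded, ?_⟩
      filter_upwards [Bornology.eventually_ne_cobounded (0 : ℂ)] with z hz
      exact inv_ne_zero hz
    refine (h1.comp h2).congr' ?_
    filter_upwards [Bornology.eventually_ne_cobounded (0 : ℂ)] with z hz
    simp only [Function.comp, slope_def_field, hF0, sub_zero]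
    rw [hFz _ (inv_ne_zero hz), hq0 z hz, inv_inv, inv_div]
    field_simp
  have hconst : ∀ z, (q z)⁻¹ = deriv F 0 := fun z =>
    Differentiable.apply_eq_of_tendsto_cocompact (hqd.inv hqne) z hlim
  refine ⟨q 1, hqne 1, fun z => ?_⟩
  have hz1 : q z = q 1 := inv_injective ((hconst z).trans (hconst 1).symm)
  rw [hcoe]
  congr 1
  by_cases hz : z = 0
  · rw [hz, hh0, mul_zero]
  · rw [← hz1, hq0 z hz]; field_simp

theorem exists_affine {a b : ℂ} (ha : a ≠ 0) :
    ∃ f ∈ automorphismGroup, f ∞ = ∞ ∧ ∀ z : ℂ, f z = (a * z + b : ℂ) := by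
  obtain ⟨f, hf, h1, h2⟩ := exists_mobius (a := a) (b := b) (c := 0) (d := 1) (by simpa)
  exact ⟨f, hf, by rw [h1, ratio_zero], fun z => by rw [h2, zero_mul, zero_add, ratio_one]⟩

theorem eq_affine {f : Equiv.Perm (OnePoint ℂ)} (hf : f ∈ automorphismGroup)
    (hinf : f ∞ = ∞) : ∃ a b : ℂ, a ≠ 0 ∧ ∀ z : ℂ, f z = (a * z + b : ℂ) := by
  obtain ⟨b, hb⟩ : ∃ b : ℂ, f (0 : ℂ) = b :=
    ⟨_, (coe_finitePart (apply_coe_ne_infty hinf 0)).symm⟩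
  obtain ⟨t, ht, t1, t2⟩ := exists_affine (a := 1) (b := -b) one_ne_zero
  obtain ⟨a, ha, h⟩ := exists_scaling (automorphismGroup.mul_mem ht hf)
    (by rw [Equiv.Perm.mul_apply, hinf, t1]) (by rw [Equiv.Perm.mul_apply, hb, t2]; simp)
  refine ⟨a, b, ha, fun z => ?_⟩
  have hz := h z
  rw [Equiv.Perm.mul_apply, ← coe_finitePart (apply_coe_ne_infty hinf z), t2,
    OnePoint.coe_eq_coe] at hz
  rw [← coe_finitePart (apply_coe_ne_infty hinf z), OnePoint.coe_eq_coe]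
  linear_combination hz

/-- Automorphisms act transitively on triples of distinct points. -/
theorem exists_normalizing {p q r : OnePoint ℂ} (hpq : p ≠ q) (hpr : p ≠ r) (hqr : q ≠ r) :
    ∃ f ∈ automorphismGroup, f p = (0 : ℂ) ∧ f q = ∞ ∧ f r = (1 : ℂ) := by
  have h1 : ∃ f ∈ automorphismGroup, f q = ∞ := by
    induction q using OnePoint.rec with
    | infty => exact ⟨1, one_mem _, rfl⟩
    | coe z =>
      obtain ⟨f, hf, -, h2⟩ := exists_mobius (a := 0) (b := 1) (c := 1) (d := -z) (by simp)
      exact ⟨f, hf, by rw [h2]; simp [ratio_zero]⟩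
  obtain ⟨f, hf, hq⟩ := h1
  have fin : ∀ {s}, q ≠ s → ∃ z : ℂ, f s = z := fun {s} hs =>
    ⟨_, (coe_finitePart fun h => hs (f.injective (hq.trans h.symm))).symm⟩
  obtain ⟨u, hu⟩ := fin hpq.symm
  obtain ⟨v, hv⟩ := fin hqr
  have huv : v - u ≠ 0 := by
    intro h
    refine hpr (f.injective ?_)
    rw [hu, hv, sub_eq_zero.1 h]
  obtain ⟨t, ht, t1, t2⟩ := exists_affine (a := (v - u)⁻¹) (b := -u * (v - u)⁻¹)
    (inv_ne_zero huv)
  refine ⟨t * f, mul_mem ht hf, ?_, ?_, ?_⟩ <;> rw [Equiv.Perm.mul_apply]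
  · rw [hu, t2]; congr 1; ring
  · rw [hq, t1]
  · rw [hv, t2]; congr 1; field_simp; ring

theorem eq_one_of_fixes {f : Equiv.Perm (OnePoint ℂ)} (hf : f ∈ automorphismGroup)
    {p q r : OnePoint ℂ} (hpq : p ≠ q) (hpr : p ≠ r) (hqr : q ≠ r)
    (hp : f p = p) (hq : f q = q) (hr : f r = r) : f = 1 := by
  obtain ⟨φ, hφ, h0, hinf, h1⟩ := exists_normalizing hpq hpr hqr
  have key : ∀ {x y}, φ x = y → f x = x → (φ * f * φ⁻¹) y = y := by
    intro x y h hx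
    rw [Equiv.Perm.mul_apply, Equiv.Perm.mul_apply, ← h, perm_inv_apply, hx]
  have hm : φ * f * φ⁻¹ ∈ automorphismGroup := mul_mem (mul_mem hφ hf) (inv_mem hφ)
  obtain ⟨c, -, hc⟩ := exists_scaling hm (key hinf hq) (key h0 hp)
  have hc1 : c = 1 := by
    have := hc 1
    rw [key h1 hr, OnePoint.coe_eq_coe] at this
    simpa using this.symm
  have : φ * f * φ⁻¹ = 1 := by
    ext1 x
    induction x using OnePoint.rec with
    | infty => rw [key hinf hq]; rfl
    | coe z => rw [hc, hc1, one_mul]; rfl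
  rwa [mul_inv_eq_one, mul_eq_left] at this

theorem eq_of_three {f g : Equiv.Perm (OnePoint ℂ)} (hf : f ∈ automorphismGroup)
    (hg : g ∈ automorphismGroup)
    {p q r : OnePoint ℂ} (hpq : p ≠ q) (hpr : p ≠ r) (hqr : q ≠ r)
    (hp : f p = g p) (hq : f q = g q) (hr : f r = g r) : f = g := by
  have := eq_one_of_fixes (f := g⁻¹ * f) (mul_mem (inv_mem hg) hf) hpq hpr hqr
    (by rw [Equiv.Perm.mul_apply, hp, perm_inv_apply])
    (by rw [Equiv.Perm.mul_apply, hq, perm_inv_apply])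
    (by rw [Equiv.Perm.mul_apply, hr, perm_inv_apply])
  exact (inv_mul_eq_one.1 this).symm

theorem inversion_coe (z : ℂ) : inversion.toEquiv (z : OnePoint ℂ) = ratio 1 z :=
  invFun_coe_eq_ratio z

theorem inversion_infty : inversion.toEquiv (∞ : OnePoint ℂ) = (0 : ℂ) := rfl

/-- Every automorphism of the sphere is a Möbius transformation. -/
theorem eq_mobius {f : Equiv.Perm (OnePoint ℂ)} (hf : f ∈ automorphismGroup) :
    ∃ a b c d : ℂ, a * d - b * c ≠ 0 ∧ f ∞ = ratio a c ∧
      ∀ z : ℂ, f z = ratio (a * z + b) (c * z + d) := by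
  by_cases hinf : f ∞ = ∞
  · obtain ⟨a, b, ha, h⟩ := eq_affine hf hinf
    exact ⟨a, b, 0, 1, by simpa, by rw [hinf, ratio_zero],
      fun z => by rw [h, zero_mul, zero_add, ratio_one]⟩
  · obtain ⟨v, hv⟩ : ∃ v : ℂ, f ∞ = v := ⟨_, (coe_finitePart hinf).symm⟩
    -- `z ↦ 1 / (f z - v)` fixes `∞`
    obtain ⟨k, hk, k1, k2⟩ := exists_mobius (a := 0) (b := 1) (c := 1) (d := -v) (by simp)
    obtain ⟨a, b, ha, h⟩ := eq_affine (mul_mem hk hf)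
      (by rw [Equiv.Perm.mul_apply, hv, k2]; simp [ratio_zero])
    obtain ⟨l, hl, l1, l2⟩ := exists_mobius (a := v) (b := 1) (c := 1) (d := 0) (by simp)
    have hlk : l * k = 1 := by
      refine eq_one_of_fixes (mul_mem hl hk) (p := ∞) (q := (v : ℂ)) (r := ((v + 1 : ℂ)))
        (OnePoint.infty_ne_coe _) (OnePoint.infty_ne_coe _) (by simp) ?_ ?_ ?_
      · rw [Equiv.Perm.mul_apply, k1, ratio_of_ne one_ne_zero, zero_div, l2]; simp [ratio_zero]
      · rw [Equiv.Perm.mul_apply, k2]; simp [ratio_zero, l1, ratio_one]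
      · rw [Equiv.Perm.mul_apply, k2]; simp [ratio_one, l2]
    refine ⟨v * a, v * b + 1, a, b, ?_, ?_, fun z => ?_⟩
    · intro h0; exact ha (by linear_combination -h0)
    · rw [hv, ratio_of_ne ha]; congr 1; field_simp
    · have : f z = l ((k * f) z) := by
        rw [← Equiv.Perm.mul_apply, ← mul_assoc, hlk, one_mul]
      rw [this, h, l2]; congr 1 <;> ring

theorem exists_fixed {f : Equiv.Perm (OnePoint ℂ)} (hf : f ∈ automorphismGroup) :
    ∃ p, f p = p := by
  obtain ⟨a, b, c, d, hdet, hinf, h⟩ := eq_mobius hf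
  by_cases hc : c = 0
  · exact ⟨∞, by rw [hinf, hc, ratio_zero]⟩
  · obtain ⟨s, hs⟩ := IsAlgClosed.exists_pow_nat_eq (discrim c (d - a) (-b)) (n := 2) two_pos
    obtain ⟨z, hz⟩ := exists_quadratic_eq_zero hc ⟨s, by rw [← hs, sq]⟩
    refine ⟨z, ?_⟩
    have hcd : c * z + d ≠ 0 := fun h0 => hdet (by linear_combination (-(c * z - a)) * h0 + c * hz)
    rw [h, ratio_of_ne hcd, OnePoint.coe_eq_coe, div_eq_iff hcd]
    linear_combination -hz

theorem conj_apply_eq {φ f : Equiv.Perm (OnePoint ℂ)} {p q : OnePoint ℂ} (h : φ p = q)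
    (hp : f p = p) : (φ * f * φ⁻¹) q = q := by
  rw [Equiv.Perm.mul_apply, Equiv.Perm.mul_apply, ← h, perm_inv_apply, hp]

/-- An automorphism of finite order with one fixed point and no other would be conjugate to a
nontrivial translation. -/
theorem exists_ne_fixed {f : Equiv.Perm (OnePoint ℂ)} (hf : f ∈ automorphismGroup)
    (hfin : IsOfFinOrder f) (hne : f ≠ 1) {p : OnePoint ℂ} (hp : f p = p) :
    ∃ q, q ≠ p ∧ f q = q := by
  obtain ⟨q, r, hpq, hpr, hqr⟩ : ∃ q r : OnePoint ℂ, p ≠ q ∧ p ≠ r ∧ q ≠ r := by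
    obtain ⟨q, hq⟩ := (Set.toFinite ({p} : Set (OnePoint ℂ))).infinite_compl.nonempty
    obtain ⟨r, hr⟩ := (Set.toFinite ({p, q} : Set (OnePoint ℂ))).infinite_compl.nonempty
    simp only [mem_compl_iff, mem_insert_iff, mem_singleton_iff, not_or] at hq hr
    exact ⟨q, r, Ne.symm hq, Ne.symm hr.1, Ne.symm hr.2⟩
  obtain ⟨φ, hφ, -, hinf, -⟩ := exists_normalizing hpq.symm hqr hpr
  obtain ⟨a, b, ha, h⟩ := eq_affine (mul_mem (mul_mem hφ hf) (inv_mem hφ)) (conj_apply_eq hinf hp)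
  by_cases ha1 : a = 1
  · exfalso
    obtain ⟨m, hm, hfm⟩ := isOfFinOrder_iff_pow_eq_one.1 hfin
    have hpow : ∀ k : ℕ, ((φ * f * φ⁻¹) ^ k) (0 : ℂ) = ((k * b : ℂ) : OnePoint ℂ) := by
      intro k
      induction k with
      | zero => simp
      | succ k ih =>
        rw [pow_succ', Equiv.Perm.mul_apply, ih, h, ha1]
        congr 1; push_cast; ring
    have hb : b = 0 := by
      have := hpow m
      rw [conj_pow, hfm] at this
      simpa [hm.ne'] using this
    apply hne
    have : φ * f * φ⁻¹ = 1 := by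
      ext1 x
      induction x using OnePoint.rec with
      | infty => exact conj_apply_eq hinf hp
      | coe z => rw [h, ha1, hb]; simp
    rwa [mul_inv_eq_one, mul_eq_left] at this
  · have h1a : 1 - a ≠ 0 := fun h0 => ha1 (by linear_combination -h0)
    refine ⟨φ⁻¹ ((b / (1 - a) : ℂ) : OnePoint ℂ), ?_, ?_⟩
    · intro h0
      have := congrArg φ h0
      rw [perm_apply_inv, hinf] at this
      exact OnePoint.coe_ne_infty _ this
    · apply φ.injective
      rw [perm_apply_inv, ← Equiv.Perm.mul_apply, ← Equiv.Perm.mul_apply, h]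
      congr 1; field_simp; ring

/-- A nontrivial automorphism of finite order has exactly two fixed points. -/
theorem exists_two_fixed {f : Equiv.Perm (OnePoint ℂ)} (hf : f ∈ automorphismGroup)
    (hfin : IsOfFinOrder f) (hne : f ≠ 1) :
    ∃ p q, p ≠ q ∧ ∀ x, f x = x ↔ x = p ∨ x = q := by
  obtain ⟨p, hp⟩ := exists_fixed hf
  obtain ⟨q, hqp, hq⟩ := exists_ne_fixed hf hfin hne hp
  refine ⟨p, q, hqp.symm, fun x => ⟨fun hx => ?_, ?_⟩⟩
  · by_contra! H
    exact hne (eq_one_of_fixes hf hqp.symm H.1.symm H.2.symm hp hq hx)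
  · rintro (rfl | rfl) <;> assumption

/-- An automorphism exchanging `0` and `∞` has the form `z ↦ c / z`. -/
theorem eq_inverted_scaling {f : Equiv.Perm (OnePoint ℂ)} (hf : f ∈ automorphismGroup)
    (h0 : f (0 : ℂ) = ∞) (hinf : f ∞ = (0 : ℂ)) :
    ∃ c : ℂ, c ≠ 0 ∧ ∀ z : ℂ, f z = ratio c z := by
  obtain ⟨c, hc, h⟩ := exists_scaling (mul_mem hf inversion_mem)
    (by rw [Equiv.Perm.mul_apply, inversion_infty, h0])
    (by rw [Equiv.Perm.mul_apply, inversion_coe, ratio_zero, hinf])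
  refine ⟨c, hc, fun z => ?_⟩
  by_cases hz : z = 0
  · rw [hz, h0, ratio_zero]
  · have := h z⁻¹
    rw [Equiv.Perm.mul_apply, inversion_coe, ratio_of_ne (inv_ne_zero hz)] at this
    rw [ratio_of_ne hz, div_eq_mul_inv, ← this]; simp

/-! ### Local multiplicity and stabilizers -/

/-- Local normal form: an analytic function with a zero of order `m` is the `m`-th power of a
local coordinate. -/
theorem exists_local_coordinate {f : ℂ → ℂ} {z₀ : ℂ} (hf : AnalyticAt ℂ f z₀) {m : ℕ} (hm : m ≠ 0)
    (hord : analyticOrderAt f z₀ = m) :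
    ∃ ψ : ℂ → ℂ, ψ z₀ = 0 ∧ map ψ (𝓝 z₀) = 𝓝 0 ∧ (∃ U ∈ 𝓝 z₀, InjOn ψ U) ∧
      ∀ᶠ z in 𝓝 z₀, f z = ψ z ^ m := by
  obtain ⟨u, hu, hu0, hfu⟩ := (hf.analyticOrderAt_eq_natCast).1 hord
  obtain ⟨r, hr⟩ := IsAlgClosed.exists_pow_nat_eq (u z₀) (n := m) (Nat.pos_of_ne_zero hm)
  have hr0 : r ≠ 0 := by
    rintro rfl
    exact hu0 (by rw [← hr, zero_pow hm])
  set v : ℂ → ℂ := fun z => r * (u z / u z₀) ^ ((m : ℂ)⁻¹) with hv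
  have hva : AnalyticAt ℂ v z₀ := by
    refine analyticAt_const.mul ((hu.div analyticAt_const hu0).cpow analyticAt_const ?_)
    simp [hu0]
  have hvm : ∀ z, v z ^ m = u z := by
    intro z
    simp only [hv]
    rw [mul_pow, Complex.cpow_nat_inv_pow _ hm, hr]
    field_simp
  have hv0 : v z₀ ≠ 0 := fun h => hu0 (by rw [← hvm, h, zero_pow hm])
  set ψ : ℂ → ℂ := fun z => (z - z₀) * v z with hψ
  have hψa : AnalyticAt ℂ ψ z₀ := (analyticAt_id.sub analyticAt_const).mul hva
  have hder : HasStrictDerivAt ψ (v z₀) z₀ := by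
    have h0 : HasStrictDerivAt (fun z => z - z₀) 1 z₀ := (hasStrictDerivAt_id z₀).sub_const z₀
    have h1 := h0.mul hva.hasStrictDerivAt
    simp only [sub_self, zero_mul, add_zero, one_mul] at h1
    exact h1
  have hψ0 : ψ z₀ = 0 := by simp [hψ]
  refine ⟨ψ, hψ0, ?_, ?_, ?_⟩
  · rw [hder.map_nhds_eq hv0, hψ0]
  · have h2 := hder.hasStrictFDerivAt_equiv hv0
    refine ⟨_, (h2.toOpenPartialHomeomorph ψ).open_source.mem_nhds
      h2.mem_toOpenPartialHomeomorph_source, ?_⟩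
    exact (h2.toOpenPartialHomeomorph ψ).injOn
  · filter_upwards [hfu] with z hz
    simp only [hψ]
    rw [hz, mul_pow, hvm, smul_eq_mul]

theorem finite_fixed {f : Equiv.Perm (OnePoint ℂ)} (hf : f ∈ automorphismGroup)
    (hne : f ≠ 1) : {p | f p = p}.Finite := by
  classical
  by_contra hinf
  obtain ⟨t, ht, hcard⟩ := Set.Infinite.exists_subset_card_eq hinf 3
  obtain ⟨p, q, r, hpq, hpr, hqr, rfl⟩ := Finset.card_eq_three.1 hcard
  exact hne (eq_one_of_fixes hf hpq hpr hqr (ht (by simp)) (ht (by simp)) (ht (by simp)))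

theorem finite_branchPoints (G : Subgroup (Equiv.Perm (OnePoint ℂ))) [Finite G]
    (hG : G ≤ automorphismGroup) : {p | ∃ g ∈ G, g ≠ 1 ∧ g p = p}.Finite := by
  have : {p | ∃ g ∈ G, g ≠ 1 ∧ g p = p} = ⋃ g ∈ {g : Equiv.Perm (OnePoint ℂ) | g ∈ G ∧ g ≠ 1},
      {p | g p = p} := by
    ext p; simp [and_assoc]
  rw [this]
  refine Set.Finite.biUnion (Set.Finite.subset (Set.toFinite (G : Set _)) fun g hg => hg.1) ?_
  exact fun g hg => finite_fixed (hG hg.1) hg.2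

/-- Near `p`, a quotient map `π` is `q ↦ Ψ q ^ m` with `Ψ` a local coordinate and `m` its
multiplicity. -/
theorem IsQuotientMap.exists_local_coordinate {G : Subgroup (Equiv.Perm (OnePoint ℂ))} [Finite G]
    {π : OnePoint ℂ → OnePoint ℂ} (hπ : IsQuotientMap G π) (p : OnePoint ℂ) :
    ∃ m : ℕ, m ≠ 0 ∧ localMultiplicity π p = m ∧ ∃ Ψ : OnePoint ℂ → ℂ,
      Ψ p = 0 ∧ map Ψ (𝓝 p) = 𝓝 0 ∧ ∃ U ∈ 𝓝 p, InjOn Ψ U ∧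
        ∀ q ∈ U, ∀ q' ∈ U, π q = π q' ↔ Ψ q ^ m = Ψ q' ^ m := by
  set e := chartAt ℂ p with he
  set e' := chartAt ℂ (π p) with he'
  set F : ℂ → ℂ := fun w => e' (π (e.symm w)) - e' (π p) with hF
  have hep : e p ∈ e.target := e.map_source (mem_chart_source ℂ p)
  have hsymm : e.symm (e p) = p := e.left_inv (mem_chart_source ℂ p)
  have hcont : Continuous π := hπ.holomorphic.continuous
  have hesymm : Tendsto e.symm (𝓝 (e p)) (𝓝 p) := by
    have := (e.continuousAt_symm hep).tendsto
    rwa [hsymm] at this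
  have hmd : ∀ᶠ w in 𝓝 (e p), DifferentiableAt ℂ F w := by
    have h1 : ∀ᶠ w in 𝓝 (e p), w ∈ e.target := e.open_target.mem_nhds hep
    have h2 : ∀ᶠ w in 𝓝 (e p), π (e.symm w) ∈ e'.source := by
      refine (hcont.continuousAt.tendsto.comp hesymm).eventually ?_
      exact e'.open_source.mem_nhds (mem_chart_source ℂ (π p))
    filter_upwards [h1, h2] with w hw1 hw2
    have a1 := mdifferentiableAt_atlas_symm (I := 𝓘(ℂ)) (chart_mem_atlas ℂ p) hw1
    have a2 := (hπ.holomorphic _).comp w a1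
    have a3 := (mdifferentiableAt_atlas (I := 𝓘(ℂ)) (chart_mem_atlas ℂ (π p)) hw2).comp w a2
    exact (mdifferentiableAt_iff_differentiableAt.1 a3).sub_const _
  have hFa : AnalyticAt ℂ F (e p) := Complex.analyticAt_iff_eventually_differentiableAt.2 hmd
  have hF0 : F (e p) = 0 := by simp [hF, hsymm]
  have hsrc : ∀ᶠ q in 𝓝 p, q ∈ e.source ∧ π q ∈ e'.source :=
    Filter.Eventually.and (e.open_source.mem_nhds (mem_chart_source ℂ p))
      (hcont.continuousAt.eventually (e'.open_source.mem_nhds (mem_chart_source ℂ (π p))))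
  have hecont : Tendsto e (𝓝 p) (𝓝 (e p)) :=
    e.continuousAt (mem_chart_source ℂ p)
  have hFq : ∀ q, q ∈ e.source → F (e q) = e' (π q) - e' (π p) := by
    intro q hq
    simp only [hF, e.left_inv hq]
  have hne_top : analyticOrderAt F (e p) ≠ ⊤ := by
    intro htop
    rw [analyticOrderAt_eq_top] at htop
    have h1 : ∀ᶠ q in 𝓝 p, π q = π p := by
      filter_upwards [hecont.eventually htop, hsrc] with q hq hs
      rw [hFq q hs.1, sub_eq_zero] at hq
      exact e'.injOn hs.2 (mem_chart_source ℂ (π p)) hq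
    have hfin : {q | π q = π p}.Finite := by
      refine (Set.finite_range fun g : G => (g : Equiv.Perm (OnePoint ℂ)) p).subset ?_
      intro q hq
      obtain ⟨g, hg, h⟩ := (hπ.fibres p q).1 (Eq.symm hq)
      exact ⟨⟨g, hg⟩, h⟩
    exact (infinite_of_mem_nhds p h1) hfin
  obtain ⟨m, hm⟩ := ENat.ne_top_iff_exists.1 hne_top
  have hm0 : m ≠ 0 := by
    rintro rfl
    exact (hFa.analyticOrderAt_ne_zero.2 hF0) hm.symm
  obtain ⟨ψ, hψ0, hψmap, ⟨U, hU, hinj⟩, hFψ⟩ :=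
    RiemannSphere.exists_local_coordinate hFa hm0 hm.symm
  refine ⟨m, hm0, hm.symm, fun q => ψ (e q), hψ0, ?_, ?_⟩
  · have : map e (𝓝 p) = 𝓝 (e p) := e.map_nhds_eq (mem_chart_source ℂ p)
    rw [← hψmap, ← this, map_map]; rfl
  · refine ⟨{q | (e q ∈ U ∧ F (e q) = ψ (e q) ^ m) ∧ q ∈ e.source ∧ π q ∈ e'.source}, ?_, ?_, ?_⟩
    · exact (hecont.eventually (Filter.Eventually.and hU hFψ)).and hsrc
    · intro q hq q' hq' h
      exact e.injOn hq.2.1 hq'.2.1 (hinj hq.1.1 hq'.1.1 h)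
    · intro q hq q' hq'
      rw [← hq.1.2, ← hq'.1.2, hFq q hq.2.1, hFq q' hq'.2.1, sub_left_inj]
      exact ⟨fun h => by rw [h], fun h => e'.injOn hq.2.2 hq'.2.2 h⟩

theorem continuous_of_mem {f : Equiv.Perm (OnePoint ℂ)} (hf : f ∈ automorphismGroup) :
    Continuous f := hf.1.continuous

/-- The multiplicity of a quotient map at `p` is the order of the stabilizer of `p`: close to `p`
the stabilizer acts simply transitively on the fibres, and in a coordinate `Ψ` in which the map is
the `m`-th power these fibres are the cosets of the group of `m`-th roots of unity. -/
theorem IsQuotientMap.localMultiplicity_eq {G : Subgroup (Equiv.Perm (OnePoint ℂ))} [Finite G]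
    (hG : G ≤ automorphismGroup) {π : OnePoint ℂ → OnePoint ℂ} (hπ : IsQuotientMap G π)
    (p : OnePoint ℂ) :
    localMultiplicity π p = Nat.card (MulAction.stabilizer G p) := by
  obtain ⟨m, hm0, hmult, Ψ, hΨ0, hΨmap, U, hU, hinj, hfib⟩ := hπ.exists_local_coordinate p
  rw [hmult, Nat.cast_inj]
  have : NeZero m := ⟨hm0⟩
  -- a neighbourhood `V ⊆ U` of `p` such that only stabilizer elements join two of its points
  obtain ⟨V, hV, hVU, hVstab⟩ : ∃ V ∈ 𝓝 p, V ⊆ U ∧ ∀ g ∈ G, ∀ q ∈ V, g q ∈ V → g p = p := by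
    have h1 : ∀ g : G, ∃ V ∈ 𝓝 p, ∀ q ∈ V, g.1 q ∈ V → g.1 p = p := by
      intro g
      by_cases hg : g.1 p = p
      · exact ⟨univ, univ_mem, fun _ _ _ => hg⟩
      · obtain ⟨A, B, hA, hB, hAB⟩ := t2_separation_nhds hg
        refine ⟨B ∩ g.1 ⁻¹' A, inter_mem hB ((continuous_of_mem (hG g.2)).continuousAt hA), ?_⟩
        exact fun q hq hgq => absurd hgq.1 (disjoint_left.1 hAB hq.2)
    choose V hV hV' using h1
    refine ⟨U ∩ ⋂ g, V g, inter_mem hU ((iInter_mem).2 hV), inter_subset_left, ?_⟩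
    intro g hg q hq hgq
    exact hV' ⟨g, hg⟩ q (mem_iInter.1 hq.2 _) (mem_iInter.1 hgq.2 _)
  have hΨtend : Tendsto Ψ (𝓝 p) (𝓝 0) := hΨmap.le
  -- a point `q ≠ p` with trivial stabilizer, so close to `p` that `V` contains its translates under
  -- the stabilizer of `p` as well as points with the coordinates `η * Ψ q`, `η ^ m = 1`
  have e1 : ∀ᶠ q in 𝓝 p, ∀ g : MulAction.stabilizer G p, g.1.1 q ∈ V := by
    refine eventually_all.2 fun g => ?_
    have := (continuous_of_mem (hG g.1.2)).continuousAt (x := p)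
    have hgp : g.1.1 p = p := g.2
    exact this.eventually (by rwa [hgp])
  have e2 : ∀ᶠ q in 𝓝 p, ∀ η : rootsOfUnity m ℂ, ∃ q' ∈ V, Ψ q' = ((η : ℂˣ) : ℂ) * Ψ q := by
    refine eventually_all.2 fun η => ?_
    have h1 : Ψ '' V ∈ 𝓝 (0 : ℂ) := by rw [← hΨmap]; exact image_mem_map hV
    have h2 : Tendsto (fun q => ((η : ℂˣ) : ℂ) * Ψ q) (𝓝 p) (𝓝 0) := by
      simpa using hΨtend.const_mul ((η : ℂˣ) : ℂ)
    filter_upwards [h2.eventually h1] with q hq using hq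
  have e3 : ∀ᶠ q in 𝓝[≠] p, ∀ g ∈ G, g ≠ 1 → g q ≠ q := by
    have hfin := (finite_branchPoints G hG).subset (sdiff_subset (t := {p}))
    have : ∀ᶠ q in 𝓝[≠] p, q ∈ ({p | ∃ g ∈ G, g ≠ 1 ∧ g p = p} \ {p})ᶜ :=
      mem_nhdsWithin_of_mem_nhds (hfin.isClosed.isOpen_compl.mem_nhds (by simp))
    filter_upwards [this, self_mem_nhdsWithin] with q hq hqp g hg hg1 hgq
    exact hq ⟨⟨g, hg, hg1, hgq⟩, hqp⟩
  obtain ⟨q, ⟨hq1, hq2, hqV⟩, hq3, hqp⟩ :=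
    ((((e1.and (e2.and hV)).filter_mono nhdsWithin_le_nhds).and
      (e3.and self_mem_nhdsWithin)).exists)
  have hqV : q ∈ V := hqV
  have hΨq : Ψ q ≠ 0 := fun h => hqp (hinj (hVU hqV) (mem_of_mem_nhds hU) (h.trans hΨ0.symm))
  have hpow : ∀ g : MulAction.stabilizer G p, (Ψ (g.1.1 q) / Ψ q) ^ m = 1 := by
    intro g
    rw [div_pow, div_eq_one_iff_eq (pow_ne_zero _ hΨq)]
    refine ((hfib _ (hVU (hq1 g)) _ (hVU hqV)).1 ?_)
    exact ((hπ.fibres _ _).2 ⟨g.1.1, g.1.2, rfl⟩).symm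
  let T : MulAction.stabilizer G p → rootsOfUnity m ℂ := fun g =>
    rootsOfUnity.mkOfPowEq (Ψ (g.1.1 q) / Ψ q) (hpow g)
  have hT : ∀ g, ((T g : ℂˣ) : ℂ) = Ψ (g.1.1 q) / Ψ q := fun g =>
    rootsOfUnity.val_mkOfPowEq_coe _ _
  have hbij : Function.Bijective T := by
    constructor
    · intro g g' h
      have h1 : Ψ (g.1.1 q) / Ψ q = Ψ (g'.1.1 q) / Ψ q := by rw [← hT, ← hT, h]
      have h2 : g.1.1 q = g'.1.1 q :=
        hinj (hVU (hq1 g)) (hVU (hq1 g')) ((div_left_inj' hΨq).1 h1)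
      by_contra hne
      refine hq3 (g'.1.1⁻¹ * g.1.1) (mul_mem (inv_mem g'.1.2) g.1.2) ?_ ?_
      · rw [Ne, inv_mul_eq_one]
        exact fun h => hne (Subtype.ext (Subtype.ext h.symm))
      · rw [Equiv.Perm.mul_apply, h2, perm_inv_apply]
    · intro η
      obtain ⟨q', hq', hη⟩ := hq2 η
      have h1 : π q = π q' := by
        refine (hfib _ (hVU hqV) _ (hVU hq')).2 ?_
        have h1 : ((η : ℂˣ) : ℂ) ^ m = 1 := by
          have := η.2
          rw [mem_rootsOfUnity'] at this
          exact this
        rw [hη, mul_pow, h1, one_mul]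
      obtain ⟨g, hg, rfl⟩ := (hπ.fibres q q').1 h1
      refine ⟨⟨⟨g, hg⟩, hVstab g hg q hqV hq'⟩, ?_⟩
      apply Subtype.ext
      apply Units.ext
      rw [hT]
      change Ψ (g q) / Ψ q = _
      rw [hη, mul_div_cancel_right₀ _ hΨq]
  rw [Nat.card_congr (Equiv.ofBijective T hbij), Complex.card_rootsOfUnity]

/-! ### Existence of the quotient map -/

theorem exists_apply_eq_iff {G : Subgroup (Equiv.Perm (OnePoint ℂ))}
    {h : Equiv.Perm (OnePoint ℂ)} (hh : h ∈ G) (p q : OnePoint ℂ) :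
    (∃ g ∈ G, g (h p) = q) ↔ ∃ g ∈ G, g p = q := by
  constructor
  · rintro ⟨g, hg, h'⟩
    exact ⟨g * h, mul_mem hg hh, h'⟩
  · rintro ⟨g, hg, h'⟩
    exact ⟨g * h⁻¹, mul_mem hg (inv_mem hh), by rw [Equiv.Perm.mul_apply, perm_inv_apply, h']⟩

section Quotient

open Polynomial

variable (G : Subgroup (Equiv.Perm (OnePoint ℂ))) [Fintype G]

/-- The product over the orbit of `p` (with multiplicities) of the values of `z - a`; it is
meaningful only if the orbit of `p` does not contain `∞`. -/
noncomputable def orbitProduct (a : ℂ) (p : OnePoint ℂ) : ℂ :=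
  ∏ g : G, (finitePart (g.1 p) - a)

open Classical in
/-- The invariant function `∏ g, (g p - a)`, which takes the value `∞` exactly on the orbit
of `∞`. -/
noncomputable def orbitMap (a : ℂ) (p : OnePoint ℂ) : OnePoint ℂ :=
  if ∃ g ∈ G, g p = ∞ then ∞ else (orbitProduct G a p : ℂ)

variable {G}

theorem orbitProduct_apply (a : ℂ) {h : Equiv.Perm (OnePoint ℂ)} (hh : h ∈ G) (p : OnePoint ℂ) :
    orbitProduct G a (h p) = orbitProduct G a p :=
  Fintype.prod_equiv (Equiv.mulRight (⟨h, hh⟩ : G)) _ _ fun _ => rfl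

theorem orbitMap_apply (a : ℂ) {h : Equiv.Perm (OnePoint ℂ)} (hh : h ∈ G) (p : OnePoint ℂ) :
    orbitMap G a (h p) = orbitMap G a p := by
  have h1 := exists_apply_eq_iff hh p ∞
  by_cases hp : ∃ g ∈ G, g p = ∞
  · rw [orbitMap, orbitMap, if_pos hp, if_pos (h1.2 hp)]
  · rw [orbitMap, orbitMap, if_neg hp, if_neg (mt h1.1 hp), orbitProduct_apply a hh]

theorem orbitProduct_eq_zero {a : ℂ} {p : OnePoint ℂ} (hp : ∀ g ∈ G, g p ≠ ∞) :
    orbitProduct G a p = 0 ↔ ∃ g ∈ G, g p = (a : OnePoint ℂ) := by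
  rw [orbitProduct, Finset.prod_eq_zero_iff]
  constructor
  · rintro ⟨g, -, hg⟩
    refine ⟨g, g.2, ?_⟩
    rw [← coe_finitePart (hp g g.2), sub_eq_zero.1 hg]
  · rintro ⟨g, hg, h⟩
    exact ⟨⟨g, hg⟩, Finset.mem_univ _, by simp [h]⟩

/-- For automorphisms `g p = (α p + β) / (γ p + δ)` with `g ∈ G`, the product of `g p - a` is
a quotient of polynomials in `p`, of which the denominator does not depend on `a`. -/
theorem exists_polynomials (hG : G ≤ automorphismGroup) :
    ∃ (P : ℂ → ℂ[X]) (Q : ℂ[X]), (∀ a, (P a).natDegree ≤ Fintype.card G) ∧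
      Q.natDegree < Fintype.card G ∧
      (∀ a : ℂ, (∀ g ∈ G, g ∞ ≠ (a : OnePoint ℂ)) → (P a).coeff (Fintype.card G) ≠ 0) ∧
      (∀ z : ℂ, Q.eval z = 0 ↔ ∃ g ∈ G, g z = ∞) ∧
      (∀ a z : ℂ, (P a).eval z = 0 → ∃ g ∈ G, g z = (a : OnePoint ℂ)) ∧
      ∀ a z : ℂ, (∀ g ∈ G, g z ≠ ∞) → orbitProduct G a z * Q.eval z = (P a).eval z := by
  have h := fun g : G => eq_mobius (hG g.2)
  choose α β γ δ hdet hinf hz using h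
  have hev : ∀ a z : ℂ, (∏ g : G, (C (α g - a * γ g) * X + C (β g - a * δ g))).eval z
      = ∏ g : G, ((α g * z + β g) - a * (γ g * z + δ g)) := by
    intro a z
    rw [eval_prod]
    refine Finset.prod_congr rfl fun g _ => ?_
    simp; ring
  have hevQ : ∀ z : ℂ, (∏ g : G, (C (γ g) * X + C (δ g))).eval z
      = ∏ g : G, (γ g * z + δ g) := by
    intro z
    rw [eval_prod]
    exact Finset.prod_congr rfl fun g _ => by simp
  have hroot : ∀ a z : ℂ, (∏ g : G, (C (α g - a * γ g) * X + C (β g - a * δ g))).eval z = 0 →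
      ∃ g ∈ G, g z = (a : OnePoint ℂ) := by
    intro a z h0
    rw [hev, Finset.prod_eq_zero_iff] at h0
    obtain ⟨g, -, hg⟩ := h0
    have hne : γ g * z + δ g ≠ 0 := by
      intro h1
      refine hdet g ?_
      rw [h1, mul_zero, sub_zero] at hg
      by_cases hγ : γ g = 0
      · have hδ : δ g = 0 := by simpa [hγ] using h1
        rw [hγ, hδ]; ring
      · have : γ g * (α g * δ g - β g * γ g) = 0 := by
          linear_combination (-(γ g) ^ 2) * hg + α g * γ g * h1
        exact (mul_eq_zero.1 this).resolve_left hγ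
    refine ⟨g, g.2, ?_⟩
    rw [hz, ratio_of_ne hne, OnePoint.coe_eq_coe, div_eq_iff hne]
    linear_combination hg
  refine ⟨fun a => ∏ g : G, (C (α g - a * γ g) * X + C (β g - a * δ g)),
    ∏ g : G, (C (γ g) * X + C (δ g)), ?_, ?_, ?_, ?_, hroot, ?_⟩
  · intro a
    refine (natDegree_prod_le _ _).trans ?_
    refine (Finset.sum_le_sum fun g _ => natDegree_linear_le).trans ?_
    simp [Finset.card_univ]
  · refine (natDegree_prod_le _ _).trans_lt ?_
    have : ∑ g : G, (C (γ g) * X + C (δ g)).natDegree < ∑ g : G, 1 := by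
      refine Finset.sum_lt_sum (fun g _ => natDegree_linear_le) ⟨1, Finset.mem_univ _, ?_⟩
      have h1 : γ 1 = 0 := by
        have := hinf 1
        rw [OneMemClass.coe_one, Equiv.Perm.one_apply] at this
        exact ratio_eq_infty.1 this.symm
      simp [h1]
    simpa [Finset.card_univ] using this
  · intro a ha
    have h1 := coeff_prod_of_natDegree_le (s := (Finset.univ : Finset G))
      (fun g => C (α g - a * γ g) * X + C (β g - a * δ g)) 1 (fun g _ => natDegree_linear_le)
    rw [mul_one, Finset.card_univ] at h1
    rw [h1, Finset.prod_ne_zero_iff]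
    intro g _ h0
    have h2 : α g = a * γ g := by
      simp [coeff_C] at h0
      linear_combination h0
    have hγ : γ g ≠ 0 := by
      intro hγ
      exact hdet g (by rw [h2, hγ]; ring)
    refine ha g g.2 ?_
    rw [hinf, ratio_of_ne hγ, h2, mul_div_cancel_right₀ _ hγ]
  · intro z
    rw [hevQ, Finset.prod_eq_zero_iff]
    constructor
    · rintro ⟨g, -, hg⟩
      exact ⟨g, g.2, by rw [hz, hg, ratio_zero]⟩
    · rintro ⟨g, hg, h⟩
      exact ⟨⟨g, hg⟩, Finset.mem_univ _, by
        have h1 := hz ⟨g, hg⟩ z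
        rw [h] at h1
        exact ratio_eq_infty.1 h1.symm⟩
  · intro a z hfin
    rw [hev, hevQ, orbitProduct, ← Finset.prod_mul_distrib]
    refine Finset.prod_congr rfl fun g _ => ?_
    have hne : γ g * z + δ g ≠ 0 := by
      intro h0
      exact hfin g g.2 (by rw [hz, h0, ratio_zero])
    rw [hz, ratio_of_ne hne, finitePart_coe, sub_mul, div_mul_cancel₀ _ hne]

/-- All the invariant functions `∏ g, (g p - b)` are affine functions of any one of them,
`∏ g, (g p - a)`, for which `a` has trivial stabilizer: after a constant is subtracted
the numerator vanishes on the orbit of `a`, which determines it up to a factor. -/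
theorem exists_orbitProduct_eq (hG : G ≤ automorphismGroup) {a : ℂ}
    (hfree : ∀ g ∈ G, g ≠ 1 → g a ≠ a) (hinf : ∀ g ∈ G, g ∞ ≠ (a : OnePoint ℂ)) (b : ℂ) :
    ∃ k c : ℂ, ∀ p, (∀ g ∈ G, g p ≠ ∞) → orbitProduct G b p = k + c * orbitProduct G a p := by
  obtain ⟨P, Q, hP, hQ, hlead, hQ0, hroot, heval⟩ := exists_polynomials hG
  set n := Fintype.card G
  have ha : ∀ g ∈ G, g a ≠ ∞ := fun g hg h =>
    hinf g⁻¹ (inv_mem hg) (by rw [← h, perm_inv_apply])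
  set k := orbitProduct G b a with hk
  set D := P b - C k * Q with hD
  have hroots : ∀ h : G, (C ((P a).coeff n) * D - C (D.coeff n) * P a).eval
      (finitePart (h.1 a)) = 0 := by
    intro h
    have hc := coe_finitePart (ha h h.2)
    have hfin : ∀ g ∈ G, g (finitePart (h.1 a) : OnePoint ℂ) ≠ ∞ := by
      intro g hg
      rw [hc]
      exact ha (g * h) (mul_mem hg h.2)
    have h1 := heval a _ hfin
    have h2 := heval b _ hfin
    rw [hc, orbitProduct_apply _ h.2] at h1 h2
    have h3 : orbitProduct G a a = 0 :=
      (orbitProduct_eq_zero ha).2 ⟨1, one_mem _, rfl⟩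
    rw [h3, zero_mul] at h1
    rw [eval_sub, eval_mul, eval_mul, hD, eval_sub, eval_mul, eval_C, eval_C, ← h1, ← h2]
    simp [hk]
  have hinj : Function.Injective fun h : G => finitePart (h.1 a) := by
    intro h h' heq
    have h1 : h.1 a = h'.1 a := by
      rw [← coe_finitePart (ha h h.2), ← coe_finitePart (ha h' h'.2)]
      exact congrArg _ heq
    by_contra hne
    refine hfree (h'.1⁻¹ * h.1) (mul_mem (inv_mem h'.2) h.2) ?_ ?_
    · rw [Ne, inv_mul_eq_one]
      exact fun h => hne (Subtype.ext h.symm)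
    · rw [Equiv.Perm.mul_apply, h1, perm_inv_apply]
  have hDdeg : D.natDegree ≤ n :=
    (natDegree_sub_le _ _).trans (max_le (hP b) ((natDegree_C_mul_le _ _).trans hQ.le))
  have hdeg : (C ((P a).coeff n) * D - C (D.coeff n) * P a).natDegree < n := by
    have h1 : (C ((P a).coeff n) * D - C (D.coeff n) * P a).natDegree ≤ n :=
      (natDegree_sub_le _ _).trans (max_le ((natDegree_C_mul_le _ _).trans hDdeg)
        ((natDegree_C_mul_le _ _).trans (hP a)))
    refine lt_of_le_of_ne h1 fun h2 => ?_
    have h3 : (C ((P a).coeff n) * D - C (D.coeff n) * P a).coeff n = 0 := by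
      simp [mul_comm]
    have hn : n ≠ 0 := Fintype.card_ne_zero
    have h4 : (C ((P a).coeff n) * D - C (D.coeff n) * P a).leadingCoeff = 0 := by
      rw [leadingCoeff, h2, h3]
    rw [leadingCoeff_eq_zero.1 h4] at h2
    exact hn h2.symm
  have hzero := eq_zero_of_natDegree_lt_card_of_eval_eq_zero _ hinj hroots hdeg
  refine ⟨k, D.coeff n / (P a).coeff n, fun p hp => ?_⟩
  obtain ⟨z, rfl⟩ : ∃ z : ℂ, p = z := ⟨_, (coe_finitePart (hp 1 (one_mem _))).symm⟩
  have h1 := heval a z hp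
  have h2 := heval b z hp
  have hQz : Q.eval z ≠ 0 := by
    rw [Ne, hQ0]; push Not; exact hp
  have h3 := congrArg (eval z) hzero
  simp only [eval_sub, eval_mul, eval_C, eval_zero, hD] at h3
  have hl := hlead a hinf
  apply mul_right_cancel₀ (mul_ne_zero hQz hl)
  have h4 : D.coeff n / (P a).coeff n * (P a).coeff n = D.coeff n := div_mul_cancel₀ _ hl
  rw [← hD] at h3
  linear_combination h3 + (P a).coeff n * h2 - D.coeff n * h1 -
    Q.eval z * orbitProduct G a z * h4

theorem mdifferentiable_orbitMap (hG : G ≤ automorphismGroup) {a : ℂ}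
    (hinf : ∀ g ∈ G, g ∞ ≠ (a : OnePoint ℂ)) :
    MDifferentiable 𝓘(ℂ) 𝓘(ℂ) (orbitMap G a) := by
  have hopen : ∀ (q : OnePoint ℂ) (p), (∀ g ∈ G, g p ≠ q) → ∀ᶠ p' in 𝓝 p, ∀ g ∈ G, g p' ≠ q := by
    intro q p hp
    have : ∀ᶠ p' in 𝓝 p, ∀ g : G, g.1 p' ≠ q := by
      refine eventually_all.2 fun g => ?_
      exact (continuous_of_mem (hG g.2)).continuousAt.eventually_ne (hp g g.2)
    filter_upwards [this] with p' hp' g hg using hp' ⟨g, hg⟩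
  have hprod : ∀ (κ : OnePoint ℂ → ℂ) (q p : OnePoint ℂ),
      (∀ p', p' ≠ q → MDifferentiableAt 𝓘(ℂ) 𝓘(ℂ) κ p') → (∀ g ∈ G, g p ≠ q) →
      MDifferentiableAt 𝓘(ℂ) 𝓘(ℂ) (fun p => ∏ g : G, κ (g.1 p)) p := by
    intro κ q p hκ hp
    have h1 := MDifferentiableAt.prod (I := 𝓘(ℂ)) (t := (Finset.univ : Finset G)) (z := p)
      (f := fun g p => κ (g.1 p))
      (fun g _ => (hκ _ (hp g g.2)).comp p ((hG g.2).1 p))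
    have h2 : (∏ g : G, fun p => κ (g.1 p)) = fun p => ∏ g : G, κ (g.1 p) := by
      funext p'
      rw [Finset.prod_apply]
    rwa [h2] at h1
  intro p
  by_cases hp : ∀ g ∈ G, g p ≠ ∞
  · have h1 := hprod (fun p => finitePart p - a) ∞ p
      (fun p' hp' => (mdifferentiableAt_finitePart hp').sub mdifferentiableAt_const) hp
    refine ((mdifferentiable_coe _).comp p h1).congr_of_eventuallyEq ?_
    filter_upwards [hopen ∞ p hp] with p' hp'
    rw [orbitMap, if_neg (by push Not; exact hp')]
    rfl
  · push Not at hp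
    obtain ⟨g₀, hg₀, hpinf⟩ := hp
    have hpa : ∀ g ∈ G, g p ≠ (a : OnePoint ℂ) := by
      intro g hg h
      refine hinf (g * g₀⁻¹) (mul_mem hg (inv_mem hg₀)) ?_
      rw [Equiv.Perm.mul_apply, ← hpinf, perm_inv_apply, h]
    -- near `p` the map is `1 / ∏ g, κ (g p)`, where `κ` is the function `1 / (z - a)`
    obtain ⟨k, hk, k1, k2⟩ := exists_mobius (a := 0) (b := 1) (c := 1) (d := -a) (by simp)
    have hk1 : k ∞ = (0 : ℂ) := by rw [k1, ratio_one]
    have hk2 : ∀ z : ℂ, z ≠ a → k z = ((z - a)⁻¹ : ℂ) := by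
      intro z hz
      have : z - a ≠ 0 := sub_ne_zero.2 hz
      rw [k2, ratio_of_ne (by simpa [sub_eq_add_neg] using this)]
      congr 1; ring
    have hka : k a = ∞ := by rw [k2]; simp [ratio_zero]
    have h1 := hprod (fun p => finitePart (k p)) a p
      (fun p' hp' => (mdifferentiableAt_finitePart (fun h => hp' (k.injective
        (h.trans hka.symm)))).comp p' (hk.1 p')) hpa
    refine ((mdifferentiable_invFun _).comp p
      ((mdifferentiable_coe _).comp p h1)).congr_of_eventuallyEq ?_
    filter_upwards [hopen a p hpa] with p' hp'
    simp only [Function.comp]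
    by_cases h : ∃ g ∈ G, g p' = ∞
    · rw [orbitMap, if_pos h]
      obtain ⟨g, hg, h'⟩ := h
      rw [Finset.prod_eq_zero (Finset.mem_univ (⟨g, hg⟩ : G)) (by simp [h', hk1]), invFun_zero]
    · rw [orbitMap, if_neg h]
      push Not at h
      have h2 : ∀ g : G, finitePart (g.1 p') - a ≠ 0 := by
        intro g h0
        apply hp' g g.2
        rw [← coe_finitePart (h g g.2), sub_eq_zero.1 h0]
      have h3 : ∏ g : G, finitePart (k (g.1 p')) = (orbitProduct G a p')⁻¹ := by
        rw [orbitProduct, ← Finset.prod_inv_distrib]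
        refine Finset.prod_congr rfl fun g _ => ?_
        conv_lhs => rw [← coe_finitePart (h g g.2), hk2 _ (sub_ne_zero.1 (h2 g)), finitePart_coe]
      have h4 : orbitProduct G a p' ≠ 0 := Finset.prod_ne_zero_iff.2 fun g _ => h2 g
      rw [h3, invFun_coe_of_ne (inv_ne_zero h4), inv_inv]

/-- The value `w` is attained at a zero of `P a - w Q`, where `P a / Q` is the invariant
function. -/
theorem surjective_orbitMap (hG : G ≤ automorphismGroup) {a : ℂ}
    (hinf : ∀ g ∈ G, g ∞ ≠ (a : OnePoint ℂ)) : Function.Surjective (orbitMap G a) := by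
  obtain ⟨P, Q, hP, hQ, hlead, hQ0, hroot, heval⟩ := exists_polynomials hG
  intro w
  induction w using OnePoint.rec with
  | infty => exact ⟨∞, if_pos ⟨1, one_mem _, rfl⟩⟩
  | coe w =>
    have hco : (P a - C w * Q).coeff (Fintype.card G) ≠ 0 := by
      rw [coeff_sub, coeff_C_mul, coeff_eq_zero_of_natDegree_lt hQ, mul_zero, sub_zero]
      exact hlead a hinf
    have hdeg : (P a - C w * Q).degree ≠ 0 := by
      intro h
      have h1 := le_degree_of_ne_zero hco
      rw [h] at h1
      exact Fintype.card_ne_zero (α := G)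
        (by exact_mod_cast le_antisymm (by exact_mod_cast h1) (Nat.zero_le _))
    obtain ⟨z, hz⟩ := IsAlgClosed.exists_root _ hdeg
    rw [IsRoot, eval_sub, eval_mul, eval_C, sub_eq_zero] at hz
    have hQz : Q.eval z ≠ 0 := by
      intro h
      rw [h, mul_zero] at hz
      obtain ⟨g, hg, h1⟩ := hroot a z hz
      obtain ⟨g', hg', h2⟩ := (hQ0 z).1 h
      refine hinf (g * g'⁻¹) (mul_mem hg (inv_mem hg')) ?_
      rw [Equiv.Perm.mul_apply, ← h2, perm_inv_apply, h1]
    have hz' : ¬ ∃ g ∈ G, g z = ∞ := by rwa [← hQ0]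
    refine ⟨z, ?_⟩
    rw [orbitMap, if_neg hz', OnePoint.coe_eq_coe]
    have := heval a z (by push Not at hz'; exact hz')
    rw [hz] at this
    exact mul_right_cancel₀ hQz this

theorem isQuotientMap_orbitMap (hG : G ≤ automorphismGroup) {a : ℂ}
    (hfree : ∀ g ∈ G, g ≠ 1 → g a ≠ a) (hinf : ∀ g ∈ G, g ∞ ≠ (a : OnePoint ℂ)) :
    IsQuotientMap G (orbitMap G a) where
  holomorphic := mdifferentiable_orbitMap hG hinf
  surjective := surjective_orbitMap hG hinf
  fibres p q := by
    constructor
    · intro h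
      by_cases hp : ∃ g ∈ G, g p = ∞ <;> by_cases hq : ∃ g ∈ G, g q = ∞
      · obtain ⟨g, hg, h1⟩ := hp
        obtain ⟨g', hg', h2⟩ := hq
        refine ⟨g'⁻¹ * g, mul_mem (inv_mem hg') hg, ?_⟩
        rw [Equiv.Perm.mul_apply, h1, ← h2, perm_inv_apply]
      · rw [orbitMap, orbitMap, if_pos hp, if_neg hq] at h
        exact absurd h.symm (OnePoint.coe_ne_infty _)
      · rw [orbitMap, orbitMap, if_neg hp, if_pos hq] at h
        exact absurd h (OnePoint.coe_ne_infty _)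
      · rw [orbitMap, orbitMap, if_neg hp, if_neg hq, OnePoint.coe_eq_coe] at h
        push Not at hp hq
        obtain ⟨z, rfl⟩ : ∃ z : ℂ, p = z := ⟨_, (coe_finitePart (hp 1 (one_mem _))).symm⟩
        -- `∏ g, (g p - z)` takes the same values at `p = z` and at `p = q`, and vanishes at `p = z`
        obtain ⟨k, c, hkc⟩ := exists_orbitProduct_eq hG hfree hinf z
        have h0 : orbitProduct G z z = 0 := (orbitProduct_eq_zero hp).2 ⟨1, one_mem _, rfl⟩
        rw [hkc _ hp, h, ← hkc _ hq, orbitProduct_eq_zero hq] at h0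
        obtain ⟨g, hg, h1⟩ := h0
        exact ⟨g⁻¹, inv_mem hg, by rw [← h1, perm_inv_apply]⟩
    · rintro ⟨g, hg, rfl⟩
      exact (orbitMap_apply a hg p).symm

end Quotient

theorem exists_isQuotientMap (G : Subgroup (Equiv.Perm (OnePoint ℂ))) [Finite G]
    (hG : G ≤ automorphismGroup) : ∃ π, IsQuotientMap G π := by
  have := Fintype.ofFinite G
  have hfin : ({p | ∃ g ∈ G, g ≠ 1 ∧ g p = p} ∪ range (fun g : G => g.1 ∞) ∪
      ({∞} : Set (OnePoint ℂ))).Finite :=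
    ((finite_branchPoints G hG).union (finite_range _)).union (finite_singleton _)
  obtain ⟨p, hp⟩ := hfin.infinite_compl.nonempty
  simp only [mem_compl_iff, mem_union, not_or, mem_singleton_iff] at hp
  obtain ⟨⟨h1, h2⟩, h3⟩ := hp
  obtain ⟨a, rfl⟩ : ∃ a : ℂ, p = a := ⟨_, (coe_finitePart h3).symm⟩
  refine ⟨orbitMap G a, isQuotientMap_orbitMap hG ?_ ?_⟩
  · exact fun g hg hg1 h => h1 ⟨g, hg, hg1, h⟩
  · exact fun g hg h => h2 ⟨⟨g, hg⟩, h⟩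

/-! ### Signatures of finite groups -/

variable {G : Subgroup (Equiv.Perm (OnePoint ℂ))}

theorem card_orbit_mul_card_stabilizer (G : Subgroup (Equiv.Perm (OnePoint ℂ)))
    (p : OnePoint ℂ) :
    Nat.card (MulAction.orbit G p) * Nat.card (MulAction.stabilizer G p) = Nat.card G := by
  rw [← Nat.card_prod]
  exact Nat.card_congr (MulAction.orbitProdStabilizerEquivGroup G p)

theorem mem_orbit_iff {p q : OnePoint ℂ} :
    q ∈ MulAction.orbit G p ↔ ∃ g ∈ G, g p = q :=
  ⟨fun ⟨g, h⟩ => ⟨g, g.2, h⟩, fun ⟨g, hg, h⟩ => ⟨⟨g, hg⟩, h⟩⟩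

theorem IsQuotientMap.fibre_eq {π : OnePoint ℂ → OnePoint ℂ} (hπ : IsQuotientMap G π)
    (p : OnePoint ℂ) : {q | π q = π p} = MulAction.orbit G p := by
  ext q
  rw [mem_orbit_iff, ← hπ.fibres p q]
  exact eq_comm

theorem one_lt_card_stabilizer_iff [Finite G] {p : OnePoint ℂ} :
    1 < Nat.card (MulAction.stabilizer G p) ↔ ∃ g ∈ G, g ≠ 1 ∧ g p = p := by
  rw [Finite.one_lt_card_iff_nontrivial, Subgroup.nontrivial_iff_exists_ne_one]
  constructor
  · rintro ⟨g, hg, h1⟩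
    exact ⟨g, g.2, fun h => h1 (Subtype.ext h), hg⟩
  · rintro ⟨g, hg, h1, hp⟩
    exact ⟨⟨g, hg⟩, hp, fun h => h1 (congrArg Subtype.val h)⟩

theorem exists_hasSignature [Finite G] (hG : G ≤ automorphismGroup)
    {π : OnePoint ℂ → OnePoint ℂ} (hπ : IsQuotientMap G π) : ∃ A r, HasSignature π A r := by
  classical
  set s : OnePoint ℂ → ℕ := fun p => Nat.card (MulAction.stabilizer G p) with hs
  have hinv : ∀ p q, π p = π q → s p = s q := by
    intro p q h
    have h1 := hπ.localMultiplicity_eq hG p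
    have h2 : MulAction.orbit G p = MulAction.orbit G q := by
      rw [← hπ.fibre_eq, ← hπ.fibre_eq, h]
    have h3 := card_orbit_mul_card_stabilizer G p
    have h4 := card_orbit_mul_card_stabilizer G q
    rw [h2, ← h4] at h3
    refine Nat.eq_of_mul_eq_mul_left ?_ h3
    exact Nat.pos_of_ne_zero (left_ne_zero_of_mul (h4.trans_ne Nat.card_pos.ne'))
  obtain ⟨σ, hσ⟩ := hπ.surjective.hasRightInverse
  refine ⟨((finite_branchPoints G hG).image π).toFinset, fun a => s (σ a), ?_, ?_, ?_⟩
  · intro a ha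
    rw [Finite.mem_toFinset] at ha
    obtain ⟨p, hp, rfl⟩ := ha
    rw [hinv (σ (π p)) p (hσ _)]
    exact one_lt_card_stabilizer_iff.2 hp
  · intro p _
    rw [hπ.localMultiplicity_eq hG, hinv (σ (π p)) p (hσ _)]
  · intro p hp
    rw [hπ.localMultiplicity_eq hG]
    rw [Finite.mem_toFinset] at hp
    have h1 : ¬ 1 < s p := fun h => hp ⟨p, one_lt_card_stabilizer_iff.1 h, rfl⟩
    have h2 : 0 < s p := Nat.card_pos
    have h3 : s p = 1 := by omega
    exact_mod_cast h3

section Signature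

variable [Finite G] {π : OnePoint ℂ → OnePoint ℂ} {A : Finset (OnePoint ℂ)} {r : OnePoint ℂ → ℕ}

theorem card_stabilizer_of_mem (hG : G ≤ automorphismGroup) (hπ : IsQuotientMap G π)
    (hA : HasSignature π A r) {p : OnePoint ℂ} (hp : π p ∈ A) :
    Nat.card (MulAction.stabilizer G p) = r (π p) := by
  have := hA.branched p hp
  rw [hπ.localMultiplicity_eq hG] at this
  exact_mod_cast this

theorem one_lt_card_stabilizer_iff_mem (hG : G ≤ automorphismGroup) (hπ : IsQuotientMap G π)
    (hA : HasSignature π A r) {p : OnePoint ℂ} :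
    1 < Nat.card (MulAction.stabilizer G p) ↔ π p ∈ A := by
  refine ⟨fun h => ?_, fun h => ?_⟩
  · by_contra hp
    have := hA.unbranched p hp
    rw [hπ.localMultiplicity_eq hG] at this
    have h1 : Nat.card (MulAction.stabilizer G p) = 1 := by exact_mod_cast this
    omega
  · rw [card_stabilizer_of_mem hG hπ hA h]
    exact hA.one_lt _ h

/-- The Riemann–Hurwitz formula for the quotient by `G`, obtained by counting the pairs of
a nontrivial element of `G` and one of its two fixed points. -/
theorem sum_one_sub_inv (hG : G ≤ automorphismGroup) (hπ : IsQuotientMap G π)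
    (hA : HasSignature π A r) :
    ∑ a ∈ A, (1 - 1 / (r a : ℚ)) = 2 - 2 / (Nat.card G : ℚ) := by
  classical
  have := Fintype.ofFinite G
  set n := Nat.card G with hn
  have hn0 : 0 < n := Nat.card_pos
  set P : Finset (OnePoint ℂ) := (finite_branchPoints G hG).toFinset with hP
  have hPmem : ∀ p, p ∈ P ↔ π p ∈ A := by
    intro p
    rw [hP, Finite.mem_toFinset, ← one_lt_card_stabilizer_iff_mem hG hπ hA,
      one_lt_card_stabilizer_iff]
    rfl
  have hdouble := Finset.sum_card_bipartiteAbove_eq_sum_card_bipartiteBelow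
    (s := (Finset.univ.erase (1 : G))) (t := P) (fun g p => g.1 p = p)
  have hleft : ∀ g ∈ (Finset.univ.erase (1 : G)),
      (Finset.bipartiteAbove (fun (g : G) p => g.1 p = p) P g).card = 2 := by
    intro g hg
    have hg1 : g.1 ≠ 1 := fun h => (Finset.mem_erase.1 hg).1 (Subtype.ext h)
    obtain ⟨p, q, hpq, h⟩ := exists_two_fixed (hG g.2)
      ((Subgroup.subtype G).isOfFinOrder (isOfFinOrder_of_finite g)) hg1
    have : Finset.bipartiteAbove (fun (g : G) p => g.1 p = p) P g = {p, q} := by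
      ext x
      rw [Finset.mem_bipartiteAbove, h x, Finset.mem_insert, Finset.mem_singleton, hP,
        Finite.mem_toFinset]
      refine ⟨fun h => h.2, fun hx => ⟨⟨g, g.2, hg1, (h x).2 hx⟩, hx⟩⟩
    rw [this, Finset.card_pair hpq]
  have hright : ∀ p ∈ P, (Finset.bipartiteBelow (fun (g : G) p => g.1 p = p)
      (Finset.univ.erase (1 : G)) p).card = r (π p) - 1 := by
    intro p hp
    rw [← card_stabilizer_of_mem hG hπ hA ((hPmem p).1 hp)]
    have h1 : Finset.bipartiteBelow (fun (g : G) p => g.1 p = p) (Finset.univ.erase (1 : G)) p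
        = (Finset.univ.filter fun g : G => g ∈ MulAction.stabilizer G p).erase 1 := by
      ext g
      simp [Finset.bipartiteBelow, MulAction.mem_stabilizer_iff, and_comm, Subgroup.smul_def]
    rw [h1, Finset.card_erase_of_mem (by simp), ← Fintype.card_subtype,
      ← Nat.card_eq_fintype_card]
  rw [Finset.sum_congr rfl hleft, Finset.sum_congr rfl hright, Finset.sum_const,
    Finset.card_erase_of_mem (Finset.mem_univ _), Finset.card_univ, ← Nat.card_eq_fintype_card,
    ← hn, ← Finset.sum_fiberwise_of_maps_to (g := π) (t := A) (fun p hp => (hPmem p).1 hp)]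
    at hdouble
  have hfibre : ∀ a ∈ A, ((∑ p ∈ P with π p = a, (r (π p) - 1) : ℕ) : ℚ)
      = n * (1 - 1 / (r a : ℚ)) := by
    intro a ha
    obtain ⟨p, rfl⟩ := hπ.surjective a
    have hr := hA.one_lt _ ha
    have h1 : ∑ q ∈ P with π q = π p, (r (π q) - 1) = ∑ q ∈ P with π q = π p, (r (π p) - 1) :=
      Finset.sum_congr rfl fun q hq => by rw [(Finset.mem_filter.1 hq).2]
    have h2 : (P.filter fun q => π q = π p).card = Nat.card (MulAction.orbit G p) := by
      rw [← hπ.fibre_eq, Nat.card_coe_set_eq, ← Set.ncard_coe_finset]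
      congr 1
      ext q
      simp only [Finset.coe_filter, mem_ofPred_eq, hPmem]
      exact ⟨fun h => h.2, fun h => ⟨h ▸ ha, h⟩⟩
    have h3 := card_orbit_mul_card_stabilizer G p
    rw [card_stabilizer_of_mem hG hπ hA ha] at h3
    rw [h1, Finset.sum_const, h2, smul_eq_mul, Nat.cast_mul, Nat.cast_sub hr.le, hn, ← h3]
    have : (r (π p) : ℚ) ≠ 0 := by
      have : r (π p) ≠ 0 := by omega
      exact_mod_cast this
    push_cast
    field_simp
  have hq := congrArg (Nat.cast : ℕ → ℚ) hdouble
  rw [Nat.cast_sum, Finset.sum_congr rfl hfibre, ← Finset.mul_sum, smul_eq_mul, Nat.cast_mul,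
    Nat.cast_sub hn0] at hq
  have hn1 : (n : ℚ) ≠ 0 := by exact_mod_cast hn0.ne'
  apply mul_left_cancel₀ hn1
  rw [← hq]
  field_simp
  push_cast
  ring

end Signature

/-- The solutions of the Riemann–Hurwitz equation with three orders, that is, of
`1 / a + 1 / b + 1 / c = 1 + 2 / n` with cleared denominators. -/
theorem triple_cases {a b c n : ℕ} (ha : 2 ≤ a) (hab : a ≤ b) (hbc : b ≤ c)
    (h : n * (b * c + a * c + a * b) = a * b * c * n + 2 * (a * b * c)) :
    a = 2 ∧ ((b = 2 ∧ n = 2 * c) ∨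
      (b = 3 ∧ ((c = 3 ∧ n = 12) ∨ (c = 4 ∧ n = 24) ∨ (c = 5 ∧ n = 60)))) := by
  have hapos : 0 < a * b * c := Nat.mul_pos (Nat.mul_pos (by omega) (by omega)) (by omega)
  have ha2 : a = 2 := by
    by_contra hne
    have h1 : b * c + a * c + a * b ≤ a * b * c := by
      have e1 : a * c ≤ b * c := Nat.mul_le_mul_right _ hab
      have e2 : a * b ≤ b * c := by rw [mul_comm b c]; exact Nat.mul_le_mul (hab.trans hbc) le_rfl
      have e3 : 3 * (b * c) ≤ a * (b * c) := Nat.mul_le_mul_right _ (by omega)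
      rw [mul_assoc]; omega
    have h2 := Nat.mul_le_mul_left n h1
    rw [h, mul_comm n] at h2
    omega
  subst ha2
  refine ⟨rfl, ?_⟩
  have hb3 : b < 4 := by
    by_contra hb
    have h1 : b * c + 2 * c + 2 * b ≤ 2 * b * c := by
      have e3 : 4 * c ≤ b * c := Nat.mul_le_mul_right _ (by omega)
      rw [mul_assoc]; omega
    have h2 := Nat.mul_le_mul_left n h1
    rw [h, mul_comm n] at h2
    omega
  have hb : b = 2 ∨ b = 3 := by omega
  rcases hb with rfl | rfl
  · left; refine ⟨rfl, ?_⟩; nlinarith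
  · right
    refine ⟨rfl, ?_⟩
    have hc : c < 6 := by
      by_contra hc
      nlinarith
    interval_cases c <;> omega

/-- The solutions of the Riemann–Hurwitz equation: each summand lies in `[1 / 2, 1)` and the sum
lies in `[1, 2)`, so that there are two or three summands. -/
theorem multiset_cases {m : Multiset ℕ} {n : ℕ} (hn : 2 ≤ n) (hm : ∀ k ∈ m, 2 ≤ k ∧ k ≤ n)
    (h : (m.map fun k : ℕ => 1 - 1 / (k : ℚ)).sum = 2 - 2 / (n : ℚ)) :
    m = {n, n} ∨ (∃ k, 2 ≤ k ∧ n = 2 * k ∧ m = {2, 2, k}) ∨ (n = 12 ∧ m = {2, 3, 3}) ∨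
      (n = 24 ∧ m = {2, 3, 4}) ∨ (n = 60 ∧ m = {2, 3, 5}) := by
  have hn0 : (0 : ℚ) < n := by positivity
  obtain ⟨l, hl, hsort⟩ : ∃ l : List ℕ, m = (l : Multiset ℕ) ∧ l.Pairwise (· ≤ ·) :=
    ⟨m.sort, (Multiset.sort_eq m (· ≤ ·)).symm, Multiset.pairwise_sort m (· ≤ ·)⟩
  subst hl
  simp only [Multiset.mem_coe] at hm
  rw [Multiset.map_coe, Multiset.sum_coe] at h
  have hhalf : ∀ k ∈ l, (1 / 2 : ℚ) ≤ 1 - 1 / (k : ℚ) := by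
    intro k hk
    have h2 : (2 : ℚ) ≤ k := by exact_mod_cast (hm k hk).1
    have : 1 / (k : ℚ) ≤ 1 / 2 := one_div_le_one_div_of_le (by norm_num) h2
    linarith
  have hlt : ∀ k ∈ l, 1 - 1 / (k : ℚ) < 1 := by
    intro k hk
    have h2 : (0 : ℚ) < k := by
      have := (hm k hk).1
      positivity
    have : 0 < 1 / (k : ℚ) := by positivity
    linarith
  have hsum2 : 2 - 2 / (n : ℚ) < 2 := by
    have : 0 < 2 / (n : ℚ) := by positivity
    linarith
  have hsum1 : 1 ≤ 2 - 2 / (n : ℚ) := by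
    have h2 : (2 : ℚ) ≤ n := by exact_mod_cast hn
    have : 2 / (n : ℚ) ≤ 1 := (div_le_one hn0).2 h2
    linarith
  match l, hsort, hm, h, hhalf, hlt with
  | [], _, _, h, _, _ =>
    simp only [List.map_nil, List.sum_nil] at h
    linarith
  | [a], _, _, h, _, hlt =>
    have := hlt a (by simp)
    simp only [List.map_cons, List.map_nil, List.sum_cons, List.sum_nil] at h
    linarith
  | [a, b], _, hm, h, _, _ =>
    left
    obtain ⟨ha, han⟩ := hm a (by simp)
    obtain ⟨hb, hbn⟩ := hm b (by simp)
    simp only [List.map_cons, List.map_nil, List.sum_cons, List.sum_nil] at h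
    have e1 : 1 / (n : ℚ) ≤ 1 / a :=
      one_div_le_one_div_of_le (by positivity) (by exact_mod_cast han)
    have e2 : 1 / (n : ℚ) ≤ 1 / b :=
      one_div_le_one_div_of_le (by positivity) (by exact_mod_cast hbn)
    have e3 : 2 / (n : ℚ) = 1 / n + 1 / n := by ring
    have f1 : 1 / (a : ℚ) = 1 / n := by linarith
    have f2 : 1 / (b : ℚ) = 1 / n := by linarith
    simp only [one_div, inv_inj, Nat.cast_inj] at f1 f2
    rw [f1, f2]; rfl
  | [a, b, c], hsort, hm, h, _, _ =>
    right
    obtain ⟨ha, -⟩ := hm a (by simp)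
    obtain ⟨hb, -⟩ := hm b (by simp)
    obtain ⟨hc, -⟩ := hm c (by simp)
    simp only [List.map_cons, List.map_nil, List.sum_cons, List.sum_nil] at h
    have key : n * (b * c + a * c + a * b) = a * b * c * n + 2 * (a * b * c) := by
      have : (n : ℚ) * (b * c + a * c + a * b) = a * b * c * n + 2 * (a * b * c) := by
        have a0 : (a : ℚ) ≠ 0 := by positivity
        have b0 : (b : ℚ) ≠ 0 := by positivity
        have c0 : (c : ℚ) ≠ 0 := by positivity
        field_simp at h
        linear_combination -h
      exact_mod_cast this
    simp only [List.pairwise_cons, List.mem_cons, List.not_mem_nil, or_false] at hsort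
    obtain ⟨rfl, h1⟩ := triple_cases ha (hsort.1 b (Or.inl rfl)) (hsort.2.1 c rfl) key
    rcases h1 with ⟨rfl, h1⟩ | ⟨rfl, h1⟩
    · exact Or.inl ⟨c, hc, h1, rfl⟩
    · rcases h1 with ⟨rfl, h1⟩ | ⟨rfl, h1⟩ | ⟨rfl, h1⟩
      · exact Or.inr (Or.inl ⟨h1, rfl⟩)
      · exact Or.inr (Or.inr (Or.inl ⟨h1, rfl⟩))
      · exact Or.inr (Or.inr (Or.inr ⟨h1, rfl⟩))
  | a :: b :: c :: d :: t, _, _, h, hhalf, _ =>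
    exfalso
    have e : ∀ l : List ℕ, (∀ k ∈ l, (1 / 2 : ℚ) ≤ 1 - 1 / (k : ℚ)) →
        0 ≤ (l.map fun k : ℕ => 1 - 1 / (k : ℚ)).sum := by
      intro l hl
      refine List.sum_nonneg ?_
      intro x hx
      obtain ⟨k, hk, rfl⟩ := List.mem_map.1 hx
      have := hl k hk
      linarith
    have e1 := e t fun k hk => hhalf k (by simp [hk])
    have f1 := hhalf a (by simp)
    have f2 := hhalf b (by simp)
    have f3 := hhalf c (by simp)
    have f4 := hhalf d (by simp)
    simp only [List.map_cons, List.sum_cons] at h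
    linarith

section Cases

variable [Finite G] {π : OnePoint ℂ → OnePoint ℂ} {A : Finset (OnePoint ℂ)} {r : OnePoint ℂ → ℕ}

theorem signature_cases (hG : G ≤ automorphismGroup) (hne : G ≠ ⊥) (hπ : IsQuotientMap G π)
    (hA : HasSignature π A r) :
    A.val.map r = {Nat.card G, Nat.card G} ∨
      (∃ k, 2 ≤ k ∧ Nat.card G = 2 * k ∧ A.val.map r = {2, 2, k}) ∨
      (Nat.card G = 12 ∧ A.val.map r = {2, 3, 3}) ∨
      (Nat.card G = 24 ∧ A.val.map r = {2, 3, 4}) ∨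
      (Nat.card G = 60 ∧ A.val.map r = {2, 3, 5}) := by
  refine multiset_cases ?_ ?_ ?_
  · have h1 : 0 < Nat.card G := Nat.card_pos
    have h2 : Nat.card G ≠ 1 := fun h => hne (Subgroup.card_eq_one.1 h)
    omega
  · intro k hk
    obtain ⟨a, ha, rfl⟩ := Multiset.mem_map.1 hk
    refine ⟨hA.one_lt a ha, ?_⟩
    obtain ⟨p, rfl⟩ := hπ.surjective a
    rw [← card_stabilizer_of_mem hG hπ hA ha]
    exact Subgroup.card_le_card_group _
  · rw [Multiset.map_map]
    exact sum_one_sub_inv hG hπ hA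

theorem exists_card_stabilizer_of_mem (hG : G ≤ automorphismGroup) (hπ : IsQuotientMap G π)
    (hA : HasSignature π A r) {s : ℕ} (hs : s ∈ A.val.map r) :
    ∃ p : OnePoint ℂ, Nat.card (MulAction.stabilizer G p) = s := by
  obtain ⟨a, ha, rfl⟩ := Multiset.mem_map.1 hs
  obtain ⟨p, rfl⟩ := hπ.surjective a
  exact ⟨p, card_stabilizer_of_mem hG hπ hA ha⟩

end Cases

/-- A point whose stabilizer has order at least `3` and whose orbit has at least `3` points
occurs only for the groups of orders `12`, `24` and `60`. -/
theorem polyhedral_cases [Finite G] (hG : G ≤ automorphismGroup) {p : OnePoint ℂ}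
    (hs : 3 ≤ Nat.card (MulAction.stabilizer G p)) (ho : 3 ≤ Nat.card (MulAction.orbit G p)) :
    ∃ π A r, IsQuotientMap G π ∧ HasSignature π A r ∧
      Nat.card (MulAction.stabilizer G p) ∈ A.val.map r ∧
      ((Nat.card G = 12 ∧ A.val.map r = {2, 3, 3}) ∨
      (Nat.card G = 24 ∧ A.val.map r = {2, 3, 4}) ∨
      (Nat.card G = 60 ∧ A.val.map r = {2, 3, 5})) := by
  have hne : G ≠ ⊥ := by
    rintro rfl
    have h1 : Nat.card (MulAction.stabilizer (⊥ : Subgroup (Equiv.Perm (OnePoint ℂ))) p) ≤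
      Nat.card (⊥ : Subgroup (Equiv.Perm (OnePoint ℂ))) := Subgroup.card_le_card_group _
    rw [Subgroup.card_bot] at h1
    omega
  obtain ⟨π, hπ⟩ := exists_isQuotientMap G hG
  obtain ⟨A, r, hA⟩ := exists_hasSignature hG hπ
  have hp : π p ∈ A := (one_lt_card_stabilizer_iff_mem hG hπ hA).1 (by omega)
  have hmem : Nat.card (MulAction.stabilizer G p) ∈ A.val.map r := by
    rw [card_stabilizer_of_mem hG hπ hA hp]
    exact Multiset.mem_map_of_mem r hp
  have hmul := card_orbit_mul_card_stabilizer G p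
  refine ⟨π, A, r, hπ, hA, hmem, ?_⟩
  rcases signature_cases hG hne hπ hA with h | ⟨k, hk, hn, h⟩ | h | h | h
  · exfalso
    rw [h] at hmem
    have h1 : Nat.card (MulAction.stabilizer G p) = Nat.card G := by simpa using hmem
    rw [h1] at hmul
    have h2 : 0 < Nat.card G := Nat.card_pos
    nlinarith
  · exfalso
    rw [h] at hmem
    have h1 : Nat.card (MulAction.stabilizer G p) = 2 ∨
      Nat.card (MulAction.stabilizer G p) = k := by simpa using hmem
    have h2 : Nat.card (MulAction.stabilizer G p) = k := by omega
    rw [h2, hn] at hmul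
    nlinarith
  · exact Or.inl h
  · exact Or.inr (Or.inl h)
  · exact Or.inr (Or.inr h)

/-- If a stabilizer order occurs only once in the signature, then the points with this
stabilizer order form one orbit. -/
theorem mem_orbit_of_count_eq_one [Finite G] {π : OnePoint ℂ → OnePoint ℂ}
    {A : Finset (OnePoint ℂ)} {r : OnePoint ℂ → ℕ} (hG : G ≤ automorphismGroup)
    (hπ : IsQuotientMap G π) (hA : HasSignature π A r) {p q : OnePoint ℂ}
    (hp : 1 < Nat.card (MulAction.stabilizer G p))
    (hpq : Nat.card (MulAction.stabilizer G q) = Nat.card (MulAction.stabilizer G p))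
    (hcount : (A.val.map r).count (Nat.card (MulAction.stabilizer G p)) = 1) :
    q ∈ MulAction.orbit G p := by
  classical
  have hpA := (one_lt_card_stabilizer_iff_mem hG hπ hA).1 hp
  have hqA := (one_lt_card_stabilizer_iff_mem hG hπ hA).1 (hpq ▸ hp)
  rw [card_stabilizer_of_mem hG hπ hA hpA] at hpq hcount
  rw [card_stabilizer_of_mem hG hπ hA hqA] at hpq
  rw [Multiset.count_map] at hcount
  have hcard : (A.filter fun a => r (π p) = r a).card = 1 := hcount
  rw [← hπ.fibre_eq]
  exact Finset.card_le_one.1 hcard.le (π q) (by simp [hqA, hpq]) (π p) (by simp [hpA])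

/-! ### Conjugation of finite groups -/

/-- The conjugate `φ G φ⁻¹`. -/
abbrev conjugate (φ : Equiv.Perm (OnePoint ℂ)) (G : Subgroup (Equiv.Perm (OnePoint ℂ))) :
    Subgroup (Equiv.Perm (OnePoint ℂ)) := G.map (MulAut.conj φ).toMonoidHom

theorem conjugate_le {φ : Equiv.Perm (OnePoint ℂ)} (hφ : φ ∈ automorphismGroup)
    (hG : G ≤ automorphismGroup) : conjugate φ G ≤ automorphismGroup := by
  rintro f ⟨g, hg, rfl⟩
  exact mul_mem (mul_mem hφ (hG hg)) (inv_mem hφ)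

theorem conjugate_conjugate (φ ψ : Equiv.Perm (OnePoint ℂ)) :
    conjugate φ (conjugate ψ G) = conjugate (φ * ψ) G := by
  rw [conjugate, conjugate, Subgroup.map_map, conjugate]
  congr 1

theorem conjugate_inv_conjugate (φ : Equiv.Perm (OnePoint ℂ)) :
    conjugate φ⁻¹ (conjugate φ G) = G := by
  rw [conjugate_conjugate, inv_mul_cancel]
  ext f
  simp

theorem card_conjugate (φ : Equiv.Perm (OnePoint ℂ)) :
    Nat.card (conjugate φ G) = Nat.card G :=
  (Nat.card_congr (G.equivMapOfInjective _ (MulAut.conj φ).injective).toEquiv).symm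

theorem orbit_conjugate (φ : Equiv.Perm (OnePoint ℂ)) (p : OnePoint ℂ) :
    MulAction.orbit (conjugate φ G) (φ p) = φ '' MulAction.orbit G p := by
  ext q
  rw [mem_orbit_iff]
  constructor
  · rintro ⟨f, ⟨g, hg, rfl⟩, rfl⟩
    refine ⟨g p, mem_orbit_iff.2 ⟨g, hg, rfl⟩, ?_⟩
    simp [Equiv.Perm.mul_apply, perm_inv_apply]
  · rintro ⟨x, hx, rfl⟩
    obtain ⟨g, hg, rfl⟩ := mem_orbit_iff.1 hx
    refine ⟨φ * g * φ⁻¹, ⟨g, hg, rfl⟩, ?_⟩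
    rw [Equiv.Perm.mul_apply, Equiv.Perm.mul_apply, perm_inv_apply]

theorem card_orbit_conjugate (φ : Equiv.Perm (OnePoint ℂ)) (p : OnePoint ℂ) :
    Nat.card (MulAction.orbit (conjugate φ G) (φ p)) = Nat.card (MulAction.orbit G p) := by
  rw [orbit_conjugate, Nat.card_image_of_injective φ.injective]

theorem card_stabilizer_conjugate [Finite G] (φ : Equiv.Perm (OnePoint ℂ)) (p : OnePoint ℂ) :
    Nat.card (MulAction.stabilizer (conjugate φ G) (φ p)) =
      Nat.card (MulAction.stabilizer G p) := by
  have h1 := card_orbit_mul_card_stabilizer G p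
  have h2 := card_orbit_mul_card_stabilizer (conjugate φ G) (φ p)
  rw [card_orbit_conjugate, card_conjugate, ← h1] at h2
  refine Nat.eq_of_mul_eq_mul_left ?_ h2
  exact Nat.pos_of_ne_zero (left_ne_zero_of_mul (h1.trans_ne Nat.card_pos.ne'))

theorem exists_ne_ne (p q : OnePoint ℂ) : ∃ r, r ≠ p ∧ r ≠ q := by
  obtain ⟨r, hr⟩ := (Set.toFinite ({p, q} : Set (OnePoint ℂ))).infinite_compl.nonempty
  simp only [mem_compl_iff, mem_insert_iff, mem_singleton_iff, not_or] at hr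
  exact ⟨r, hr⟩

/-- The stabilizer of a point fixes a second point: if the first one is moved to `∞`, then the
stabilizer consists of affine maps, which fix the centroid of each of their orbits in `ℂ`. -/
theorem exists_second_fixed [Finite G] (hG : G ≤ automorphismGroup) (p : OnePoint ℂ) :
    ∃ q, q ≠ p ∧ ∀ g ∈ G, g p = p → g q = q := by
  have := Fintype.ofFinite (MulAction.stabilizer G p)
  obtain ⟨x, hx, -⟩ := exists_ne_ne p p
  obtain ⟨y, hyp, hyx⟩ := exists_ne_ne p x
  obtain ⟨φ, hφ, -, hinf, -⟩ := exists_normalizing hx hyx.symm hyp.symm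
  have haff : ∀ g ∈ G, g p = p → ∃ a b : ℂ, ∀ z : ℂ, (φ * g * φ⁻¹) z = (a * z + b : ℂ) := by
    intro g hg hgp
    obtain ⟨a, b, -, h⟩ := eq_affine (mul_mem (mul_mem hφ (hG hg)) (inv_mem hφ))
      (conj_apply_eq hinf hgp)
    exact ⟨a, b, h⟩
  set S := MulAction.stabilizer G p with hS
  set c : S → ℂ := fun g => finitePart ((φ * g.1.1 * φ⁻¹) (0 : ℂ)) with hc
  have hc' : ∀ g : S, (φ * g.1.1 * φ⁻¹) (0 : ℂ) = (c g : OnePoint ℂ) := by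
    intro g
    obtain ⟨a, b, h⟩ := haff g.1.1 g.1.2 g.2
    simp only [hc, h, finitePart_coe]
  set q : ℂ := (∑ g, c g) / Fintype.card S with hq
  have hcard : (Fintype.card S : ℂ) ≠ 0 := by exact_mod_cast Fintype.card_ne_zero
  refine ⟨φ⁻¹ q, fun h => ?_, fun g hg hgp => ?_⟩
  · have h1 := congrArg φ h
    rw [perm_apply_inv, hinf] at h1
    exact OnePoint.coe_ne_infty _ h1
  · apply φ.injective
    rw [perm_apply_inv, ← Equiv.Perm.mul_apply, ← Equiv.Perm.mul_apply]
    obtain ⟨a, b, h⟩ := haff g hg hgp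
    rw [h, OnePoint.coe_eq_coe]
    let g' : S := ⟨⟨g, hg⟩, hgp⟩
    have hmul : ∀ k : S, c (g' * k) = a * c k + b := by
      intro k
      have h1 := hc' (g' * k)
      have h2 : φ * (g' * k).1.1 * φ⁻¹ = (φ * g * φ⁻¹) * (φ * k.1.1 * φ⁻¹) := by
        change φ * (g * k.1.1) * φ⁻¹ = _
        group
      rw [h2, Equiv.Perm.mul_apply, hc', h, OnePoint.coe_eq_coe] at h1
      exact h1.symm
    have hsum : ∑ k, c k = a * ∑ k, c k + Fintype.card S * b := by
      conv_lhs => rw [← Equiv.sum_comp (Equiv.mulLeft g') c]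
      simp only [Equiv.coe_mulLeft, hmul]
      rw [Finset.sum_add_distrib, ← Finset.mul_sum, Finset.sum_const, nsmul_eq_mul,
        Finset.card_univ]
    rw [hq]
    field_simp
    linear_combination -hsum

/-- If the stabilizer of `0` has order `m` and fixes `∞`, it consists of the scalings by the
`m`-th roots of unity. -/
theorem stabilizer_zero [Finite G] (hG : G ≤ automorphismGroup)
    (hfix : ∀ g ∈ G, g (0 : ℂ) = (0 : ℂ) → g ∞ = ∞) {m : ℕ}
    (hm : Nat.card (MulAction.stabilizer G ((0 : ℂ) : OnePoint ℂ)) = m) :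
    (∀ g ∈ G, g (0 : ℂ) = (0 : ℂ) → ∃ c : ℂ, c ^ m = 1 ∧ ∀ z : ℂ, g z = (c * z : ℂ)) ∧
      ∀ c : ℂ, c ^ m = 1 → ∃ g ∈ G, g ∞ = ∞ ∧ ∀ z : ℂ, g z = (c * z : ℂ) := by
  set S := MulAction.stabilizer G ((0 : ℂ) : OnePoint ℂ) with hS
  have hm0 : m ≠ 0 := by rw [← hm]; exact Nat.card_pos.ne'
  have : NeZero m := ⟨hm0⟩
  have h1 : ∀ g : S, ∃ c : ℂ, c ^ m = 1 ∧ ∀ z : ℂ, g.1.1 z = (c * z : ℂ) := by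
    intro g
    obtain ⟨c, -, h⟩ := exists_scaling (hG g.1.2) (hfix _ g.1.2 g.2) g.2
    refine ⟨c, ?_, h⟩
    have hpow : ∀ k : ℕ, (g.1.1 ^ k) (1 : ℂ) = (c ^ k : ℂ) := by
      intro k
      induction k with
      | zero => simp
      | succ k ih => rw [pow_succ', Equiv.Perm.mul_apply, ih, h, pow_succ']
    have h2 : g ^ m = 1 := by rw [← hm]; exact pow_card_eq_one'
    have h3 : g.1.1 ^ m = 1 := by
      have := congrArg (fun x : S => x.1.1) h2
      exact this
    have h4 := hpow m
    rw [h3, Equiv.Perm.one_apply, OnePoint.coe_eq_coe] at h4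
    exact h4.symm
  refine ⟨fun g hg h0 => h1 ⟨⟨g, hg⟩, h0⟩, ?_⟩
  choose c hc hcz using h1
  let T : S → rootsOfUnity m ℂ := fun g => rootsOfUnity.mkOfPowEq (c g) (hc g)
  have hT : ∀ g, ((T g : ℂˣ) : ℂ) = c g := fun g => rootsOfUnity.val_mkOfPowEq_coe _ _
  have hinj : Function.Injective T := by
    intro g g' h
    have h2 : c g = c g' := by rw [← hT, ← hT, h]
    refine Subtype.ext (Subtype.ext (Equiv.ext fun x => ?_))
    induction x using OnePoint.rec with
    | infty => rw [hfix _ g.1.2 g.2, hfix _ g'.1.2 g'.2]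
    | coe z => rw [hcz, hcz, h2]
  have hbij := hinj.bijective_of_nat_card_le (by rw [Complex.card_rootsOfUnity, hm])
  intro d hd
  obtain ⟨g, hg⟩ := hbij.2 (rootsOfUnity.mkOfPowEq d hd)
  have h3 : c g = d := by rw [← hT, hg, rootsOfUnity.val_mkOfPowEq_coe]
  exact ⟨g.1.1, g.1.2, hfix _ g.1.2 g.2, fun z => by rw [hcz, h3]⟩

/-! ### Groups determined by an orbit -/

/-- The automorphisms of the sphere that preserve the set `S`. -/
def setStabilizer (S : Set (OnePoint ℂ)) : Subgroup (Equiv.Perm (OnePoint ℂ)) where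
  carrier := {f | f ∈ automorphismGroup ∧ f '' S = S}
  mul_mem' := fun {f g} hf hg => ⟨mul_mem hf.1 hg.1, by
    rw [Equiv.Perm.coe_mul, image_comp, hg.2, hf.2]⟩
  one_mem' := ⟨one_mem _, by simp⟩
  inv_mem' := fun {f} hf => ⟨inv_mem hf.1, by
    conv_lhs => rw [← hf.2]
    rw [← image_comp]
    exact (image_congr fun x _ => perm_inv_apply f x).trans (image_id' S)⟩

theorem setStabilizer_le (S : Set (OnePoint ℂ)) : setStabilizer S ≤ automorphismGroup :=
  fun _ h => h.1

theorem finite_setStabilizer {S : Set (OnePoint ℂ)} (hS : S.Finite) (h3 : 3 ≤ S.ncard) :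
    Finite (setStabilizer S) := by
  classical
  have := hS.to_subtype
  have hmaps : ∀ f : setStabilizer S, ∀ x : S, f.1 x ∈ S := fun f x => by
    have h := mem_image_of_mem f.1 x.2
    rwa [f.2.2] at h
  refine Finite.of_injective (fun (f : setStabilizer S) (x : S) => (⟨f.1 x, hmaps f x⟩ : S)) ?_
  intro f g h
  obtain ⟨p, q, r, hp, hq, hr, hpq, hpr, hqr⟩ := (Set.two_lt_ncard_iff hS).1 h3
  have hval : ∀ x ∈ S, f.1 x = g.1 x := fun x hx => congrArg Subtype.val (congrFun h ⟨x, hx⟩)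
  exact Subtype.ext (eq_of_three f.2.1 g.2.1 hpq hpr hqr (hval p hp) (hval q hq) (hval r hr))

/-- The size of an orbit with large stabilizers determines the order of the group. -/
theorem card_eq_of_card_orbit [Finite G] (hG : G ≤ automorphismGroup) {p : OnePoint ℂ}
    (hs : 3 ≤ Nat.card (MulAction.stabilizer G p)) :
    (Nat.card (MulAction.orbit G p) = 4 → Nat.card G = 12) ∧
    (Nat.card (MulAction.orbit G p) = 6 → Nat.card G = 24) ∧
    (Nat.card (MulAction.orbit G p) = 12 → Nat.card G = 60) := by
  have key : 3 ≤ Nat.card (MulAction.orbit G p) →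
      (Nat.card (MulAction.orbit G p) = 4 → Nat.card G = 12) ∧
      (Nat.card (MulAction.orbit G p) = 6 → Nat.card G = 24) ∧
      (Nat.card (MulAction.orbit G p) = 12 → Nat.card G = 60) := by
    intro ho
    have hmul := card_orbit_mul_card_stabilizer G p
    obtain ⟨π, A, r, -, -, hmem, h⟩ := polyhedral_cases hG hs ho
    rcases h with ⟨hn, h⟩ | ⟨hn, h⟩ | ⟨hn, h⟩ <;> rw [h] at hmem <;>
      simp only [Multiset.insert_eq_cons, Multiset.mem_cons, Multiset.mem_singleton] at hmem <;>
      refine ⟨fun h1 => ?_, fun h1 => ?_, fun h1 => ?_⟩ <;> rw [h1, hn] at hmul <;> omega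
  refine ⟨fun h => (key (by omega)).1 h, fun h => (key (by omega)).2.1 h,
    fun h => (key (by omega)).2.2 h⟩

/-- A polyhedral group is the full group of automorphisms preserving its smallest orbit, because
that group has an orbit of the same size. -/
theorem eq_setStabilizer_orbit [Finite G] (hG : G ≤ automorphismGroup) {p : OnePoint ℂ}
    (hs : 3 ≤ Nat.card (MulAction.stabilizer G p))
    (ho : Nat.card (MulAction.orbit G p) = 4 ∨ Nat.card (MulAction.orbit G p) = 6 ∨
      Nat.card (MulAction.orbit G p) = 12) :
    G = setStabilizer (MulAction.orbit G p) := by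
  set S := MulAction.orbit G p with hS
  have hfin : S.Finite := by
    refine Set.finite_coe_iff.1 (Nat.finite_of_card_ne_zero ?_)
    omega
  have hpos : 0 < Nat.card S := by omega
  have hH := finite_setStabilizer hfin (by rw [← Nat.card_coe_set_eq]; omega)
  have hle : G ≤ setStabilizer S := by
    intro g hg
    refine ⟨hG hg, ?_⟩
    have h1 : ∀ f ∈ G, f '' S ⊆ S := by
      rintro f hf _ ⟨x, hx, rfl⟩
      obtain ⟨k, hk, rfl⟩ := mem_orbit_iff.1 hx
      exact mem_orbit_iff.2 ⟨f * k, mul_mem hf hk, rfl⟩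
    refine (h1 g hg).antisymm fun x hx => ?_
    exact ⟨g⁻¹ x, h1 _ (inv_mem hg) ⟨x, hx, rfl⟩, perm_apply_inv g x⟩
  have horb : MulAction.orbit (setStabilizer S) p = S := by
    ext x
    rw [mem_orbit_iff]
    constructor
    · rintro ⟨f, hf, rfl⟩
      rw [← hf.2]
      exact mem_image_of_mem f (MulAction.mem_orbit_self p)
    · intro hx
      obtain ⟨g, hg, rfl⟩ := mem_orbit_iff.1 hx
      exact ⟨g, hle hg, rfl⟩
  have hs' : 3 ≤ Nat.card (MulAction.stabilizer (setStabilizer S) p) := by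
    have h1 := card_orbit_mul_card_stabilizer G p
    have h2 := card_orbit_mul_card_stabilizer (setStabilizer S) p
    have h3 := Subgroup.card_le_of_le hle
    rw [horb] at h2
    rw [← h1, ← h2] at h3
    exact hs.trans (Nat.le_of_mul_le_mul_left h3 hpos)
  have c1 := card_eq_of_card_orbit hG hs
  have c2 := card_eq_of_card_orbit (setStabilizer_le S) hs'
  rw [horb] at c2
  refine Subgroup.eq_of_le_of_card_ge hle ?_
  rcases ho with h | h | h
  · rw [c1.1 h, c2.1 h]
  · rw [c1.2.1 h, c2.2.1 h]
  · rw [c1.2.2 h, c2.2.2 h]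

/-! ### The smallest orbits of the polyhedral groups -/

/-- The points `c * d` of the sphere, where `c` runs through the `m`-th roots of unity. -/
def rootPoints (m : ℕ) (d : ℂ) : Set (OnePoint ℂ) := {p | ∃ c : ℂ, c ^ m = 1 ∧ p = (c * d : ℂ)}

theorem ncard_rootPoints {m : ℕ} (hm : m ≠ 0) {d : ℂ} (hd : d ≠ 0) :
    (rootPoints m d).ncard = m := by
  have : NeZero m := ⟨hm⟩
  have h1 : rootPoints m d =
      range (fun η : rootsOfUnity m ℂ => ((((η : ℂˣ) : ℂ) * d : ℂ) : OnePoint ℂ)) := by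
    ext p
    constructor
    · rintro ⟨c, hc, rfl⟩
      exact ⟨rootsOfUnity.mkOfPowEq c hc, by simp only [rootsOfUnity.val_mkOfPowEq_coe]⟩
    · rintro ⟨η, rfl⟩
      refine ⟨((η : ℂˣ) : ℂ), ?_, rfl⟩
      have := η.2
      rw [mem_rootsOfUnity'] at this
      exact this
  rw [h1, ← Nat.card_coe_set_eq, Nat.card_range_of_injective, Complex.card_rootsOfUnity]
  intro η η' h
  have h2 : ((η : ℂˣ) : ℂ) * d = ((η' : ℂˣ) : ℂ) * d := OnePoint.coe_injective h
  exact Subtype.ext (Units.ext (mul_right_cancel₀ hd h2))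

theorem ne_zero_of_pow_eq_one {m : ℕ} (hm : m ≠ 0) {c : ℂ} (h : c ^ m = 1) : c ≠ 0 := by
  rintro rfl
  rw [zero_pow hm] at h
  exact zero_ne_one h

theorem zero_notMem_rootPoints {m : ℕ} (hm : m ≠ 0) {d : ℂ} (hd : d ≠ 0) :
    ((0 : ℂ) : OnePoint ℂ) ∉ rootPoints m d := by
  rintro ⟨c, hc, h⟩
  exact mul_ne_zero (ne_zero_of_pow_eq_one hm hc) hd (OnePoint.coe_injective h).symm

theorem infty_notMem_rootPoints (m : ℕ) (d : ℂ) : (∞ : OnePoint ℂ) ∉ rootPoints m d := by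
  rintro ⟨c, hc, h⟩
  exact OnePoint.infty_ne_coe _ h

theorem finite_rootPoints {m : ℕ} (hm : m ≠ 0) {d : ℂ} (hd : d ≠ 0) :
    (rootPoints m d).Finite :=
  finite_of_ncard_ne_zero (by rwa [ncard_rootPoints hm hd])

/-- A fixed primitive fifth root of unity. -/
noncomputable def zeta5 : ℂ := Complex.exp (2 * Real.pi * Complex.I / (5 : ℕ))

theorem isPrimitiveRoot_zeta5 : IsPrimitiveRoot zeta5 5 :=
  Complex.isPrimitiveRoot_exp 5 (by norm_num)

/-- The vertices of a tetrahedron on the sphere, one of them at `0`. -/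
def tetrahedronVertices : Set (OnePoint ℂ) := insert ((0 : ℂ) : OnePoint ℂ) (rootPoints 3 1)

/-- The vertices of an octahedron on the sphere, with an axis from `0` to `∞`. -/
def octahedronVertices : Set (OnePoint ℂ) :=
  insert ∞ (insert ((0 : ℂ) : OnePoint ℂ) (rootPoints 4 1))

/-- Two regular pentagons around the axis from `0` to `∞`, together with the two poles. -/
def doublePentagon (d : ℂ) : Set (OnePoint ℂ) :=
  insert ∞ (insert ((0 : ℂ) : OnePoint ℂ) (rootPoints 5 1 ∪ rootPoints 5 d))

/-- The vertices of an icosahedron on the sphere, with an axis from `0` to `∞`. -/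
noncomputable def icosahedronVertices : Set (OnePoint ℂ) := doublePentagon (zeta5 + zeta5⁻¹ - 1)

theorem ncard_tetrahedronVertices : tetrahedronVertices.ncard = 4 := by
  rw [tetrahedronVertices, ncard_insert_of_notMem
    (zero_notMem_rootPoints (by norm_num) one_ne_zero)
    (finite_rootPoints (by norm_num) one_ne_zero), ncard_rootPoints (by norm_num) one_ne_zero]

theorem ncard_octahedronVertices : octahedronVertices.ncard = 6 := by
  have hf := finite_rootPoints (m := 4) (by norm_num) one_ne_zero
  rw [octahedronVertices, ncard_insert_of_notMem _ (hf.insert _), ncard_insert_of_notMem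
    (zero_notMem_rootPoints (by norm_num) one_ne_zero) hf,
    ncard_rootPoints (by norm_num) one_ne_zero]
  simp [infty_notMem_rootPoints]

theorem ncard_doublePentagon {d : ℂ} (hd : d ≠ 0) (h5 : d ^ 5 ≠ 1) :
    (doublePentagon d).ncard = 12 := by
  have hf := finite_rootPoints (m := 5) (by norm_num) one_ne_zero
  have hf' := finite_rootPoints (m := 5) (by norm_num) hd
  have hdisj : Disjoint (rootPoints 5 1) (rootPoints 5 d) := by
    rw [disjoint_left]
    rintro p ⟨c, hc, rfl⟩ ⟨c', hc', h⟩
    have h1 : c * 1 = c' * d := OnePoint.coe_injective h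
    have h2 := congrArg (· ^ 5) h1
    simp only [mul_pow, hc, hc', one_pow, one_mul] at h2
    exact h5 h2.symm
  rw [doublePentagon, ncard_insert_of_notMem _ ((hf.union hf').insert _), ncard_insert_of_notMem
    _ (hf.union hf'), ncard_union_eq hdisj hf hf',
    ncard_rootPoints (by norm_num) one_ne_zero, ncard_rootPoints (by norm_num) hd]
  · rw [mem_union, not_or]
    exact ⟨zero_notMem_rootPoints (by norm_num) one_ne_zero,
      zero_notMem_rootPoints (by norm_num) hd⟩
  · simp [infty_notMem_rootPoints]

/-- The common second fixed point of the stabilizer of `p`, and another point of the orbit of `p`,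
can be moved to `∞` and `1`. -/
theorem exists_normalized_conjugate [Finite G] (hG : G ≤ automorphismGroup) {p : OnePoint ℂ}
    (ho : 3 ≤ Nat.card (MulAction.orbit G p)) :
    ∃ φ ∈ automorphismGroup, φ p = (0 : ℂ) ∧
      (∀ g ∈ conjugate φ G, g (0 : ℂ) = (0 : ℂ) → g ∞ = ∞) ∧
      ∃ g ∈ conjugate φ G, g (0 : ℂ) = (1 : ℂ) := by
  obtain ⟨q, hqp, hq⟩ := exists_second_fixed hG p
  obtain ⟨x, hx, hxq⟩ : ∃ x ∈ MulAction.orbit G p, x ∉ ({p, q} : Set (OnePoint ℂ)) := by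
    by_contra! H
    have h1 := ncard_le_ncard (s := MulAction.orbit G p) (t := {p, q}) H
    rw [ncard_pair hqp.symm, ← Nat.card_coe_set_eq] at h1
    omega
  simp only [mem_insert_iff, mem_singleton_iff, not_or] at hxq
  obtain ⟨φ, hφ, h0, hinf, h1⟩ := exists_normalizing hqp.symm (Ne.symm hxq.1) (Ne.symm hxq.2)
  refine ⟨φ, hφ, h0, ?_, ?_⟩
  · rintro _ ⟨g, hg, rfl⟩ hg0
    refine conj_apply_eq hinf (hq g hg ?_)
    have h2 : φ (g (φ⁻¹ (0 : ℂ))) = (0 : ℂ) := hg0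
    rw [← h0, perm_inv_apply] at h2
    exact φ.injective h2
  · obtain ⟨g, hg, rfl⟩ := mem_orbit_iff.1 hx
    refine ⟨φ * g * φ⁻¹, ⟨g, hg, rfl⟩, ?_⟩
    rw [Equiv.Perm.mul_apply, Equiv.Perm.mul_apply, ← h0, perm_inv_apply, h1]

/-- In the octahedral and icosahedral cases the second fixed point of the stabilizer of a vertex
is a vertex. -/
theorem mem_orbit_of_fixed [Finite G] (hG : G ≤ automorphismGroup) {p q : OnePoint ℂ}
    (h : (Nat.card (MulAction.stabilizer G p) = 4 ∧ Nat.card (MulAction.orbit G p) = 6) ∨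
      (Nat.card (MulAction.stabilizer G p) = 5 ∧ Nat.card (MulAction.orbit G p) = 12))
    (hq : ∀ g ∈ G, g p = p → g q = q) :
    Nat.card (MulAction.stabilizer G q) = Nat.card (MulAction.stabilizer G p) ∧
      q ∈ MulAction.orbit G p := by
  have hle : Nat.card (MulAction.stabilizer G p) ≤ Nat.card (MulAction.stabilizer G q) := by
    refine Subgroup.card_le_of_le fun g hg => ?_
    exact hq g.1 g.2 hg
  obtain ⟨π, A, r, hπ, hA, hmem, hcases⟩ := polyhedral_cases hG (p := p)
    (by rcases h with h | h <;> omega) (by rcases h with h | h <;> omega)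
  have hq1 : 1 < Nat.card (MulAction.stabilizer G q) := by rcases h with h | h <;> omega
  have hqA := (one_lt_card_stabilizer_iff_mem hG hπ hA).1 hq1
  have hqmem : Nat.card (MulAction.stabilizer G q) ∈ A.val.map r := by
    rw [card_stabilizer_of_mem hG hπ hA hqA]
    exact Multiset.mem_map_of_mem r hqA
  have hmul := card_orbit_mul_card_stabilizer G p
  have key : Nat.card (MulAction.stabilizer G q) = Nat.card (MulAction.stabilizer G p) ∧
      (A.val.map r).count (Nat.card (MulAction.stabilizer G p)) = 1 := by
    rcases hcases with ⟨hn, hc⟩ | ⟨hn, hc⟩ | ⟨hn, hc⟩ <;> rw [hc] at hqmem ⊢ <;>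
      simp only [Multiset.insert_eq_cons, Multiset.mem_cons, Multiset.mem_singleton] at hqmem <;>
      rcases h with ⟨h1, h2⟩ | ⟨h1, h2⟩ <;> rw [h1, h2, hn] at hmul <;> rw [h1] at hle ⊢
    all_goals first | omega | exact ⟨by omega, by decide⟩
  exact ⟨key.1, mem_orbit_of_count_eq_one hG hπ hA (by rcases h with h | h <;> omega) key.1 key.2⟩

theorem orbit_eq_tetrahedronVertices [Finite G] (hG : G ≤ automorphismGroup)
    (hfix : ∀ g ∈ G, g (0 : ℂ) = (0 : ℂ) → g ∞ = ∞) (h01 : ∃ g ∈ G, g (0 : ℂ) = (1 : ℂ))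
    (hs : Nat.card (MulAction.stabilizer G ((0 : ℂ) : OnePoint ℂ)) = 3)
    (ho : Nat.card (MulAction.orbit G ((0 : ℂ) : OnePoint ℂ)) = 4) :
    MulAction.orbit G ((0 : ℂ) : OnePoint ℂ) = tetrahedronVertices := by
  have hscale := (stabilizer_zero hG hfix hs).2
  obtain ⟨g, hg, hg1⟩ := h01
  symm
  refine eq_of_subset_of_ncard_le ?_ ?_ (finite_of_ncard_ne_zero ?_)
  · rintro x (rfl | ⟨c, hc, rfl⟩)
    · exact MulAction.mem_orbit_self _
    · obtain ⟨h, hh, -, hz⟩ := hscale c hc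
      exact mem_orbit_iff.2 ⟨h * g, mul_mem hh hg, by rw [Equiv.Perm.mul_apply, hg1, hz]⟩
  · rw [ncard_tetrahedronVertices, ← Nat.card_coe_set_eq, ho]
  · rw [← Nat.card_coe_set_eq, ho]; norm_num

theorem orbit_eq_octahedronVertices [Finite G] (hG : G ≤ automorphismGroup)
    (hfix : ∀ g ∈ G, g (0 : ℂ) = (0 : ℂ) → g ∞ = ∞) (h01 : ∃ g ∈ G, g (0 : ℂ) = (1 : ℂ))
    (hs : Nat.card (MulAction.stabilizer G ((0 : ℂ) : OnePoint ℂ)) = 4)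
    (ho : Nat.card (MulAction.orbit G ((0 : ℂ) : OnePoint ℂ)) = 6) :
    MulAction.orbit G ((0 : ℂ) : OnePoint ℂ) = octahedronVertices := by
  have hscale := (stabilizer_zero hG hfix hs).2
  obtain ⟨g, hg, hg1⟩ := h01
  symm
  refine eq_of_subset_of_ncard_le ?_ ?_ (finite_of_ncard_ne_zero ?_)
  · rintro x (rfl | rfl | ⟨c, hc, rfl⟩)
    · exact (mem_orbit_of_fixed hG (Or.inl ⟨hs, ho⟩) hfix).2
    · exact MulAction.mem_orbit_self _
    · obtain ⟨h, hh, -, hz⟩ := hscale c hc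
      exact mem_orbit_iff.2 ⟨h * g, mul_mem hh hg, by rw [Equiv.Perm.mul_apply, hg1, hz]⟩
  · rw [ncard_octahedronVertices, ← Nat.card_coe_set_eq, ho]
  · rw [← Nat.card_coe_set_eq, ho]; norm_num

/-- For an icosahedral group with a vertex at `0` and the opposite one at `∞`, the vertices form
two pentagons. If `d` is the vertex opposite to `1`, then the rotation `r` around `1` and `d` maps
the opposite vertices `0`, `∞` to opposite vertices, which yields two equations for `d`. -/
theorem orbit_eq_doublePentagon [Finite G] (hG : G ≤ automorphismGroup)
    (hfix : ∀ g ∈ G, g (0 : ℂ) = (0 : ℂ) → g ∞ = ∞) (h01 : ∃ g ∈ G, g (0 : ℂ) = (1 : ℂ))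
    (hs : Nat.card (MulAction.stabilizer G ((0 : ℂ) : OnePoint ℂ)) = 5)
    (ho : Nat.card (MulAction.orbit G ((0 : ℂ) : OnePoint ℂ)) = 12) :
    ∃ d : ℂ, MulAction.orbit G ((0 : ℂ) : OnePoint ℂ) = doublePentagon d ∧
      (d = zeta5 + zeta5⁻¹ - 1 ∨ d * (zeta5 + zeta5⁻¹ - 1) = 1) := by
  have hscale := (stabilizer_zero hG hfix hs).2
  obtain ⟨g, hg, hg1⟩ := h01
  have hζ5 : zeta5 ^ 5 = 1 := isPrimitiveRoot_zeta5.pow_eq_one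
  have hζ1 : zeta5 ≠ 1 := isPrimitiveRoot_zeta5.ne_one (by norm_num)
  have hζ0 : zeta5 ≠ 0 := ne_zero_of_pow_eq_one (by norm_num) hζ5
  obtain ⟨h, hh, hhinf, hhz⟩ := hscale zeta5 hζ5
  have hh0 : h (0 : ℂ) = (0 : ℂ) := by rw [hhz, mul_zero]
  obtain ⟨hsinf, hinfmem⟩ := mem_orbit_of_fixed hG (Or.inr ⟨hs, ho⟩) hfix
  have hstab : MulAction.stabilizer G ((0 : ℂ) : OnePoint ℂ) =
      MulAction.stabilizer G (∞ : OnePoint ℂ) := by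
    refine Subgroup.eq_of_le_of_card_ge (fun k hk => ?_) hsinf.le
    exact hfix k.1 k.2 hk
  have hfix' : ∀ k ∈ G, k ∞ = ∞ → k (0 : ℂ) = (0 : ℂ) := by
    intro k hk hkinf
    have h1 : (⟨k, hk⟩ : G) ∈ MulAction.stabilizer G (∞ : OnePoint ℂ) := hkinf
    rw [← hstab] at h1
    exact h1
  have hhfix : ∀ x, h x = x → x = (0 : ℂ) ∨ x = ∞ := by
    intro x hx
    induction x using OnePoint.rec with
    | infty => exact Or.inr rfl
    | coe z =>
      rw [hhz, OnePoint.coe_eq_coe] at hx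
      have h1 : (zeta5 - 1) * z = 0 := by linear_combination hx
      rw [(mul_eq_zero.1 h1).resolve_left (sub_ne_zero.2 hζ1)]
      exact Or.inl rfl
  -- opposite vertices are mapped to opposite vertices
  have opp1 : ∀ x ∈ G, ∀ y ∈ G, x (0 : ℂ) = y (0 : ℂ) → x ∞ = y ∞ := by
    intro x hx y hy hxy
    have h1 := hfix (y⁻¹ * x) (mul_mem (inv_mem hy) hx)
      (by rw [Equiv.Perm.mul_apply, hxy, perm_inv_apply])
    rw [Equiv.Perm.mul_apply] at h1
    rw [← perm_apply_inv y (x ∞), h1]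
  have swap : ∀ k ∈ G, k (0 : ℂ) = ∞ → k ∞ = (0 : ℂ) := by
    intro k hk hk0
    have h1 : (k * h * k⁻¹) ∞ = ∞ := by
      rw [Equiv.Perm.mul_apply, Equiv.Perm.mul_apply, ← hk0, perm_inv_apply, hh0]
    have h2 := hfix' _ (mul_mem (mul_mem hk hh) (inv_mem hk)) h1
    have h3 : h (k⁻¹ (0 : ℂ)) = k⁻¹ (0 : ℂ) := by
      apply k.injective
      rw [perm_apply_inv]
      exact h2
    rcases hhfix _ h3 with h4 | h4
    · have h5 := congrArg k h4
      rw [perm_apply_inv, hk0] at h5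
      exact absurd h5 (OnePoint.coe_ne_infty _)
    · rw [← h4, perm_apply_inv]
  have opp2 : ∀ x ∈ G, ∀ y ∈ G, x (0 : ℂ) = y ∞ → x ∞ = y (0 : ℂ) := by
    intro x hx y hy hxy
    have h1 := swap (y⁻¹ * x) (mul_mem (inv_mem hy) hx)
      (by rw [Equiv.Perm.mul_apply, hxy, perm_inv_apply])
    rw [Equiv.Perm.mul_apply] at h1
    rw [← perm_apply_inv y (x ∞), h1]
  -- `d` is the vertex opposite to `1`, and `g` has the form `z ↦ (d z + t) / (z + t)`
  obtain ⟨d, hd⟩ : ∃ d : ℂ, g ∞ = d := by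
    refine ⟨_, (coe_finitePart fun h1 => ?_).symm⟩
    have h2 := hfix' g hg h1
    rw [hg1, OnePoint.coe_eq_coe] at h2
    exact one_ne_zero h2
  have hd0 : d ≠ 0 := by
    rintro rfl
    have h1 := opp2 1 (one_mem _) g hg (by rw [hd]; rfl)
    rw [hg1] at h1
    exact OnePoint.infty_ne_coe _ h1
  have hd5 : d ^ 5 ≠ 1 := by
    intro h5
    -- the rotation `z ↦ d z` maps `1` to its opposite `d`, hence `d` to `1`, so that `d = 1`
    obtain ⟨k, hk, hkinf, hkz⟩ := hscale d h5
    have h1 := opp2 (k * g) (mul_mem hk hg) g hg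
      (by rw [Equiv.Perm.mul_apply, hg1, hkz, mul_one, hd])
    rw [Equiv.Perm.mul_apply, hd, hkz, hg1, OnePoint.coe_eq_coe] at h1
    have h2 : d = 1 := by linear_combination h5 - (d ^ 3 + d) * h1
    rw [h2, ← hg1] at hd
    exact OnePoint.infty_ne_coe _ (g.injective hd)
  have horb : MulAction.orbit G ((0 : ℂ) : OnePoint ℂ) = doublePentagon d := by
    symm
    refine eq_of_subset_of_ncard_le ?_ ?_ (finite_of_ncard_ne_zero ?_)
    · obtain ⟨k, hk, hkinf⟩ := mem_orbit_iff.1 hinfmem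
      rintro x (rfl | rfl | ⟨c, hc, rfl⟩ | ⟨c, hc, rfl⟩)
      · exact hinfmem
      · exact MulAction.mem_orbit_self _
      · obtain ⟨h, hh, -, hz⟩ := hscale c hc
        exact mem_orbit_iff.2 ⟨h * g, mul_mem hh hg, by rw [Equiv.Perm.mul_apply, hg1, hz]⟩
      · obtain ⟨h, hh, -, hz⟩ := hscale c hc
        refine mem_orbit_iff.2 ⟨h * g * k, mul_mem (mul_mem hh hg) hk, ?_⟩
        rw [Equiv.Perm.mul_apply, Equiv.Perm.mul_apply, hkinf, hd, hz]
    · rw [ncard_doublePentagon hd0 hd5, ← Nat.card_coe_set_eq, ho]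
    · rw [← Nat.card_coe_set_eq, ho]; norm_num
  refine ⟨d, horb, ?_⟩
  obtain ⟨t, ht0, hgt⟩ : ∃ t : ℂ, t ≠ 0 ∧ ∀ z : ℂ, g z = ratio (d * z + t) (z + t) := by
    obtain ⟨a, b, c, e, hdet, e1, e2⟩ := eq_mobius (hG hg)
    have hc : c ≠ 0 := by
      rintro rfl
      rw [ratio_zero, hd] at e1
      exact OnePoint.coe_ne_infty _ e1
    have e3 := e2 0
    rw [hg1, mul_zero, mul_zero, zero_add, zero_add] at e3
    have he : e ≠ 0 := by
      rintro rfl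
      rw [ratio_zero] at e3
      exact OnePoint.coe_ne_infty _ e3
    rw [ratio_of_ne he, OnePoint.coe_eq_coe, eq_div_iff he, one_mul] at e3
    rw [hd, ratio_of_ne hc, OnePoint.coe_eq_coe, eq_div_iff hc] at e1
    refine ⟨e / c, div_ne_zero he hc, fun z => ?_⟩
    rw [e2, ← e3, ← e1, ← ratio_mul_left hc (d * z + e / c)]
    congr 1 <;> field_simp
  have hd1 : d ≠ 1 := by
    rintro rfl
    exact hd5 (one_pow 5)
  have hdζ : d - zeta5 ≠ 0 := by
    intro h1
    exact hd5 (by rw [sub_eq_zero.1 h1, hζ5])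
  have hζ1' : 1 - zeta5 ≠ 0 := sub_ne_zero.2 hζ1.symm
  set r := g * h * g⁻¹ with hr
  have hrG : r ∈ G := mul_mem (mul_mem hg hh) (inv_mem hg)
  have hgz0 : g⁻¹ (0 : ℂ) = ((-t / d : ℂ) : OnePoint ℂ) := by
    apply g.injective
    have h1 : -t / d + t ≠ 0 := by
      have : -t / d + t = t * (d - 1) / d := by field_simp; ring
      rw [this]
      exact div_ne_zero (mul_ne_zero ht0 (sub_ne_zero.2 hd1)) hd0
    rw [perm_apply_inv, hgt, ratio_of_ne h1, OnePoint.coe_eq_coe]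
    field_simp
    ring
  have hgzinf : g⁻¹ ∞ = ((-t : ℂ) : OnePoint ℂ) := by
    apply g.injective
    rw [perm_apply_inv, hgt, neg_add_cancel, ratio_zero]
  have hr0 : r (0 : ℂ) = ((d * (1 - zeta5) / (d - zeta5) : ℂ) : OnePoint ℂ) := by
    have h1 : zeta5 * (-t / d) + t = t * (d - zeta5) / d := by field_simp; ring
    rw [hr, Equiv.Perm.mul_apply, Equiv.Perm.mul_apply, hgz0, hhz, hgt, h1,
      ratio_of_ne (div_ne_zero (mul_ne_zero ht0 hdζ) hd0), OnePoint.coe_eq_coe]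
    field_simp
    ring
  have hrinf : r ∞ = (((1 - d * zeta5) / (1 - zeta5) : ℂ) : OnePoint ℂ) := by
    have h1 : zeta5 * -t + t = t * (1 - zeta5) := by ring
    rw [hr, Equiv.Perm.mul_apply, Equiv.Perm.mul_apply, hgzinf, hhz, hgt, h1,
      ratio_of_ne (mul_ne_zero ht0 hζ1'), OnePoint.coe_eq_coe]
    field_simp
    ring
  have hr1 : r (1 : ℂ) = (1 : ℂ) := by
    rw [hr, Equiv.Perm.mul_apply, Equiv.Perm.mul_apply, ← hg1, perm_inv_apply, hh0]
  have hrd : r d = d := by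
    rw [hr, Equiv.Perm.mul_apply, Equiv.Perm.mul_apply, ← hd, perm_inv_apply, hhinf]
  have hrmem : r (0 : ℂ) ∈ doublePentagon d := by
    rw [← horb]
    exact mem_orbit_iff.2 ⟨r, hrG, rfl⟩
  rcases hrmem with h1 | h1 | ⟨b, hb, h1⟩ | ⟨b, hb, h1⟩
  · rw [hr0] at h1
    exact absurd h1 (OnePoint.coe_ne_infty _)
  · rw [hr0, OnePoint.coe_eq_coe] at h1
    exact absurd h1 (div_ne_zero (mul_ne_zero hd0 hζ1') hdζ)
  -- `r` maps `0`, `∞` to the opposite vertices `b`, `b d`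
  · right
    have hb1 : b ≠ 1 := by
      rintro rfl
      rw [mul_one, ← hr1] at h1
      exact zero_ne_one (OnePoint.coe_injective (r.injective h1))
    obtain ⟨k, hk, hkinf, hkz⟩ := hscale b hb
    have h2 := opp1 r hrG (k * g) (mul_mem hk hg) (by
      rw [Equiv.Perm.mul_apply k g, hg1, h1, hkz])
    rw [Equiv.Perm.mul_apply k g, hd, hkz, hrinf, OnePoint.coe_eq_coe, div_eq_iff hζ1'] at h2
    rw [hr0, OnePoint.coe_eq_coe, div_eq_iff hdζ] at h1
    have h3 : (zeta5 * b - 1) * ((1 - zeta5) * (b - 1)) = 0 := by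
      linear_combination (b - zeta5 * b + zeta5) * h1 + (1 - zeta5 - b) * h2
    have h4 : zeta5 * b = 1 := by
      have := (mul_eq_zero.1 h3).resolve_right (mul_ne_zero hζ1' (sub_ne_zero.2 hb1))
      linear_combination this
    have h5 : zeta5⁻¹ = b := inv_eq_of_mul_eq_one_right h4
    rw [h5]
    linear_combination (-1) * h1 + h4
  -- `r` maps `0`, `∞` to the opposite vertices `b d`, `b`
  · left
    have hb1 : b ≠ 1 := by
      rintro rfl
      rw [one_mul, ← hrd] at h1
      exact hd0 (OnePoint.coe_injective (r.injective h1)).symm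
    obtain ⟨k, hk, hkinf, hkz⟩ := hscale b hb
    have h2 := opp2 r hrG (k * g) (mul_mem hk hg) (by
      rw [Equiv.Perm.mul_apply k g, hd, h1, hkz])
    rw [Equiv.Perm.mul_apply k g, hg1, hkz, hrinf, OnePoint.coe_eq_coe, div_eq_iff hζ1'] at h2
    rw [hr0, OnePoint.coe_eq_coe, div_eq_iff hdζ] at h1
    have h1' : 1 - zeta5 = b * (d - zeta5) := mul_left_cancel₀ hd0 (by linear_combination h1)
    have h3 : (b - zeta5) * ((1 - zeta5) * (b - 1)) = 0 := by
      linear_combination zeta5 * h1' - b * h2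
    have h4 : b = zeta5 := by
      have := (mul_eq_zero.1 h3).resolve_right (mul_ne_zero hζ1' (sub_ne_zero.2 hb1))
      linear_combination this
    rw [h4] at h2
    have h5 : d = (1 - zeta5 + zeta5 * zeta5) / zeta5 := by
      rw [eq_div_iff hζ0]; linear_combination -h2
    rw [h5]
    field_simp
    ring

/-- The sizes of the stabilizer and of the orbit of a vertex of a regular tetrahedron, octahedron
or icosahedron. -/
def IsVertexData (s o : ℕ) : Prop := (s = 3 ∧ o = 4) ∨ (s = 4 ∧ o = 6) ∨ (s = 5 ∧ o = 12)

/-- The model of the vertex set with `o` elements. -/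
noncomputable def modelVertices (o : ℕ) : Set (OnePoint ℂ) :=
  if o = 4 then tetrahedronVertices else if o = 6 then octahedronVertices else icosahedronVertices

theorem exists_image_orbit_eq_modelVertices [Finite G] (hG : G ≤ automorphismGroup)
    {p : OnePoint ℂ}
    (h : IsVertexData (Nat.card (MulAction.stabilizer G p)) (Nat.card (MulAction.orbit G p))) :
    ∃ φ ∈ automorphismGroup,
      φ '' MulAction.orbit G p = modelVertices (Nat.card (MulAction.orbit G p)) := by
  have ho : 3 ≤ Nat.card (MulAction.orbit G p) := by rcases h with h | h | h <;> omega
  obtain ⟨φ, hφ, hp, hfix, h01⟩ := exists_normalized_conjugate hG ho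
  have hG' := conjugate_le hφ hG
  have : Finite (conjugate φ G) := Finite.Set.finite_image _ _
  have e1 := card_stabilizer_conjugate (G := G) φ p
  have e2 := card_orbit_conjugate (G := G) φ p
  have e3 := orbit_conjugate (G := G) φ p
  rw [hp] at e1 e2 e3
  rcases h with ⟨hs, ho⟩ | ⟨hs, ho⟩ | ⟨hs, ho⟩
  · refine ⟨φ, hφ, ?_⟩
    rw [← e3, orbit_eq_tetrahedronVertices hG' hfix h01 (e1.trans hs) (e2.trans ho), ho,
      modelVertices, if_pos rfl]
  · refine ⟨φ, hφ, ?_⟩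
    rw [← e3, orbit_eq_octahedronVertices hG' hfix h01 (e1.trans hs) (e2.trans ho), ho,
      modelVertices, if_neg (by norm_num), if_pos rfl]
  · obtain ⟨d, hd, h⟩ := orbit_eq_doublePentagon hG' hfix h01 (e1.trans hs) (e2.trans ho)
    have hmodel : modelVertices 12 = doublePentagon (zeta5 + zeta5⁻¹ - 1) := by
      rw [modelVertices, if_neg (by norm_num), if_neg (by norm_num)]; rfl
    rw [ho, hmodel]
    rcases h with rfl | h
    · exact ⟨φ, hφ, by rw [← e3, hd]⟩
    -- `z ↦ c z` maps the pentagons of `1` and `d` to those of `c` and `1`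
    · set c := zeta5 + zeta5⁻¹ - 1
      have hc0 : c ≠ 0 := right_ne_zero_of_mul_eq_one h
      obtain ⟨ψ, hψ, hψinf, hψz⟩ := exists_affine (a := c) (b := 0) hc0
      refine ⟨ψ * φ, mul_mem hψ hφ, ?_⟩
      rw [Equiv.Perm.coe_mul, image_comp, ← e3, hd]
      have himg : ∀ e, ψ '' rootPoints 5 e = rootPoints 5 (e * c) := by
        intro e
        ext x
        constructor
        · rintro ⟨_, ⟨u, hu, rfl⟩, rfl⟩
          exact ⟨u, hu, by rw [hψz]; congr 1; ring⟩
        · rintro ⟨u, hu, rfl⟩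
          exact ⟨_, ⟨u, hu, rfl⟩, by rw [hψz]; congr 1; ring⟩
      rw [doublePentagon, image_insert_eq, image_insert_eq, image_union, himg, himg, hψinf, hψz, h,
        doublePentagon, mul_zero, zero_add, one_mul, union_comm]

/-- Two polyhedral groups of the same type are conjugate. -/
theorem exists_conjugate_eq_of_vertexData {H : Subgroup (Equiv.Perm (OnePoint ℂ))} [Finite G]
    [Finite H] (hG : G ≤ automorphismGroup) (hH : H ≤ automorphismGroup) {p q : OnePoint ℂ}
    {s o : ℕ} (hso : IsVertexData s o)
    (hp : Nat.card (MulAction.stabilizer G p) = s) (hp' : Nat.card (MulAction.orbit G p) = o)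
    (hq : Nat.card (MulAction.stabilizer H q) = s) (hq' : Nat.card (MulAction.orbit H q) = o) :
    ∃ φ ∈ automorphismGroup, conjugate φ G = H := by
  have key : ∀ {G : Subgroup (Equiv.Perm (OnePoint ℂ))} [Finite G] {p : OnePoint ℂ},
      G ≤ automorphismGroup → Nat.card (MulAction.stabilizer G p) = s →
      Nat.card (MulAction.orbit G p) = o →
      ∃ φ ∈ automorphismGroup, conjugate φ G = setStabilizer (modelVertices o) := by
    intro G _ p hG hs ho
    obtain ⟨φ, hφ, h⟩ := exists_image_orbit_eq_modelVertices hG (p := p) (by rwa [hs, ho])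
    refine ⟨φ, hφ, ?_⟩
    have : Finite (conjugate φ G) := Finite.Set.finite_image _ _
    rw [← ho, ← h, ← orbit_conjugate]
    refine eq_setStabilizer_orbit (conjugate_le hφ hG) ?_ ?_
    · rw [card_stabilizer_conjugate, hs]; rcases hso with h | h | h <;> omega
    · rw [card_orbit_conjugate, ho]; rcases hso with h | h | h <;> omega
  obtain ⟨φ, hφ, h1⟩ := key hG hp hp'
  obtain ⟨ψ, hψ, h2⟩ := key hH hq hq'
  refine ⟨ψ⁻¹ * φ, mul_mem (inv_mem hψ) hφ, ?_⟩
  rw [← conjugate_conjugate, h1, ← h2, conjugate_inv_conjugate]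

/-! ### Cyclic and dihedral groups -/

/-- The maps `z ↦ c z` with `c ^ k = 1`. -/
def IsCyclicRotation (k : ℕ) (f : Equiv.Perm (OnePoint ℂ)) : Prop :=
  ∃ c : ℂ, c ^ k = 1 ∧ f ∞ = ∞ ∧ ∀ z : ℂ, f z = (c * z : ℂ)

/-- The maps `z ↦ c / z` with `c ^ k = 1`. -/
def IsInvertedRotation (k : ℕ) (f : Equiv.Perm (OnePoint ℂ)) : Prop :=
  ∃ c : ℂ, c ^ k = 1 ∧ f ∞ = (0 : ℂ) ∧ ∀ z : ℂ, f z = ratio c z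

theorem perm_ext {f g : Equiv.Perm (OnePoint ℂ)} (hinf : f ∞ = g ∞)
    (h : ∀ z : ℂ, f z = g z) : f = g := by
  refine Equiv.ext fun x => ?_
  induction x using OnePoint.rec with
  | infty => exact hinf
  | coe z => exact h z

/-- A scaling composed with `z ↦ 1 / z`. -/
theorem scaling_mul_inversion_apply {f g : Equiv.Perm (OnePoint ℂ)} {c : ℂ}
    (hf : f ∞ = ∞) (hfz : ∀ z : ℂ, f z = (c * z : ℂ)) (hg : g ∞ = (0 : ℂ))
    (hgz : ∀ z : ℂ, g z = ratio 1 z) :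
    (f * g) ∞ = (0 : ℂ) ∧ ∀ z : ℂ, (f * g) z = ratio c z := by
  refine ⟨by rw [Equiv.Perm.mul_apply, hg, hfz, mul_zero], fun z => ?_⟩
  rw [Equiv.Perm.mul_apply, hgz]
  by_cases hz : z = 0
  · rw [hz, ratio_zero, ratio_zero, hf]
  · rw [ratio_of_ne hz, ratio_of_ne hz, hfz]; congr 1; ring

theorem exists_conjugate_cyclic [Finite G] (hG : G ≤ automorphismGroup) {p : OnePoint ℂ}
    (hp : Nat.card (MulAction.stabilizer G p) = Nat.card G) :
    ∃ φ ∈ automorphismGroup, ∀ f, f ∈ conjugate φ G ↔ IsCyclicRotation (Nat.card G) f := by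
  obtain ⟨q, hqp, hq⟩ := exists_second_fixed hG p
  obtain ⟨x, hxp, hxq⟩ := exists_ne_ne p q
  obtain ⟨φ, hφ, h0, hinf, -⟩ := exists_normalizing hqp.symm hxp.symm hxq.symm
  have htop : ∀ g ∈ G, g p = p := by
    intro g hg
    have h1 : MulAction.stabilizer G p = ⊤ := Subgroup.eq_top_of_card_eq _ hp
    have h2 : (⟨g, hg⟩ : G) ∈ MulAction.stabilizer G p := by rw [h1]; trivial
    exact h2
  have hfix0 : ∀ f ∈ conjugate φ G, f (0 : ℂ) = (0 : ℂ) := by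
    rintro _ ⟨g, hg, rfl⟩
    exact conj_apply_eq h0 (htop g hg)
  have hfixinf : ∀ f ∈ conjugate φ G, f ∞ = ∞ := by
    rintro _ ⟨g, hg, rfl⟩
    exact conj_apply_eq hinf (hq g hg (htop g hg))
  have : Finite (conjugate φ G) := Finite.Set.finite_image _ _
  have hcard := card_stabilizer_conjugate (G := G) φ p
  rw [h0, hp] at hcard
  obtain ⟨h1, h2⟩ := stabilizer_zero (conjugate_le hφ hG) (fun g hg _ => hfixinf g hg) hcard
  refine ⟨φ, hφ, fun f => ⟨fun hf => ?_, ?_⟩⟩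
  · obtain ⟨c, hc, hz⟩ := h1 f hf (hfix0 f hf)
    exact ⟨c, hc, hfixinf f hf, hz⟩
  · rintro ⟨c, hc, hfinf, hz⟩
    obtain ⟨g, hg, hginf, hgz⟩ := h2 c hc
    rwa [perm_ext (hfinf.trans hginf.symm) fun z => (hz z).trans (hgz z).symm]

theorem exists_conjugate_dihedral [Finite G] (hG : G ≤ automorphismGroup) {p : OnePoint ℂ} {k : ℕ}
    (hs : Nat.card (MulAction.stabilizer G p) = k) (ho : Nat.card (MulAction.orbit G p) = 2) :
    ∃ φ ∈ automorphismGroup,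
      ∀ f, f ∈ conjugate φ G ↔ IsCyclicRotation k f ∨ IsInvertedRotation k f := by
  -- the orbit is `{p, q}`; a fixed point of an element that exchanges `p` and `q` is moved to `1`
  obtain ⟨q, hqp, horb⟩ : ∃ q, q ≠ p ∧ MulAction.orbit G p = {p, q} := by
    rw [Nat.card_coe_set_eq, ncard_eq_two] at ho
    obtain ⟨x, y, hxy, h⟩ := ho
    have hp : p ∈ ({x, y} : Set (OnePoint ℂ)) := h ▸ MulAction.mem_orbit_self p
    rcases hp with rfl | rfl
    · exact ⟨y, hxy.symm, h⟩
    · exact ⟨x, hxy, by rw [h, pair_comm]⟩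
  have hpq : ∀ g ∈ G, (g p = p ∨ g p = q) ∧ (g q = p ∨ g q = q) := by
    intro g hg
    obtain ⟨k, hk, rfl⟩ := mem_orbit_iff.1 (show q ∈ MulAction.orbit G p by rw [horb]; simp)
    have h1 : g p ∈ MulAction.orbit G p := mem_orbit_iff.2 ⟨g, hg, rfl⟩
    have h2 : g (k p) ∈ MulAction.orbit G p := mem_orbit_iff.2 ⟨g * k, mul_mem hg hk, rfl⟩
    rw [horb] at h1 h2
    exact ⟨h1, h2⟩
  obtain ⟨g₀, hg₀, hg₀p⟩ :=
    mem_orbit_iff.1 (show q ∈ MulAction.orbit G p by rw [horb]; simp)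
  have hg₀q : g₀ q = p := by
    rcases (hpq g₀ hg₀).2 with h | h
    · exact h
    · exact absurd (g₀.injective (h.trans hg₀p.symm)) hqp
  obtain ⟨x, hx⟩ := exists_fixed (hG hg₀)
  have hxp : p ≠ x := by rintro rfl; exact hqp (hg₀p.symm.trans hx)
  have hxq : q ≠ x := by rintro rfl; exact hqp (hx.symm.trans hg₀q)
  obtain ⟨φ, hφ, h0, hinf, h1⟩ := exists_normalizing hqp.symm hxp hxq
  have hG' := conjugate_le hφ hG
  have : Finite (conjugate φ G) := Finite.Set.finite_image _ _
  have hcases : ∀ f ∈ conjugate φ G, (f (0 : ℂ) = (0 : ℂ) ∧ f ∞ = ∞) ∨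
      (f (0 : ℂ) = ∞ ∧ f ∞ = (0 : ℂ)) := by
    rintro _ ⟨g, hg, rfl⟩
    change ((φ * g * φ⁻¹) _ = _ ∧ (φ * g * φ⁻¹) _ = _) ∨ ((φ * g * φ⁻¹) _ = _ ∧ (φ * g * φ⁻¹) _ = _)
    rw [← h0, ← hinf]
    simp only [Equiv.Perm.mul_apply, perm_inv_apply, φ.injective.eq_iff]
    obtain ⟨h1 | h1, h2 | h2⟩ := hpq g hg
    · exact absurd (g.injective (h2.trans h1.symm)) hqp
    · exact Or.inl ⟨h1, h2⟩
    · exact Or.inr ⟨h1, h2⟩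
    · exact absurd (g.injective (h2.trans h1.symm)) hqp
  have hcard := card_stabilizer_conjugate (G := G) φ p
  rw [h0, hs] at hcard
  have hfix : ∀ f ∈ conjugate φ G, f (0 : ℂ) = (0 : ℂ) → f ∞ = ∞ := by
    intro f hf hf0
    rcases hcases f hf with h | h
    · exact h.2
    · exact absurd (hf0.symm.trans h.1) (OnePoint.coe_ne_infty _)
  obtain ⟨hst, hsc⟩ := stabilizer_zero hG' hfix hcard
  set j := φ * g₀ * φ⁻¹ with hj
  have hjG : j ∈ conjugate φ G := ⟨g₀, hg₀, rfl⟩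
  have hj1 : j (1 : ℂ) = (1 : ℂ) := conj_apply_eq h1 hx
  have hj0 : j (0 : ℂ) = ∞ := by
    rw [hj, Equiv.Perm.mul_apply, Equiv.Perm.mul_apply, ← h0, perm_inv_apply, hg₀p, hinf]
  have hjinf : j ∞ = (0 : ℂ) := by
    rw [hj, Equiv.Perm.mul_apply, Equiv.Perm.mul_apply, ← hinf, perm_inv_apply, hg₀q, h0]
  have hjz : ∀ z : ℂ, j z = ratio 1 z := by
    obtain ⟨c, -, hc⟩ := eq_inverted_scaling (hG' hjG) hj0 hjinf
    have h2 := hc 1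
    rw [hj1, ratio_one, OnePoint.coe_eq_coe] at h2
    rwa [← h2] at hc
  have hjj : j * j = 1 := by
    refine eq_of_three (mul_mem (hG' hjG) (hG' hjG)) (one_mem _) (p := ((0 : ℂ) : OnePoint ℂ))
      (q := ∞) (r := ((1 : ℂ) : OnePoint ℂ)) (OnePoint.coe_ne_infty _) (by simp)
      (OnePoint.infty_ne_coe _) ?_ ?_ ?_
    · rw [Equiv.Perm.mul_apply, hj0, hjinf]; rfl
    · rw [Equiv.Perm.mul_apply, hjinf, hj0]; rfl
    · rw [Equiv.Perm.mul_apply, hj1, hj1]; rfl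
  refine ⟨φ, hφ, fun f => ⟨fun hf => ?_, ?_⟩⟩
  · rcases hcases f hf with h | h
    · obtain ⟨c, hc, hz⟩ := hst f hf h.1
      exact Or.inl ⟨c, hc, h.2, hz⟩
    · right
      have hfj : f * j ∈ conjugate φ G := mul_mem hf hjG
      have hfj0 : (f * j) (0 : ℂ) = (0 : ℂ) := by rw [Equiv.Perm.mul_apply, hj0, h.2]
      obtain ⟨c, hc, hz⟩ := hst _ hfj hfj0
      have h3 := scaling_mul_inversion_apply (hfix _ hfj hfj0) hz hjinf hjz
      rw [mul_assoc, hjj, mul_one] at h3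
      exact ⟨c, hc, h3⟩
  · rintro (⟨c, hc, hfinf, hz⟩ | ⟨c, hc, hfinf, hz⟩) <;>
      obtain ⟨g, hg, hginf, hgz⟩ := hsc c hc
    · rwa [perm_ext (hfinf.trans hginf.symm) fun z => (hz z).trans (hgz z).symm]
    · have h3 := scaling_mul_inversion_apply hginf hgz hjinf hjz
      have h4 := mul_mem hg hjG
      rwa [perm_ext (hfinf.trans h3.1.symm) fun z => (hz z).trans (h3.2 z).symm]

/-! ### Isometries of three-space and their action on the sphere -/

/-- The point of `ℂ ∪ {∞}` in the direction of the vector `v ≠ 0` of three-space. -/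
noncomputable def direction (v : E3) : OnePoint ℂ := ratio ⟨v 0, v 1⟩ ((‖v‖ - v 2 : ℝ) : ℂ)

theorem stereo_apply (x : S2) : stereo x = ratio ⟨x.1 0, x.1 1⟩ ((1 - x.1 2 : ℝ) : ℂ) := by
  change stereoFun x = _
  by_cases hx : x = northPole
  · rw [stereoFun, if_pos hx, hx]
    simp [northPole, ratio_zero]
  · have h2 : (1 - x.1 2 : ℝ) ≠ 0 := fun h => hx (eq_northPole (by linarith))
    have h3 : ((1 - x.1 2 : ℝ) : ℂ) ≠ 0 := by exact_mod_cast h2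
    rw [stereoFun, if_neg hx, ratio_of_ne h3]
    congr 1
    apply Complex.ext
    · rw [Complex.div_ofReal_re]
    · rw [Complex.div_ofReal_im]

/-- The point of the unit sphere in the direction of `v`. -/
noncomputable def unitVector (v : E3) (hv : v ≠ 0) : S2 :=
  ⟨‖v‖⁻¹ • v, by rw [mem_sphere_zero_iff_norm, norm_smul, norm_inv, norm_norm,
    inv_mul_cancel₀ (norm_ne_zero_iff.2 hv)]⟩

theorem stereo_unitVector (v : E3) (hv : v ≠ 0) : stereo (unitVector v hv) = direction v := by
  have hn : ‖v‖ ≠ 0 := norm_ne_zero_iff.2 hv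
  have hn' : (((‖v‖)⁻¹ : ℝ) : ℂ) ≠ 0 := by exact_mod_cast inv_ne_zero hn
  rw [stereo_apply, direction, ← ratio_mul_left hn' ⟨v 0, v 1⟩ _]
  congr 1
  · apply Complex.ext <;> simp [unitVector]
  · rw [← Complex.ofReal_mul]
    congr 1
    simp [unitVector, mul_sub, hn]

/-- Directions of vectors of arbitrary length are permuted as the vectors are. -/
theorem isometryAction_direction (ρ : E3 ≃ₗᵢ[ℝ] E3) {v : E3} (hv : v ≠ 0) :
    isometryAction ρ (direction v) = direction (ρ v) := by
  have hρ : ρ v ≠ 0 := by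
    rw [← norm_ne_zero_iff, ρ.norm_map, norm_ne_zero_iff]; exact hv
  rw [← stereo_unitVector v hv, ← stereo_unitVector _ hρ]
  change stereo (isometryOnSphere ρ (stereo.symm (stereo (unitVector v hv)))) = _
  rw [Equiv.symm_apply_apply]
  congr 1
  apply Subtype.ext
  change ρ (‖v‖⁻¹ • v) = ‖ρ v‖⁻¹ • ρ v
  rw [map_smul, ρ.norm_map]

theorem direction_injective {v w : E3} (hv : v ≠ 0) (hvw : ‖v‖ = ‖w‖)
    (h : direction v = direction w) : v = w := by
  have hw : w ≠ 0 := by rw [← norm_ne_zero_iff, ← hvw, norm_ne_zero_iff]; exact hv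
  rw [← stereo_unitVector v hv, ← stereo_unitVector w hw] at h
  have h1 := congrArg Subtype.val (stereo.injective h)
  change ‖v‖⁻¹ • v = ‖w‖⁻¹ • w at h1
  rw [← hvw] at h1
  exact smul_right_injective _ (inv_ne_zero (norm_ne_zero_iff.2 hv)) h1

theorem isometryAction_injective : Function.Injective isometryAction := by
  intro ρ σ h
  apply LinearIsometryEquiv.ext
  intro v
  by_cases hv : v = 0
  · simp [hv]
  · have h1 := isometryAction_direction ρ hv
    rw [h, isometryAction_direction σ hv] at h1
    refine (direction_injective ?_ (by rw [σ.norm_map, ρ.norm_map]) h1).symm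
    rw [← norm_ne_zero_iff, σ.norm_map, norm_ne_zero_iff]; exact hv

theorem direction_infty : direction !₂[0, 0, 1] = ∞ := by
  simp [direction, EuclideanSpace.norm_eq, Fin.sum_univ_three, ratio_zero]

theorem norm_eq_sqrt (v : E3) : ‖v‖ = Real.sqrt (v 0 ^ 2 + v 1 ^ 2 + v 2 ^ 2) := by
  simp [EuclideanSpace.norm_eq, Fin.sum_univ_three]

/-- The vector over `z` in which inverse stereographic projection has no denominators. -/
noncomputable def liftVector (z : ℂ) : E3 :=
  !₂[2 * z.re, 2 * z.im, Complex.normSq z - 1]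

theorem norm_liftVector (z : ℂ) : ‖liftVector z‖ = Complex.normSq z + 1 := by
  rw [norm_eq_sqrt]
  have : (liftVector z) 0 ^ 2 + (liftVector z) 1 ^ 2 + (liftVector z) 2 ^ 2
      = (Complex.normSq z + 1) ^ 2 := by
    simp [liftVector, Complex.normSq_apply]; ring
  rw [this, Real.sqrt_sq]
  positivity [Complex.normSq_nonneg z]

theorem liftVector_ne_zero (z : ℂ) : liftVector z ≠ 0 := by
  rw [← norm_ne_zero_iff, norm_liftVector]
  positivity [Complex.normSq_nonneg z]

theorem direction_liftVector (z : ℂ) : direction (liftVector z) = z := by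
  have h2 : (2 : ℂ) ≠ 0 := two_ne_zero
  rw [direction, norm_liftVector, ← ratio_one z, ← ratio_mul_left h2 z 1]
  congr 1
  · apply Complex.ext <;> simp [liftVector]
  · simp [liftVector]; ring

/-! ### Reflections -/

/-- The reflection in the plane with normal vector `v`. -/
noncomputable abbrev planeReflection (v : E3) : E3 ≃ₗᵢ[ℝ] E3 :=
  (Submodule.span ℝ {v})ᗮ.reflection

/-- The reflection in coordinates. The factor `2 / ‖v‖ ^ 2` enters as a solution `t` of
`t * ‖v‖ ^ 2 = 2`, which keeps divisions out of the computations. -/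
theorem planeReflection_apply {v : E3} {t : ℝ} (ht : t * (v 0 ^ 2 + v 1 ^ 2 + v 2 ^ 2) = 2)
    (x : E3) (i : Fin 3) :
    planeReflection v x i = x i - t * (v 0 * x 0 + v 1 * x 1 + v 2 * x 2) * v i := by
  have h : ‖v‖ ^ 2 = v 0 ^ 2 + v 1 ^ 2 + v 2 ^ 2 := by
    rw [norm_eq_sqrt, Real.sq_sqrt (by positivity)]
  have h0 : v 0 ^ 2 + v 1 ^ 2 + v 2 ^ 2 ≠ 0 := by
    intro h0
    rw [h0, mul_zero] at ht
    norm_num at ht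
  rw [planeReflection, Submodule.reflection_orthogonal_apply, Submodule.reflection_singleton_apply,
    eq_div_iff h0 |>.2 ht]
  simp [h, PiLp.inner_apply, Fin.sum_univ_three]
  ring

theorem det_planeReflection {v : E3} (hv : v ≠ 0) :
    LinearMap.det ((planeReflection v).toLinearEquiv : E3 →ₗ[ℝ] E3) = -1 := by
  have h := Submodule.det_reflection (𝕜 := ℝ) (Submodule.span ℝ {v})ᗮ
  rw [Submodule.orthogonal_orthogonal, finrank_span_singleton hv, pow_one] at h
  exact h

/-- Complex conjugation on the sphere. -/
noncomputable def conjSphere : Equiv.Perm (OnePoint ℂ) where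
  toFun p := p.elim ∞ fun z => ((starRingEnd ℂ z : ℂ) : OnePoint ℂ)
  invFun p := p.elim ∞ fun z => ((starRingEnd ℂ z : ℂ) : OnePoint ℂ)
  left_inv p := by
    induction p using OnePoint.rec with
    | infty => rfl
    | coe z => simp
  right_inv p := by
    induction p using OnePoint.rec with
    | infty => rfl
    | coe z => simp

theorem conjSphere_coe (z : ℂ) : conjSphere z = ((starRingEnd ℂ z : ℂ) : OnePoint ℂ) := rfl

theorem conjSphere_infty : conjSphere ∞ = ∞ := rfl

theorem conjSphere_mul_self : conjSphere * conjSphere = 1 :=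
  Equiv.ext conjSphere.left_inv

theorem conjSphere_ratio (n d : ℂ) :
    conjSphere (ratio n d) = ratio (starRingEnd ℂ n) (starRingEnd ℂ d) := by
  by_cases hd : d = 0
  · simp [hd, ratio_zero, conjSphere_infty]
  · have hd' : starRingEnd ℂ d ≠ 0 := by simpa using hd
    rw [ratio_of_ne hd, ratio_of_ne hd', conjSphere_coe, map_div₀]

theorem conjSphere_conj_mem {f : Equiv.Perm (OnePoint ℂ)} (hf : f ∈ automorphismGroup) :
    conjSphere * f * conjSphere ∈ automorphismGroup := by
  obtain ⟨a, b, c, d, hdet, hinf, hz⟩ := eq_mobius hf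
  obtain ⟨g, hg, hginf, hgz⟩ := exists_mobius (a := starRingEnd ℂ a) (b := starRingEnd ℂ b)
    (c := starRingEnd ℂ c) (d := starRingEnd ℂ d) (by
      rw [← map_mul, ← map_mul, ← map_sub]
      exact (map_ne_zero (starRingEnd ℂ)).2 hdet)
  have : conjSphere * f * conjSphere = g := by
    refine perm_ext ?_ fun z => ?_
    · rw [Equiv.Perm.mul_apply, Equiv.Perm.mul_apply, conjSphere_infty, hinf, conjSphere_ratio,
        hginf]
    · rw [Equiv.Perm.mul_apply, Equiv.Perm.mul_apply, conjSphere_coe, hz, conjSphere_ratio, hgz]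
      simp
  rwa [this]

/-- The reflection in the plane with normal vector `v` acts as the antiholomorphic
transformation `z ↦ (c - ν z̄) / (c z̄ + ν̄)`, where `ν = v₀ + i v₁` and `c = v₂`. -/
theorem exists_planeReflection_eq {v : E3} (hv : v ≠ 0) :
    ∃ f ∈ automorphismGroup, isometryAction (planeReflection v) = f * conjSphere := by
  set ν : ℂ := ⟨v 0, v 1⟩ with hν
  set c : ℂ := (v 2 : ℂ) with hc
  have hN : v 0 ^ 2 + v 1 ^ 2 + v 2 ^ 2 ≠ 0 := by
    have h := norm_ne_zero_iff.2 hv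
    rw [norm_eq_sqrt] at h
    exact fun h0 => h (by rw [h0, Real.sqrt_zero])
  have hνν : ν * starRingEnd ℂ ν + c * c = ((v 0 ^ 2 + v 1 ^ 2 + v 2 ^ 2 : ℝ) : ℂ) := by
    rw [Complex.mul_conj, Complex.normSq_mk]
    push_cast
    ring
  obtain ⟨f, hf, hfinf, hfz⟩ := exists_mobius (a := -ν) (b := c) (c := c) (d := starRingEnd ℂ ν) (by
    intro h
    have : ν * starRingEnd ℂ ν + c * c = 0 := by linear_combination -h
    rw [hνν] at this
    exact hN (Complex.ofReal_eq_zero.1 this))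
  obtain ⟨t, ht⟩ : ∃ t : ℝ, t * (v 0 ^ 2 + v 1 ^ 2 + v 2 ^ 2) = 2 :=
    ⟨2 / (v 0 ^ 2 + v 1 ^ 2 + v 2 ^ 2), div_mul_cancel₀ _ hN⟩
  have ht0 : t ≠ 0 := by
    rintro rfl
    norm_num at ht
  refine ⟨f, hf, perm_ext ?_ fun z => ?_⟩
  · rw [Equiv.Perm.mul_apply, conjSphere_infty, hfinf, ← direction_infty,
      isometryAction_direction _ (by intro h; simpa using congrArg (fun x : E3 => x 2) h),
      direction, LinearIsometryEquiv.norm_map]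
    have hn : ‖(!₂[0, 0, 1] : E3)‖ = 1 := by simp [norm_eq_sqrt]
    rw [hn]
    simp only [planeReflection_apply ht]
    by_cases hc0 : v 2 = 0
    · simp [hc, hc0, ratio_zero]
    -- the homogeneous coordinates differ by the factor `t * v 2`
    · have hk : ((t * v 2 : ℝ) : ℂ) ≠ 0 := Complex.ofReal_ne_zero.2 (mul_ne_zero ht0 hc0)
      rw [← ratio_mul_left hk (-ν) c]
      congr 1
      · apply Complex.ext <;> simp [hν]
      · rw [hc, ← Complex.ofReal_mul]
        congr 1
        simp
  · rw [Equiv.Perm.mul_apply, conjSphere_coe, hfz]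
    conv_lhs => rw [← direction_liftVector z]
    rw [isometryAction_direction _ (liftVector_ne_zero z), direction,
      LinearIsometryEquiv.norm_map, norm_liftVector]
    simp only [planeReflection_apply ht]
    -- the image has the homogeneous coordinates of the claim, multiplied by a factor `k` that may
    -- vanish, in which case both points are `∞`
    set k : ℂ := (t : ℂ) * (c * z + ν) with hk
    set w := liftVector z with hw
    have hw0 : w 0 = 2 * z.re := rfl
    have hw1 : w 1 = 2 * z.im := rfl
    have hw2 : w 2 = z.re * z.re + z.im * z.im - 1 := by
      rw [← Complex.normSq_apply]; rfl
    have e1 : (⟨w 0 - t * (v 0 * w 0 + v 1 * w 1 + v 2 * w 2) * v 0,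
        w 1 - t * (v 0 * w 0 + v 1 * w 1 + v 2 * w 2) * v 1⟩ : ℂ) =
        k * (-ν * starRingEnd ℂ z + c) := by
      rw [hw0, hw1, hw2]
      apply Complex.ext
      · simp [hk, hν, hc]
        linear_combination -z.re * ht
      · simp [hk, hν, hc]
        linear_combination -z.im * ht
    have e2 : ((Complex.normSq z + 1 - (w 2 - t * (v 0 * w 0 + v 1 * w 1 + v 2 * w 2) * v 2) : ℝ)
        : ℂ) = k * (c * starRingEnd ℂ z + starRingEnd ℂ ν) := by
      rw [hw0, hw1, hw2, Complex.normSq_apply]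
      apply Complex.ext
      · simp only [Complex.ofReal_re]
        simp [hk, hν, hc]
        linear_combination -ht
      · simp only [Complex.ofReal_im]
        simp [hk, hν, hc]
        ring
    rw [e1, e2]
    by_cases hz : c * z + ν = 0
    · have h1 : c * starRingEnd ℂ z + starRingEnd ℂ ν = 0 := by
        have := congrArg (starRingEnd ℂ) hz
        simpa [hc] using this
      rw [h1, mul_zero, ratio_zero, ratio_zero]
    · exact ratio_mul_left (mul_ne_zero (Complex.ofReal_ne_zero.2 ht0) hz) _ _

/-- Products of reflections act holomorphically or antiholomorphically, according to their
determinants. -/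
theorem isometryAction_mem {S : Set (E3 ≃ₗᵢ[ℝ] E3)}
    (hS : ∀ s ∈ S, ∃ v : E3, v ≠ 0 ∧ s = planeReflection v) {ρ : E3 ≃ₗᵢ[ℝ] E3}
    (hρ : ρ ∈ Subgroup.closure S ⊓ rotations) : isometryAction ρ ∈ automorphismGroup := by
  have hdet : ∀ a b : E3 ≃ₗᵢ[ℝ] E3, LinearMap.det ((a * b).toLinearEquiv : E3 →ₗ[ℝ] E3) =
      LinearMap.det (a.toLinearEquiv : E3 →ₗ[ℝ] E3) *
        LinearMap.det (b.toLinearEquiv : E3 →ₗ[ℝ] E3) := by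
    intro a b
    rw [← map_mul]; rfl
  have hdet1 : LinearMap.det ((1 : E3 ≃ₗᵢ[ℝ] E3).toLinearEquiv : E3 →ₗ[ℝ] E3) = 1 :=
    LinearMap.det_id
  have key : ∀ ρ ∈ Subgroup.closure S,
      (LinearMap.det (ρ.toLinearEquiv : E3 →ₗ[ℝ] E3) = 1 ∧
        isometryAction ρ ∈ automorphismGroup) ∨
      (LinearMap.det (ρ.toLinearEquiv : E3 →ₗ[ℝ] E3) = -1 ∧
        isometryAction ρ * conjSphere ∈ automorphismGroup) := by
    intro ρ hρ
    induction hρ using Subgroup.closure_induction with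
    | mem s hs =>
      obtain ⟨v, hv, rfl⟩ := hS s hs
      obtain ⟨f, hf, h⟩ := exists_planeReflection_eq hv
      refine Or.inr ⟨det_planeReflection hv, ?_⟩
      rwa [h, mul_assoc, conjSphere_mul_self, mul_one]
    | one => exact Or.inl ⟨hdet1, by rw [map_one]; exact one_mem _⟩
    | mul a b _ _ ha hb =>
      rw [hdet, map_mul]
      rcases ha with ⟨ha, ha'⟩ | ⟨ha, ha'⟩ <;> rcases hb with ⟨hb, hb'⟩ | ⟨hb, hb'⟩
      · exact Or.inl ⟨by rw [ha, hb, one_mul], mul_mem ha' hb'⟩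
      · exact Or.inr ⟨by rw [ha, hb, one_mul], by rw [mul_assoc]; exact mul_mem ha' hb'⟩
      · refine Or.inr ⟨by rw [ha, hb, mul_one], ?_⟩
        have : isometryAction a * isometryAction b * conjSphere = (isometryAction a * conjSphere) *
            (conjSphere * isometryAction b * conjSphere) := by
          rw [mul_assoc conjSphere, ← mul_assoc (isometryAction a * conjSphere),
            mul_assoc _ conjSphere conjSphere,
            conjSphere_mul_self, mul_one, mul_assoc]
        rw [this]
        exact mul_mem ha' (conjSphere_conj_mem hb')
      · refine Or.inl ⟨by rw [ha, hb]; norm_num, ?_⟩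
        have : isometryAction a * isometryAction b = (isometryAction a * conjSphere) *
            (conjSphere * (isometryAction b * conjSphere) * conjSphere) := by
          have e : conjSphere * (isometryAction b * conjSphere) * conjSphere =
              conjSphere * isometryAction b := by
            rw [mul_assoc, mul_assoc, conjSphere_mul_self, mul_one]
          rw [e, mul_assoc, ← mul_assoc conjSphere, conjSphere_mul_self, one_mul]
        rw [this]
        exact mul_mem ha' (conjSphere_conj_mem hb')
    | inv a _ ha =>
      have h1 : LinearMap.det (a.toLinearEquiv : E3 →ₗ[ℝ] E3) *
          LinearMap.det (a⁻¹.toLinearEquiv : E3 →ₗ[ℝ] E3) = 1 := by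
        rw [← hdet, mul_inv_cancel, hdet1]
      rw [map_inv]
      rcases ha with ⟨ha, ha'⟩ | ⟨ha, ha'⟩
      · exact Or.inl ⟨by rw [ha, one_mul] at h1; exact h1, inv_mem ha'⟩
      · refine Or.inr ⟨by rw [ha] at h1; linarith, ?_⟩
        have h2 := conjSphere_conj_mem (inv_mem ha')
        have h3 : conjSphere⁻¹ = conjSphere := inv_eq_of_mul_eq_one_left conjSphere_mul_self
        rwa [mul_inv_rev, h3, ← mul_assoc, conjSphere_mul_self, one_mul] at h2
  rcases key ρ hρ.1 with h | h
  · exact h.2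
  · have h1 : LinearMap.det (ρ.toLinearEquiv : E3 →ₗ[ℝ] E3) = 1 := hρ.2
    rw [h.1] at h1
    norm_num at h1

/-! ### Symmetries of a polyhedron -/

/-- The plane with normal vector `v` is a symmetry plane of the polyhedron with vertex set `V`. -/
def IsMirror (V : Set E3) (v : E3) : Prop := v ≠ 0 ∧ ∀ x ∈ V, planeReflection v x ∈ V

theorem IsMirror.mem_symmetryReflections {V : Set E3} {v : E3} (h : IsMirror V v) :
    planeReflection v ∈ symmetryReflections V := by
  refine ⟨v, h.1, rfl, (image_subset_iff.2 h.2).antisymm fun x hx => ?_⟩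
  exact ⟨_, h.2 x hx, Submodule.reflection_reflection _ x⟩

theorem IsMirror.mul_mem_polyhedronRotationGroup {V : Set E3} {v w : E3} (hv : IsMirror V v)
    (hw : IsMirror V w) :
    planeReflection v * planeReflection w ∈ polyhedronRotationGroup V := by
  refine ⟨MulMemClass.mul_mem (Subgroup.subset_closure hv.mem_symmetryReflections)
    (Subgroup.subset_closure hw.mem_symmetryReflections), ?_⟩
  have h : ((planeReflection v * planeReflection w).toLinearEquiv : E3 →ₗ[ℝ] E3) =
      ((planeReflection v).toLinearEquiv : E3 →ₗ[ℝ] E3) *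
        ((planeReflection w).toLinearEquiv : E3 →ₗ[ℝ] E3) := rfl
  change LinearMap.det _ = 1
  rw [h, map_mul, det_planeReflection hv.1, det_planeReflection hw.1]
  norm_num

theorem apply_mem_of_mem_polyhedronRotationGroup {V : Set E3} {ρ : E3 ≃ₗᵢ[ℝ] E3}
    (hρ : ρ ∈ polyhedronRotationGroup V) {x : E3} (hx : x ∈ V) : ρ x ∈ V := by
  have key : ∀ ρ ∈ Subgroup.closure (symmetryReflections V), ρ '' V = V := by
    intro ρ hρ
    induction hρ using Subgroup.closure_induction with
    | mem s hs => obtain ⟨v, -, -, h⟩ := hs; exact h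
    | one => exact image_id V
    | mul a b _ _ ha hb =>
      have h := image_comp a b V
      rw [hb, ha] at h
      exact h
    | inv a _ ha =>
      have h := image_comp (a⁻¹ : E3 ≃ₗᵢ[ℝ] E3) a V
      rw [ha] at h
      rw [← h]
      exact (image_congr fun x _ => a.symm_apply_apply x).trans (image_id' V)
  have h := mem_image_of_mem ρ hx
  rwa [key ρ hρ.1] at h

/-- The rotation group of the polyhedron with vertex set `V`, acting on `ℂ ∪ {∞}`. -/
noncomputable abbrev sphereGroup (V : Set E3) : Subgroup (Equiv.Perm (OnePoint ℂ)) :=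
  (polyhedronRotationGroup V).map isometryAction

theorem sphereGroup_le (V : Set E3) : sphereGroup V ≤ automorphismGroup := by
  rintro _ ⟨ρ, hρ, rfl⟩
  exact isometryAction_mem (S := symmetryReflections V)
    (fun _ ⟨v, hv, hs, _⟩ => ⟨v, hv, hs⟩) hρ

theorem orbit_subset {V : Set E3} {p : E3} (hp : p ∈ V) (hp0 : p ≠ 0) :
    MulAction.orbit (sphereGroup V) (direction p) ⊆ direction '' V := by
  intro x hx
  obtain ⟨_, ⟨ρ, hρ, rfl⟩, rfl⟩ := mem_orbit_iff.1 hx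
  exact ⟨ρ p, apply_mem_of_mem_polyhedronRotationGroup hρ hp,
    (isometryAction_direction ρ hp0).symm⟩

theorem three_le_card_orbit {V : Set E3} (hV : V.Finite) {p : E3} (hp : p ∈ V) (hp0 : p ≠ 0)
    {σ τ : E3 ≃ₗᵢ[ℝ] E3} (hσ : σ ∈ polyhedronRotationGroup V)
    (hτ : τ ∈ polyhedronRotationGroup V) (h1 : σ p ≠ p) (h2 : τ p ≠ p) (h3 : σ p ≠ τ p) :
    3 ≤ Nat.card (MulAction.orbit (sphereGroup V) (direction p)) := by
  have hmem : ∀ ρ ∈ polyhedronRotationGroup V,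
      direction (ρ p) ∈ MulAction.orbit (sphereGroup V) (direction p) := fun ρ hρ =>
    mem_orbit_iff.2 ⟨_, ⟨ρ, hρ, rfl⟩, isometryAction_direction ρ hp0⟩
  have hne : ∀ ρ : E3 ≃ₗᵢ[ℝ] E3, ρ p ≠ 0 := fun ρ => by
    rw [← norm_ne_zero_iff, ρ.norm_map, norm_ne_zero_iff]; exact hp0
  rw [Nat.card_coe_set_eq]
  refine (Set.two_lt_ncard_iff ((hV.image _).subset (orbit_subset hp hp0))).2
    ⟨_, _, _, MulAction.mem_orbit_self _, hmem σ hσ, hmem τ hτ, fun h => ?_, fun h => ?_,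
      fun h => ?_⟩
  · exact h1 (direction_injective hp0 (σ.norm_map p).symm h).symm
  · exact h2 (direction_injective hp0 (τ.norm_map p).symm h).symm
  · exact h3 (direction_injective (hne σ) ((σ.norm_map p).trans (τ.norm_map p).symm) h)

/-- The group preserves the set of directions of the vertices, which is finite and has at least
three points. -/
theorem finite_sphereGroup {V : Set E3} (hV : V.Finite) (hV0 : ∀ x ∈ V, x ≠ 0)
    {p : E3} (hp : p ∈ V)
    (h : 3 ≤ Nat.card (MulAction.orbit (sphereGroup V) (direction p))) :
    Finite (sphereGroup V) := by
  have h3 : 3 ≤ (direction '' V).ncard := by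
    rw [Nat.card_coe_set_eq] at h
    exact h.trans (ncard_le_ncard (orbit_subset hp (hV0 p hp)) (hV.image _))
  have hfin := finite_setStabilizer (hV.image direction) h3
  refine Finite.Set.subset (setStabilizer (direction '' V) : Set (Equiv.Perm (OnePoint ℂ))) ?_
  have hsub : ∀ f ∈ sphereGroup V, f '' (direction '' V) ⊆ direction '' V := by
    rintro _ ⟨ρ, hρ, rfl⟩ _ ⟨_, ⟨x, hx, rfl⟩, rfl⟩
    rw [isometryAction_direction ρ (hV0 x hx)]
    exact ⟨_, apply_mem_of_mem_polyhedronRotationGroup hρ hx, rfl⟩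
  intro f hf
  refine ⟨sphereGroup_le V hf, (hsub f hf).antisymm fun x hx => ?_⟩
  exact ⟨f⁻¹ x, hsub _ (inv_mem hf) ⟨x, hx, rfl⟩, perm_apply_inv f x⟩

/-- A rotation fixing a vertex has the same order as an element of the stabilizer, because the
action is faithful. -/
theorem orderOf_dvd_card_stabilizer {V : Set E3} [Finite (sphereGroup V)] {p : E3} (hp0 : p ≠ 0)
    {ρ : E3 ≃ₗᵢ[ℝ] E3} (hρ : ρ ∈ polyhedronRotationGroup V) (h : ρ p = p) :
    orderOf ρ ∣ Nat.card (MulAction.stabilizer (sphereGroup V) (direction p)) := by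
  set g : MulAction.stabilizer (sphereGroup V) (direction p) :=
    ⟨⟨isometryAction ρ, ρ, hρ, rfl⟩, by
      change isometryAction ρ (direction p) = direction p
      rw [isometryAction_direction ρ hp0, h]⟩ with hg
  have h1 : orderOf g = orderOf ρ := by
    rw [← orderOf_injective isometryAction isometryAction_injective,
      ← orderOf_injective (Subgroup.subtype _) (Subgroup.subtype_injective _),
      ← orderOf_injective (Subgroup.subtype _) (Subgroup.subtype_injective _)]
    rfl
  rw [← h1]
  exact orderOf_dvd_natCard g

/-! ### The pyramid and the dihedron -/

/-- The vector with horizontal part of length `1` and argument `2 π j / k`, and height `h`. -/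
noncomputable def baseVertex (k j : ℕ) (h : ℝ) : E3 :=
  !₂[Real.cos (2 * Real.pi * j / k), Real.sin (2 * Real.pi * j / k), h]

/-- A normal vector of the vertical plane at angle `π m / k`. -/
noncomputable def verticalNormal (k m : ℕ) : E3 :=
  !₂[-Real.sin (Real.pi * m / k), Real.cos (Real.pi * m / k), 0]

/-- The `k`-th root of unity with argument `2 π j / k`. -/
noncomputable def rootOfUnity (k j : ℕ) : ℂ :=
  ⟨Real.cos (2 * Real.pi * j / k), Real.sin (2 * Real.pi * j / k)⟩

theorem rootOfUnity_eq (k j : ℕ) :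
    rootOfUnity k j = Complex.exp (2 * Real.pi * Complex.I / k) ^ j := by
  rw [← Complex.exp_nat_mul]
  have h : (j : ℂ) * (2 * Real.pi * Complex.I / k) =
      ((2 * Real.pi * j / k : ℝ) : ℂ) * Complex.I := by
    push_cast; ring
  rw [h, Complex.exp_mul_I]
  apply Complex.ext
  · simp [rootOfUnity, Complex.cos_ofReal_re, Complex.sin_ofReal_im, -Complex.ofReal_div,
      -Complex.ofReal_mul]
  · simp [rootOfUnity, Complex.cos_ofReal_im, Complex.sin_ofReal_re, -Complex.ofReal_div,
      -Complex.ofReal_mul]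

theorem pow_eq_one_iff_rootOfUnity {k : ℕ} (hk : k ≠ 0) {c : ℂ} :
    c ^ k = 1 ↔ ∃ j, c = rootOfUnity k j := by
  have h := Complex.isPrimitiveRoot_exp k hk
  have : NeZero k := ⟨hk⟩
  constructor
  · intro hc
    obtain ⟨j, -, hj⟩ := h.eq_pow_of_pow_eq_one hc
    exact ⟨j, by rw [rootOfUnity_eq, hj]⟩
  · rintro ⟨j, rfl⟩
    rw [rootOfUnity_eq, ← pow_mul, mul_comm j, pow_mul, h.pow_eq_one, one_pow]

theorem norm_baseVertex (k j : ℕ) (h : ℝ) : ‖baseVertex k j h‖ = Real.sqrt (1 + h ^ 2) := by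
  rw [norm_eq_sqrt]
  congr 1
  simp [baseVertex]

theorem norm_vertical (a : ℝ) : ‖(!₂[0, 0, a] : E3)‖ = |a| := by
  simp [norm_eq_sqrt, Real.sqrt_sq_eq_abs]

theorem direction_vertical_pos {a : ℝ} (ha : 0 < a) : direction !₂[0, 0, a] = ∞ := by
  rw [direction, norm_vertical, abs_of_pos ha]
  simp [ratio_zero]

theorem direction_vertical_neg {a : ℝ} (ha : 0 < a) : direction !₂[0, 0, -a] = (0 : ℂ) := by
  have h : ((2 * a : ℝ) : ℂ) ≠ 0 := Complex.ofReal_ne_zero.2 (by positivity)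
  have h0 : (⟨0, 0⟩ : ℂ) = 0 := rfl
  rw [direction, norm_vertical, abs_neg, abs_of_pos ha]
  have e : a - (!₂[0, 0, -a] : E3) 2 = 2 * a := by simp; ring
  rw [e, ratio_of_ne h]
  simp [h0]

theorem vertical_ne_zero {a : ℝ} (ha : a ≠ 0) : (!₂[0, 0, a] : E3) ≠ 0 := by
  rw [← norm_ne_zero_iff, norm_vertical]
  exact abs_ne_zero.2 ha

/-- The absolute value of the stereographic projection of a base vertex. -/
noncomputable def baseRadius (h : ℝ) : ℂ := (((Real.sqrt (1 + h ^ 2) - h)⁻¹ : ℝ) : ℂ)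

theorem sqrt_sub_pos (h : ℝ) : 0 < Real.sqrt (1 + h ^ 2) - h := by
  have h1 : |h| < Real.sqrt (1 + h ^ 2) := by
    rw [← Real.sqrt_sq_eq_abs]
    exact Real.sqrt_lt_sqrt (sq_nonneg h) (by linarith)
  linarith [le_abs_self h]

theorem baseRadius_ne_zero (h : ℝ) : baseRadius h ≠ 0 :=
  Complex.ofReal_ne_zero.2 (inv_ne_zero (sqrt_sub_pos h).ne')

theorem baseRadius_zero : baseRadius 0 = 1 := by simp [baseRadius]

theorem direction_baseVertex (k j : ℕ) (h : ℝ) :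
    direction (baseVertex k j h) = (rootOfUnity k j * baseRadius h : ℂ) := by
  rw [direction, norm_baseVertex]
  have e : Real.sqrt (1 + h ^ 2) - baseVertex k j h 2 = Real.sqrt (1 + h ^ 2) - h := rfl
  rw [e, ratio_of_ne (Complex.ofReal_ne_zero.2 (sqrt_sub_pos h).ne'), baseRadius,
    Complex.ofReal_inv, div_eq_mul_inv]
  rfl

theorem baseVertex_ne_zero (k j : ℕ) (h : ℝ) : baseVertex k j h ≠ 0 := by
  rw [← norm_ne_zero_iff, norm_baseVertex]
  exact (Real.sqrt_pos.2 (by positivity)).ne'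

theorem rootOfUnity_zero (k : ℕ) : rootOfUnity k 0 = 1 := by
  apply Complex.ext <;> simp [rootOfUnity]

/-- An automorphism induced by a rotation around the vertical axis. -/
theorem isometryAction_of_fixes_vertical {ρ : E3 ≃ₗᵢ[ℝ] E3}
    (hρ : isometryAction ρ ∈ automorphismGroup) {a : ℝ} (ha : 0 < a)
    (h1 : ρ !₂[0, 0, a] = !₂[0, 0, a]) {k m : ℕ} {h : ℝ}
    (h2 : ρ (baseVertex k 0 h) = baseVertex k m h) :
    isometryAction ρ ∞ = ∞ ∧ ∀ z : ℂ, isometryAction ρ z = (rootOfUnity k m * z : ℂ) := by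
  have hinf : isometryAction ρ ∞ = ∞ := by
    rw [← direction_vertical_pos ha, isometryAction_direction ρ (vertical_ne_zero ha.ne'), h1]
  have h3 : ρ !₂[0, 0, -a] = !₂[0, 0, -a] := by
    have e : (!₂[0, 0, -a] : E3) = -!₂[0, 0, a] := by
      ext i; fin_cases i <;> simp
    rw [e, map_neg, h1]
  have h0 : isometryAction ρ (0 : ℂ) = (0 : ℂ) := by
    rw [← direction_vertical_neg ha,
      isometryAction_direction ρ (vertical_ne_zero (neg_ne_zero.2 ha.ne')), h3]
  obtain ⟨c, -, hc⟩ := exists_scaling hρ hinf h0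
  have h4 := isometryAction_direction ρ (baseVertex_ne_zero k 0 h)
  rw [h2, direction_baseVertex, direction_baseVertex, hc, OnePoint.coe_eq_coe, rootOfUnity_zero,
    one_mul] at h4
  rw [mul_right_cancel₀ (baseRadius_ne_zero h) h4] at hc
  exact ⟨hinf, hc⟩

/-- An automorphism induced by a half-turn around a horizontal axis. -/
theorem isometryAction_of_inverts_vertical {ρ : E3 ≃ₗᵢ[ℝ] E3}
    (hρ : isometryAction ρ ∈ automorphismGroup) {a : ℝ} (ha : 0 < a)
    (h1 : ρ !₂[0, 0, a] = !₂[0, 0, -a]) {k m : ℕ}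
    (h2 : ρ (baseVertex k 0 0) = baseVertex k m 0) :
    isometryAction ρ ∞ = (0 : ℂ) ∧ ∀ z : ℂ, isometryAction ρ z = ratio (rootOfUnity k m) z := by
  have e : (!₂[0, 0, -a] : E3) = -!₂[0, 0, a] := by
    ext i; fin_cases i <;> simp
  have hinf : isometryAction ρ ∞ = (0 : ℂ) := by
    rw [← direction_vertical_pos ha, isometryAction_direction ρ (vertical_ne_zero ha.ne'), h1,
      direction_vertical_neg ha]
  have h3 : ρ !₂[0, 0, -a] = !₂[0, 0, a] := by
    rw [e, map_neg, h1, e, neg_neg]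
  have h0 : isometryAction ρ (0 : ℂ) = ∞ := by
    rw [← direction_vertical_neg ha,
      isometryAction_direction ρ (vertical_ne_zero (neg_ne_zero.2 ha.ne')), h3,
      direction_vertical_pos ha]
  obtain ⟨c, -, hc⟩ := eq_inverted_scaling hρ h0 hinf
  have h4 := isometryAction_direction ρ (baseVertex_ne_zero k 0 0)
  rw [h2, direction_baseVertex, direction_baseVertex, hc, rootOfUnity_zero, baseRadius_zero,
    mul_one, mul_one, ratio_one, OnePoint.coe_eq_coe] at h4
  rw [h4] at hc
  exact ⟨hinf, hc⟩

theorem planeReflection_verticalNormal (k m : ℕ) (x : E3) :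
    planeReflection (verticalNormal k m) x =
      !₂[Real.cos (2 * Real.pi * m / k) * x 0 + Real.sin (2 * Real.pi * m / k) * x 1,
        Real.sin (2 * Real.pi * m / k) * x 0 - Real.cos (2 * Real.pi * m / k) * x 1, x 2] := by
  have e : 2 * Real.pi * m / k = 2 * (Real.pi * m / k) := by ring
  have hs := Real.sin_sq_add_cos_sq (Real.pi * m / k)
  rw [e, Real.cos_two_mul, Real.sin_two_mul]
  ext i
  rw [planeReflection_apply (t := 2) (by simp [verticalNormal])]
  fin_cases i
  · simp [verticalNormal]
    linear_combination -2 * x 0 * hs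
  · simp [verticalNormal]
    ring
  · simp [verticalNormal]

theorem planeReflection_verticalNormal_vertical (k m : ℕ) (a : ℝ) :
    planeReflection (verticalNormal k m) !₂[0, 0, a] = !₂[0, 0, a] := by
  rw [planeReflection_verticalNormal]
  ext i; fin_cases i <;> simp

/-- The vertex at angle `2 π j / k` is moved to the angle `2 π (m - j) / k`; the index
`m + (k - 1) * j` is a natural number congruent to `m - j` modulo `k`. -/
theorem planeReflection_verticalNormal_baseVertex {k : ℕ} (hk : k ≠ 0) (m j : ℕ) (h : ℝ) :
    planeReflection (verticalNormal k m) (baseVertex k j h) =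
      baseVertex k (m + (k - 1) * j) h := by
  have hk' : (k : ℝ) ≠ 0 := Nat.cast_ne_zero.2 hk
  have e : 2 * Real.pi * (m + (k - 1) * j : ℕ) / k =
      2 * Real.pi * m / k - 2 * Real.pi * j / k + j * (2 * Real.pi) := by
    rw [Nat.cast_add, Nat.cast_mul, Nat.cast_pred (Nat.pos_of_ne_zero hk)]
    field_simp
    ring
  rw [planeReflection_verticalNormal, baseVertex, baseVertex, e, Real.cos_add_nat_mul_two_pi,
    Real.sin_add_nat_mul_two_pi, Real.cos_sub, Real.sin_sub]
  ext i
  fin_cases i <;> simp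

theorem planeReflection_axis₂ (x : E3) :
    planeReflection !₂[0, 0, 1] x = !₂[x 0, x 1, -x 2] := by
  ext i
  rw [planeReflection_apply (t := 2) (by simp)]
  fin_cases i <;> simp
  ring

theorem verticalNormal_ne_zero (k m : ℕ) : verticalNormal k m ≠ 0 := by
  rw [← norm_ne_zero_iff, norm_eq_sqrt]
  simp [verticalNormal]

theorem isMirror_pyramid {k : ℕ} (hk : k ≠ 0) (m : ℕ) :
    IsMirror (pyramid k) (verticalNormal k m) := by
  refine ⟨verticalNormal_ne_zero k m, ?_⟩
  rintro x (⟨j, rfl⟩ | rfl)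
  · exact Or.inl ⟨_, planeReflection_verticalNormal_baseVertex hk m j (-1)⟩
  · exact Or.inr (planeReflection_verticalNormal_vertical k m 3)

theorem isMirror_dihedron {k : ℕ} (hk : k ≠ 0) (m : ℕ) :
    IsMirror (dihedron k) (verticalNormal k m) := by
  refine ⟨verticalNormal_ne_zero k m, ?_⟩
  rintro x (⟨j, rfl⟩ | rfl | rfl)
  · exact Or.inl ⟨_, planeReflection_verticalNormal_baseVertex hk m j 0⟩
  · exact Or.inr (Or.inl (planeReflection_verticalNormal_vertical k m 2))
  · exact Or.inr (Or.inr (planeReflection_verticalNormal_vertical k m (-2)))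

theorem isMirror_dihedron_horizontal (k : ℕ) : IsMirror (dihedron k) !₂[0, 0, 1] := by
  refine ⟨vertical_ne_zero one_ne_zero, ?_⟩
  rintro x (⟨j, rfl⟩ | rfl | rfl) <;> rw [planeReflection_axis₂]
  · exact Or.inl ⟨j, by simp⟩
  · exact Or.inr (Or.inr (by simp))
  · exact Or.inr (Or.inl (by simp))

/-- The apex is fixed by every symmetry, since its norm differs from that of the base vertices. -/
theorem mem_sphereGroup_pyramid_iff {k : ℕ} (hk : k ≠ 0) {f : Equiv.Perm (OnePoint ℂ)} :
    f ∈ sphereGroup (pyramid k) ↔ IsCyclicRotation k f := by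
  constructor
  · intro hf
    have haut := sphereGroup_le _ hf
    obtain ⟨ρ, hρ, rfl⟩ := hf
    have hapex : ρ !₂[0, 0, 3] = !₂[0, 0, 3] := by
      rcases apply_mem_of_mem_polyhedronRotationGroup hρ (x := !₂[0, 0, 3]) (Or.inr rfl) with
        ⟨j, h⟩ | h
      · have h1 := congrArg norm h
        rw [ρ.norm_map, norm_vertical] at h1
        have h2 := norm_baseVertex k j (-1)
        change ‖(!₂[_, _, _] : E3)‖ = _ at h2
        rw [← h1] at h2
        have h3 := congrArg (· ^ 2) h2
        simp only [Real.sq_sqrt (show (0 : ℝ) ≤ 1 + (-1) ^ 2 by norm_num)] at h3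
        norm_num at h3
      · exact h
    rcases apply_mem_of_mem_polyhedronRotationGroup hρ (x := baseVertex k 0 (-1))
      (Or.inl ⟨0, rfl⟩) with ⟨j, h⟩ | h
    · obtain ⟨h1, h2⟩ := isometryAction_of_fixes_vertical haut three_pos hapex h
      exact ⟨_, (pow_eq_one_iff_rootOfUnity hk).2 ⟨j, rfl⟩, h1, h2⟩
    · have h1 := congrArg (fun x : E3 => x 2) (ρ.injective (h.trans hapex.symm))
      simp [baseVertex] at h1
      norm_num at h1
  · rintro ⟨c, hc, hinf, hz⟩
    obtain ⟨m, rfl⟩ := (pow_eq_one_iff_rootOfUnity hk).1 hc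
    have hmem := (isMirror_pyramid hk m).mul_mem_polyhedronRotationGroup (isMirror_pyramid hk 0)
    have hmem' := Subgroup.mem_map_of_mem isometryAction hmem
    obtain ⟨h1, h2⟩ := isometryAction_of_fixes_vertical (sphereGroup_le _ hmem') three_pos
      (k := k) (m := m) (h := -1) (by
        rw [LinearIsometryEquiv.coe_mul, Function.comp_apply,
          planeReflection_verticalNormal_vertical, planeReflection_verticalNormal_vertical])
      (by
        rw [LinearIsometryEquiv.coe_mul, Function.comp_apply,
          planeReflection_verticalNormal_baseVertex hk,
          planeReflection_verticalNormal_baseVertex hk]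
        simp)
    rwa [perm_ext (hinf.trans h1.symm) fun z => (hz z).trans (h2 z).symm]

/-- The apexes are fixed or exchanged by every symmetry, since their norm differs from that of the
base vertices. -/
theorem mem_sphereGroup_dihedron_iff {k : ℕ} (hk : k ≠ 0) {f : Equiv.Perm (OnePoint ℂ)} :
    f ∈ sphereGroup (dihedron k) ↔ IsCyclicRotation k f ∨ IsInvertedRotation k f := by
  constructor
  · intro hf
    have haut := sphereGroup_le _ hf
    obtain ⟨ρ, hρ, rfl⟩ := hf
    have hnorm : ∀ j, ‖baseVertex k j 0‖ = 1 := fun j => by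
      rw [norm_baseVertex]; simp
    have hapex : ρ !₂[0, 0, 2] = !₂[0, 0, 2] ∨ ρ !₂[0, 0, 2] = !₂[0, 0, -2] := by
      rcases apply_mem_of_mem_polyhedronRotationGroup hρ (x := !₂[0, 0, 2]) (Or.inr (Or.inl rfl))
        with ⟨j, h⟩ | h
      · have h1 := (congrArg norm h).trans (hnorm j)
        rw [ρ.norm_map, norm_vertical] at h1
        norm_num at h1
      · exact h
    obtain ⟨j, h⟩ : ∃ j, ρ (baseVertex k 0 0) = baseVertex k j 0 := by
      rcases apply_mem_of_mem_polyhedronRotationGroup hρ (x := baseVertex k 0 0)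
        (Or.inl ⟨0, rfl⟩) with h | h | h
      · exact h
      all_goals
        have h1 := congrArg norm h
        rw [ρ.norm_map, norm_vertical, hnorm] at h1
        norm_num at h1
    have hj := (pow_eq_one_iff_rootOfUnity hk).2 ⟨j, rfl⟩
    rcases hapex with hapex | hapex
    · obtain ⟨h1, h2⟩ := isometryAction_of_fixes_vertical haut two_pos hapex h
      exact Or.inl ⟨_, hj, h1, h2⟩
    · obtain ⟨h1, h2⟩ := isometryAction_of_inverts_vertical haut two_pos hapex h
      exact Or.inr ⟨_, hj, h1, h2⟩
  · rintro (⟨c, hc, hinf, hz⟩ | ⟨c, hc, hinf, hz⟩)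
    · obtain ⟨m, rfl⟩ := (pow_eq_one_iff_rootOfUnity hk).1 hc
      have hmem := (isMirror_dihedron hk m).mul_mem_polyhedronRotationGroup (isMirror_dihedron hk 0)
      have hmem' := Subgroup.mem_map_of_mem isometryAction hmem
      obtain ⟨h1, h2⟩ := isometryAction_of_fixes_vertical (sphereGroup_le _ hmem') two_pos
        (k := k) (m := m) (h := 0) (by
          rw [LinearIsometryEquiv.coe_mul, Function.comp_apply,
            planeReflection_verticalNormal_vertical, planeReflection_verticalNormal_vertical])
        (by
          rw [LinearIsometryEquiv.coe_mul, Function.comp_apply,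
            planeReflection_verticalNormal_baseVertex hk,
            planeReflection_verticalNormal_baseVertex hk]
          simp)
      rwa [perm_ext (hinf.trans h1.symm) fun z => (hz z).trans (h2 z).symm]
    · obtain ⟨m, rfl⟩ := (pow_eq_one_iff_rootOfUnity hk).1 hc
      have hmem := (isMirror_dihedron hk m).mul_mem_polyhedronRotationGroup
        (isMirror_dihedron_horizontal k)
      have hmem' := Subgroup.mem_map_of_mem isometryAction hmem
      obtain ⟨h1, h2⟩ := isometryAction_of_inverts_vertical (sphereGroup_le _ hmem') two_pos
        (k := k) (m := m) (by
          have e : planeReflection !₂[0, 0, 1] !₂[0, 0, 2] = !₂[0, 0, -2] := by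
            rw [planeReflection_axis₂]; simp
          rw [LinearIsometryEquiv.coe_mul, Function.comp_apply, e,
            planeReflection_verticalNormal_vertical])
        (by
          have e : planeReflection !₂[0, 0, 1] (baseVertex k 0 0) = baseVertex k 0 0 := by
            rw [planeReflection_axis₂]; simp [baseVertex]
          rw [LinearIsometryEquiv.coe_mul, Function.comp_apply, e,
            planeReflection_verticalNormal_baseVertex hk]
          simp)
      rwa [perm_ext (hinf.trans h1.symm) fun z => (hz z).trans (h2 z).symm]

/-! ### The tetrahedron, the octahedron and the icosahedron -/

theorem planeReflection_eq {v : E3} {t : ℝ} (ht : t * (v 0 ^ 2 + v 1 ^ 2 + v 2 ^ 2) = 2)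
    (x : E3) :
    planeReflection v x = x - (t * (v 0 * x 0 + v 1 * x 1 + v 2 * x 2)) • v := by
  ext i
  rw [planeReflection_apply ht]
  rfl

theorem planeReflection_axis₀ (x : E3) : planeReflection !₂[1, 0, 0] x = !₂[-x 0, x 1, x 2] := by
  rw [planeReflection_eq (t := 2) (by simp)]
  ext i; fin_cases i <;> simp; ring

theorem planeReflection_axis₁ (x : E3) : planeReflection !₂[0, 1, 0] x = !₂[x 0, -x 1, x 2] := by
  rw [planeReflection_eq (t := 2) (by simp)]
  ext i; fin_cases i <;> simp; ring

theorem planeReflection_swap₀₁ (x : E3) :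
    planeReflection !₂[1, -1, 0] x = !₂[x 1, x 0, x 2] := by
  rw [planeReflection_eq (t := 1) (by simp; norm_num)]
  ext i; fin_cases i <;> simp

theorem planeReflection_swap₁₂ (x : E3) :
    planeReflection !₂[0, 1, -1] x = !₂[x 0, x 2, x 1] := by
  rw [planeReflection_eq (t := 1) (by simp; norm_num)]
  ext i; fin_cases i <;> simp

theorem planeReflection_swap₀₂ (x : E3) :
    planeReflection !₂[1, 0, -1] x = !₂[x 2, x 1, x 0] := by
  rw [planeReflection_eq (t := 1) (by simp; norm_num)]
  ext i; fin_cases i <;> simp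

theorem planeReflection_neg_swap₀₁ (x : E3) :
    planeReflection !₂[1, 1, 0] x = !₂[-x 1, -x 0, x 2] := by
  rw [planeReflection_eq (t := 1) (by simp; norm_num)]
  ext i; fin_cases i <;> simp

theorem planeReflection_neg_swap₁₂ (x : E3) :
    planeReflection !₂[0, 1, 1] x = !₂[x 0, -x 2, -x 1] := by
  rw [planeReflection_eq (t := 1) (by simp; norm_num)]
  ext i; fin_cases i <;> simp

theorem isMirror_of_forall {V : Set E3} {v : E3} {F : E3 → E3}
    (h : ∀ x, planeReflection v x = F x) (hv : v 0 ^ 2 + v 1 ^ 2 + v 2 ^ 2 ≠ 0)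
    (hF : ∀ x ∈ V, F x ∈ V) : IsMirror V v := by
  refine ⟨?_, fun x hx => by rw [h]; exact hF x hx⟩
  rintro rfl
  simp at hv

/-- If a rotation of order `n` fixes the vertex `p`, and `p` has at least three images, then the
list of signatures determines the stabilizer and the orbit of `p`. For `n = 3` the number of
vertices excludes the orbits of sizes `8` and `20` of the octahedral and icosahedral groups. -/
theorem card_stabilizer_and_orbit {V : Set E3} (hV : V.Finite) (hV0 : ∀ x ∈ V, x ≠ 0) {p : E3}
    (hp : p ∈ V) {σ τ ρ : E3 ≃ₗᵢ[ℝ] E3} (hσ : σ ∈ polyhedronRotationGroup V)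
    (hτ : τ ∈ polyhedronRotationGroup V) (hρ : ρ ∈ polyhedronRotationGroup V) (h1 : σ p ≠ p)
    (h2 : τ p ≠ p) (h3 : σ p ≠ τ p) (hfix : ρ p = p) {n : ℕ} (hn : orderOf ρ = n)
    (hn' : n = 3 ∧ V.ncard ≤ 4 ∨ n = 4 ∨ n = 5) :
    Finite (sphereGroup V) ∧ Nat.card (MulAction.stabilizer (sphereGroup V) (direction p)) = n ∧
      IsVertexData n (Nat.card (MulAction.orbit (sphereGroup V) (direction p))) := by
  have ho := three_le_card_orbit hV hp (hV0 p hp) hσ hτ h1 h2 h3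
  have hfin := finite_sphereGroup hV hV0 hp ho
  have hs := orderOf_dvd_card_stabilizer (hV0 p hp) hρ hfix
  have hle : Nat.card (MulAction.orbit (sphereGroup V) (direction p)) ≤ V.ncard := by
    rw [Nat.card_coe_set_eq]
    exact (ncard_le_ncard (orbit_subset hp (hV0 p hp)) (hV.image _)).trans (ncard_image_le hV)
  have hmul := card_orbit_mul_card_stabilizer (sphereGroup V) (direction p)
  rw [hn] at hs
  have hs3 : 3 ≤ Nat.card (MulAction.stabilizer (sphereGroup V) (direction p)) := by
    have h := Nat.le_of_dvd Nat.card_pos hs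
    omega
  obtain ⟨π, A, r, -, -, hmem, h⟩ := polyhedral_cases (sphereGroup_le V) hs3 ho
  refine ⟨hfin, ?_⟩
  generalize Nat.card (MulAction.stabilizer (sphereGroup V) (direction p)) = s at *
  generalize Nat.card (MulAction.orbit (sphereGroup V) (direction p)) = o at *
  unfold IsVertexData
  rcases hn' with ⟨rfl, hV4⟩ | rfl | rfl <;>
    rcases h with ⟨hG, hr⟩ | ⟨hG, hr⟩ | ⟨hG, hr⟩ <;> rw [hr] at hmem <;>
    simp only [Multiset.insert_eq_cons, Multiset.mem_cons, Multiset.mem_singleton] at hmem <;>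
    rw [hG] at hmul <;> rcases hmem with rfl | rfl | rfl <;> omega

/-- The rotation of order three around `(1, 1, 1)` permutes the coordinates. -/
theorem exists_vertexData_tetrahedron : Finite (sphereGroup tetrahedron) ∧ ∃ p : OnePoint ℂ,
    Nat.card (MulAction.stabilizer (sphereGroup tetrahedron) p) = 3 ∧
    IsVertexData 3 (Nat.card (MulAction.orbit (sphereGroup tetrahedron) p)) := by
  have m1 : IsMirror tetrahedron !₂[1, -1, 0] := by
    refine isMirror_of_forall planeReflection_swap₀₁ (by simp) ?_
    rintro x (rfl | rfl | rfl | rfl) <;> simp [tetrahedron]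
  have m2 : IsMirror tetrahedron !₂[0, 1, -1] := by
    refine isMirror_of_forall planeReflection_swap₁₂ (by simp) ?_
    rintro x (rfl | rfl | rfl | rfl) <;> simp [tetrahedron]
  have m3 : IsMirror tetrahedron !₂[1, 1, 0] := by
    refine isMirror_of_forall planeReflection_neg_swap₀₁ (by simp) ?_
    rintro x (rfl | rfl | rfl | rfl) <;> simp [tetrahedron]
  have m4 : IsMirror tetrahedron !₂[0, 1, 1] := by
    refine isMirror_of_forall planeReflection_neg_swap₁₂ (by simp) ?_
    rintro x (rfl | rfl | rfl | rfl) <;> simp [tetrahedron]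
  have hρ : ∀ x, (planeReflection !₂[1, -1, 0] * planeReflection !₂[0, 1, -1]) x =
      !₂[x 2, x 0, x 1] := fun x => by
    rw [LinearIsometryEquiv.coe_mul, Function.comp_apply, planeReflection_swap₁₂,
      planeReflection_swap₀₁]
    rfl
  have hσ : ∀ x, (planeReflection !₂[1, 1, 0] * planeReflection !₂[1, -1, 0]) x =
      !₂[-x 0, -x 1, x 2] := fun x => by
    rw [LinearIsometryEquiv.coe_mul, Function.comp_apply, planeReflection_swap₀₁,
      planeReflection_neg_swap₀₁]
    rfl
  have hτ : ∀ x, (planeReflection !₂[0, 1, 1] * planeReflection !₂[0, 1, -1]) x =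
      !₂[x 0, -x 1, -x 2] := fun x => by
    rw [LinearIsometryEquiv.coe_mul, Function.comp_apply, planeReflection_swap₁₂,
      planeReflection_neg_swap₁₂]
    rfl
  have hord : orderOf (planeReflection !₂[1, -1, 0] * planeReflection !₂[0, 1, -1]) = 3 := by
    have := Fact.mk Nat.prime_three
    refine orderOf_eq_prime ?_ fun h => ?_
    · generalize planeReflection _ * planeReflection _ = ρ at hρ ⊢
      ext x i
      simp only [pow_succ, pow_zero, one_mul, LinearIsometryEquiv.coe_mul, Function.comp_apply, hρ]
      fin_cases i <;> rfl
    · have h1 := hρ !₂[1, 0, 0]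
      rw [h] at h1
      simp at h1
  refine (card_stabilizer_and_orbit (V := tetrahedron) (p := !₂[1, 1, 1]) (by simp [tetrahedron])
    ?_ (by simp [tetrahedron]) (m3.mul_mem_polyhedronRotationGroup m1)
    (m4.mul_mem_polyhedronRotationGroup m2) (m1.mul_mem_polyhedronRotationGroup m2)
    ?_ ?_ ?_ ?_ hord (Or.inl ⟨rfl, ?_⟩)).imp_right fun h => ⟨_, h⟩
  · rintro _ (rfl | rfl | rfl | rfl) h <;> simpa using congrArg (fun x : E3 => x 0) h
  · rw [hσ]; simp; norm_num
  · rw [hτ]; simp; norm_num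
  · rw [hσ, hτ]; simp; norm_num
  · rw [hρ]; rfl
  · refine (ncard_insert_le _ _).trans (Nat.succ_le_succ ((ncard_insert_le _ _).trans
      (Nat.succ_le_succ ((ncard_insert_le _ _).trans (by rw [ncard_singleton])))))

/-- The rotation of order four around `(0, 0, 1)` is the quarter turn of the horizontal plane. -/
theorem exists_vertexData_octahedron : Finite (sphereGroup octahedron) ∧ ∃ p : OnePoint ℂ,
    Nat.card (MulAction.stabilizer (sphereGroup octahedron) p) = 4 ∧
    IsVertexData 4 (Nat.card (MulAction.orbit (sphereGroup octahedron) p)) := by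
  have m0 : IsMirror octahedron !₂[1, 0, 0] := by
    refine isMirror_of_forall planeReflection_axis₀ (by simp) ?_
    rintro x (rfl | rfl | rfl | rfl | rfl | rfl) <;> simp [octahedron]
  have m1 : IsMirror octahedron !₂[0, 1, 0] := by
    refine isMirror_of_forall planeReflection_axis₁ (by simp) ?_
    rintro x (rfl | rfl | rfl | rfl | rfl | rfl) <;> simp [octahedron]
  have m2 : IsMirror octahedron !₂[1, -1, 0] := by
    refine isMirror_of_forall planeReflection_swap₀₁ (by simp) ?_
    rintro x (rfl | rfl | rfl | rfl | rfl | rfl) <;> simp [octahedron]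
  have m3 : IsMirror octahedron !₂[1, 0, -1] := by
    refine isMirror_of_forall planeReflection_swap₀₂ (by simp) ?_
    rintro x (rfl | rfl | rfl | rfl | rfl | rfl) <;> simp [octahedron]
  have m4 : IsMirror octahedron !₂[0, 1, -1] := by
    refine isMirror_of_forall planeReflection_swap₁₂ (by simp) ?_
    rintro x (rfl | rfl | rfl | rfl | rfl | rfl) <;> simp [octahedron]
  have hρ : ∀ x, (planeReflection !₂[1, 0, 0] * planeReflection !₂[1, -1, 0]) x =
      !₂[-x 1, x 0, x 2] := fun x => by
    rw [LinearIsometryEquiv.coe_mul, Function.comp_apply, planeReflection_swap₀₁,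
      planeReflection_axis₀]
    rfl
  have hσ : ∀ x, (planeReflection !₂[1, 0, -1] * planeReflection !₂[0, 1, 0]) x =
      !₂[x 2, -x 1, x 0] := fun x => by
    rw [LinearIsometryEquiv.coe_mul, Function.comp_apply, planeReflection_axis₁,
      planeReflection_swap₀₂]
    rfl
  have hτ : ∀ x, (planeReflection !₂[0, 1, -1] * planeReflection !₂[1, 0, 0]) x =
      !₂[-x 0, x 2, x 1] := fun x => by
    rw [LinearIsometryEquiv.coe_mul, Function.comp_apply, planeReflection_axis₀,
      planeReflection_swap₁₂]
    rfl
  have hord : orderOf (planeReflection !₂[1, 0, 0] * planeReflection !₂[1, -1, 0]) = 4 := by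
    have := Fact.mk Nat.prime_two
    refine orderOf_eq_prime_pow (p := 2) (n := 1) (fun h => ?_) ?_
    · generalize planeReflection _ * planeReflection _ = ρ at hρ h
      have h1 := congrArg (fun ρ : E3 ≃ₗᵢ[ℝ] E3 => ρ !₂[1, 0, 0]) h
      simp only [pow_succ, pow_zero, one_mul, LinearIsometryEquiv.coe_mul, Function.comp_apply,
        hρ] at h1
      norm_num at h1
    · rw [show 2 ^ (1 + 1) = 4 from rfl]
      generalize planeReflection _ * planeReflection _ = ρ at hρ ⊢
      ext x i
      simp only [pow_succ, pow_zero, one_mul, LinearIsometryEquiv.coe_mul, Function.comp_apply, hρ]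
      fin_cases i <;> simp
  refine (card_stabilizer_and_orbit (V := octahedron) (p := !₂[0, 0, 1]) (by simp [octahedron])
    ?_ (by simp [octahedron]) (m3.mul_mem_polyhedronRotationGroup m1)
    (m4.mul_mem_polyhedronRotationGroup m0) (m0.mul_mem_polyhedronRotationGroup m2)
    ?_ ?_ ?_ ?_ hord (Or.inr (Or.inl rfl))).imp_right fun h => ⟨_, h⟩
  · rintro _ (rfl | rfl | rfl | rfl | rfl | rfl) h <;> simp at h
  · rw [hσ]; simp
  · rw [hτ]; simp
  · rw [hσ, hτ]; simp
  · rw [hρ]; simp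

theorem mem_icosahedron_iff {x : E3} : x ∈ icosahedron ↔
    (x 0 = 0 ∧ x 1 ^ 2 = 1 ∧ x 2 ^ 2 = Real.goldenRatio ^ 2) ∨
    (x 2 = 0 ∧ x 0 ^ 2 = 1 ∧ x 1 ^ 2 = Real.goldenRatio ^ 2) ∨
    (x 1 = 0 ∧ x 2 ^ 2 = 1 ∧ x 0 ^ 2 = Real.goldenRatio ^ 2) := by
  have e : ∀ y : ℝ, y ^ 2 = 1 ↔ y = 1 ∨ y = -1 := fun y => by
    rw [← sq_eq_sq_iff_eq_or_eq_neg, one_pow]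
  simp only [e, sq_eq_sq_iff_eq_or_eq_neg]
  constructor
  · rintro ⟨a, b, ha, hb, rfl | rfl | rfl⟩ <;> simp [ha, hb]
  · rintro (⟨h0, h1, h2⟩ | ⟨h0, h1, h2⟩ | ⟨h0, h1, h2⟩)
    · refine ⟨_, _, h1, h2, Or.inl ?_⟩
      ext i; fin_cases i <;> simp [h0]
    · refine ⟨_, _, h1, h2, Or.inr (Or.inl ?_)⟩
      ext i; fin_cases i <;> simp [h0]
    · refine ⟨_, _, h1, h2, Or.inr (Or.inr ?_)⟩
      ext i; fin_cases i <;> simp [h0]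

theorem finite_icosahedron : icosahedron.Finite := by
  set S : Set ℝ := {0, 1, -1, Real.goldenRatio, -Real.goldenRatio} with hS
  have hS' : S.Finite := by simp [hS]
  refine ((hS'.prod (hS'.prod hS')).image fun t => (!₂[t.1, t.2.1, t.2.2] : E3)).subset ?_
  rintro _ ⟨a, b, rfl | rfl, rfl | rfl, rfl | rfl | rfl⟩ <;>
    exact ⟨(_, _, _), by simp [hS], rfl⟩

/-- The normal vector is orthogonal to the vertex `(0, 1, φ)` and has norm `2`. -/
theorem planeReflection_golden (x : E3) :
    planeReflection !₂[Real.goldenRatio - 1, Real.goldenRatio, -1] x =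
      !₂[x 0 - (Real.goldenRatio - 1) *
          (((Real.goldenRatio - 1) * x 0 + Real.goldenRatio * x 1 - x 2) / 2),
        x 1 - Real.goldenRatio *
          (((Real.goldenRatio - 1) * x 0 + Real.goldenRatio * x 1 - x 2) / 2),
        x 2 + ((Real.goldenRatio - 1) * x 0 + Real.goldenRatio * x 1 - x 2) / 2] := by
  have h := Real.goldenRatio_sq
  generalize Real.goldenRatio = φ at *
  rw [planeReflection_eq (t := 1 / 2) (by simp; linear_combination h)]
  ext i; fin_cases i <;> simp <;> ring

theorem isMirror_icosahedron_golden :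
    IsMirror icosahedron !₂[Real.goldenRatio - 1, Real.goldenRatio, -1] := by
  have h := Real.goldenRatio_sq
  refine isMirror_of_forall planeReflection_golden (by simp; nlinarith) ?_
  rintro _ ⟨a, b, ha, hb, hx⟩
  rw [mem_icosahedron_iff]
  generalize Real.goldenRatio = φ at *
  rcases ha with rfl | rfl <;> rcases hb with rfl | rfl <;> rcases hx with rfl | rfl | rfl <;>
    simp <;> grind

/-- The product of the reflections with normal vectors `(φ - 1, φ, -1)` and `(1, 0, 0)` is the
rotation by `4 π / 5` around `(0, 1, φ)`. -/
theorem exists_vertexData_icosahedron : Finite (sphereGroup icosahedron) ∧ ∃ p : OnePoint ℂ,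
    Nat.card (MulAction.stabilizer (sphereGroup icosahedron) p) = 5 ∧
    IsVertexData 5 (Nat.card (MulAction.orbit (sphereGroup icosahedron) p)) := by
  have m0 : IsMirror icosahedron !₂[1, 0, 0] := by
    refine isMirror_of_forall planeReflection_axis₀ (by simp) fun x hx => ?_
    rw [mem_icosahedron_iff] at hx ⊢
    simpa using hx
  have m1 : IsMirror icosahedron !₂[0, 1, 0] := by
    refine isMirror_of_forall planeReflection_axis₁ (by simp) fun x hx => ?_
    rw [mem_icosahedron_iff] at hx ⊢
    simpa using hx
  have m2 : IsMirror icosahedron !₂[0, 0, 1] := by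
    refine isMirror_of_forall planeReflection_axis₂ (by simp) fun x hx => ?_
    rw [mem_icosahedron_iff] at hx ⊢
    simpa using hx
  have m3 := isMirror_icosahedron_golden
  have hφ := Real.goldenRatio_sq
  have hφ0 := Real.goldenRatio_pos
  have hρ : ∀ x, (planeReflection !₂[Real.goldenRatio - 1, Real.goldenRatio, -1] *
      planeReflection !₂[1, 0, 0]) x =
      !₂[(-Real.goldenRatio * x 0 - x 1 + (Real.goldenRatio - 1) * x 2) / 2,
        (x 0 + (1 - Real.goldenRatio) * x 1 + Real.goldenRatio * x 2) / 2,
        ((1 - Real.goldenRatio) * x 0 + Real.goldenRatio * x 1 + x 2) / 2] := fun x => by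
    rw [LinearIsometryEquiv.coe_mul, Function.comp_apply, planeReflection_axis₀,
      planeReflection_golden]
    generalize Real.goldenRatio = φ at *
    ext i; fin_cases i <;> simp <;> grind
  have hσ : ∀ x, (planeReflection !₂[1, 0, 0] * planeReflection !₂[0, 1, 0]) x =
      !₂[-x 0, -x 1, x 2] := fun x => by
    rw [LinearIsometryEquiv.coe_mul, Function.comp_apply, planeReflection_axis₁,
      planeReflection_axis₀]
    rfl
  have hτ : ∀ x, (planeReflection !₂[1, 0, 0] * planeReflection !₂[0, 0, 1]) x =
      !₂[-x 0, x 1, -x 2] := fun x => by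
    rw [LinearIsometryEquiv.coe_mul, Function.comp_apply, planeReflection_axis₂,
      planeReflection_axis₀]
    rfl
  have hord : orderOf (planeReflection !₂[Real.goldenRatio - 1, Real.goldenRatio, -1] *
      planeReflection !₂[1, 0, 0]) = 5 := by
    have := Fact.mk Nat.prime_five
    generalize planeReflection _ * planeReflection _ = ρ at hρ ⊢
    generalize Real.goldenRatio = φ at *
    refine orderOf_eq_prime ?_ fun h => ?_
    -- `ρ ^ 2 * ρ ^ 2 * ρ = 1`, with the matrix of `ρ ^ 2` simplified by `φ ^ 2 = φ + 1`
    · have h2 : ∀ x, ρ (ρ x) = !₂[((φ - 1) * x 0 + φ * x 1 - x 2) / 2,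
          (-φ * x 0 + x 1 + (φ - 1) * x 2) / 2, (x 0 + (φ - 1) * x 1 + φ * x 2) / 2] := fun x => by
        rw [hρ, hρ]
        ext i; fin_cases i <;> simp <;> grind
      ext x i
      simp only [pow_succ, pow_zero, one_mul, LinearIsometryEquiv.coe_mul, Function.comp_apply]
      rw [h2, h2, hρ]
      fin_cases i <;> simp <;> grind
    · have h1 := congrArg (fun x : E3 => x 0) (hρ !₂[1, 0, 0])
      rw [h] at h1
      simp at h1
      linarith
  refine (card_stabilizer_and_orbit (V := icosahedron) (p := !₂[0, 1, Real.goldenRatio])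
    finite_icosahedron ?_ ⟨1, _, Or.inl rfl, Or.inl rfl, Or.inl rfl⟩
    (m0.mul_mem_polyhedronRotationGroup m1)
    (m0.mul_mem_polyhedronRotationGroup m2) (m3.mul_mem_polyhedronRotationGroup m0)
    ?_ ?_ ?_ ?_ hord (Or.inr (Or.inr rfl))).imp_right fun h => ⟨_, h⟩
  · rintro x hx rfl
    simp [mem_icosahedron_iff] at hx
  · rw [hσ]; intro h
    have := congrArg (fun x : E3 => x 1) h
    norm_num at this
  · rw [hτ]; intro h
    have := congrArg (fun x : E3 => x 2) h
    simp at this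
    linarith
  · rw [hσ, hτ]; intro h
    have := congrArg (fun x : E3 => x 1) h
    norm_num at this
  · rw [hρ]
    generalize Real.goldenRatio = φ at *
    ext i; fin_cases i <;> simp <;> grind

/-! ### The classification -/

theorem exists_conjugate_eq_rotationGroup {G : Subgroup (Equiv.Perm (OnePoint ℂ))} [Finite G]
    (hG : G ≤ automorphismGroup) (hne : G ≠ ⊥) {π : OnePoint ℂ → OnePoint ℂ}
    {A : Finset (OnePoint ℂ)} {r : OnePoint ℂ → ℕ} (hπ : IsQuotientMap G π)
    (hA : HasSignature π A r) :
    ∃ N : Name, A.val.map r = N.orders ∧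
      ∃ φ ∈ automorphismGroup, conjugate φ G = N.rotationGroup.map isometryAction := by
  have hstab : ∀ s ∈ A.val.map r, ∃ p : OnePoint ℂ, Nat.card (MulAction.stabilizer G p) = s :=
    fun s hs => exists_card_stabilizer_of_mem hG hπ hA hs
  have hmul := card_orbit_mul_card_stabilizer G
  -- in the last three cases `|G|` and the order `n` of the stabilizer determine the orbit size
  have hpoly : ∀ {V : Set E3} {n o : ℕ} {p : OnePoint ℂ},
      (Finite (sphereGroup V) ∧ ∃ q : OnePoint ℂ,
        Nat.card (MulAction.stabilizer (sphereGroup V) q) = n ∧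
        IsVertexData n (Nat.card (MulAction.orbit (sphereGroup V) q))) →
      Nat.card (MulAction.stabilizer G p) = n → Nat.card G = o * n → IsVertexData n o →
      ∃ φ ∈ automorphismGroup, conjugate φ G = sphereGroup V := by
    rintro V n o p ⟨hfin, q, hq, hdata⟩ hp hcard hno
    have ho : Nat.card (MulAction.orbit G p) = o := by
      have h := hmul p
      rw [hp, hcard] at h
      refine Nat.eq_of_mul_eq_mul_right ?_ h
      unfold IsVertexData at hno
      omega
    refine exists_conjugate_eq_of_vertexData hG (sphereGroup_le V) hno hp ho hq ?_
    unfold IsVertexData at hno hdata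
    omega
  rcases signature_cases hG hne hπ hA with h | ⟨k, hk, hn, h⟩ | ⟨hn, h⟩ | ⟨hn, h⟩ | ⟨hn, h⟩
  · obtain ⟨p, hp⟩ := hstab (Nat.card G) (by simp [h])
    obtain ⟨φ, hφ, hf⟩ := exists_conjugate_cyclic hG hp
    exact ⟨.kGon (Nat.card G), h, φ, hφ, Subgroup.ext fun f =>
      (hf f).trans (mem_sphereGroup_pyramid_iff Nat.card_pos.ne').symm⟩
  · obtain ⟨p, hp⟩ := hstab k (by simp [h])
    have ho : Nat.card (MulAction.orbit G p) = 2 := by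
      have h1 := hmul p
      rw [hp, hn] at h1
      exact Nat.eq_of_mul_eq_mul_right (by omega) h1
    obtain ⟨φ, hφ, hf⟩ := exists_conjugate_dihedral hG hp ho
    exact ⟨.dihedron k, h, φ, hφ, Subgroup.ext fun f =>
      (hf f).trans (mem_sphereGroup_dihedron_iff (by omega)).symm⟩
  · obtain ⟨p, hp⟩ := hstab 3 (by simp [h])
    exact ⟨.tetrahedron, h,
      hpoly (o := 4) exists_vertexData_tetrahedron hp hn (by simp [IsVertexData])⟩
  · obtain ⟨p, hp⟩ := hstab 4 (by simp [h])
    exact ⟨.octahedron, h,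
      hpoly (o := 6) exists_vertexData_octahedron hp hn (by simp [IsVertexData])⟩
  · obtain ⟨p, hp⟩ := hstab 5 (by simp [h])
    exact ⟨.icosahedron, h,
      hpoly (o := 12) exists_vertexData_icosahedron hp hn (by simp [IsVertexData])⟩

end RiemannSphere

/-- A nontrivial finite group `G` of automorphisms of the Riemann sphere has a signature, i.e. the
quotient by `G` is realized by a universal branched covering `π` of the Riemann sphere with some
signature `(A, R)`; and for each such `π` and `(A, R)`, the set of orders `R` is one of the sets
with a name, and `G` is conjugate, by an automorphism of the Riemann sphere, to the group of
rotations with the same name. -/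
theorem theorem5 (G : Subgroup (Equiv.Perm (OnePoint ℂ))) [Finite G]
    (hG : G ≤ RiemannSphere.automorphismGroup) (hne : G ≠ ⊥) :
    (∃ (π : OnePoint ℂ → OnePoint ℂ) (A : Finset (OnePoint ℂ)) (r : OnePoint ℂ → ℕ),
      RiemannSphere.IsQuotientMap G π ∧ RiemannSphere.HasSignature π A r) ∧
    ∀ (π : OnePoint ℂ → OnePoint ℂ) (A : Finset (OnePoint ℂ)) (r : OnePoint ℂ → ℕ),
      RiemannSphere.IsQuotientMap G π → RiemannSphere.HasSignature π A r →
      ∃ N : RiemannSphere.Name, A.val.map r = N.orders ∧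
        ∃ φ ∈ RiemannSphere.automorphismGroup,
          G.map (MulAut.conj φ).toMonoidHom = N.rotationGroup.map RiemannSphere.isometryAction := by
  refine ⟨?_, fun π A r hπ hA =>
    RiemannSphere.exists_conjugate_eq_rotationGroup hG hne hπ hA⟩
  obtain ⟨π, hπ⟩ := RiemannSphere.exists_isQuotientMap G hG
  obtain ⟨A, r, hA⟩ := RiemannSphere.exists_hasSignature hG hπ
  exact ⟨π, A, r, hπ, hA⟩
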